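/- **Setting.** Let $W:[0,\infty)^2\to[0,1]$ be a symmetric kernel, let $t:\mathbb{Z}_+\to(0,\infty)$ be increasing, $k\mapsto t_k$, and let $X\in L^2([0,1])$ be real-valued. For an integer $N\ge 1$ put $W_{\{N\}}(u,v)=W(ut_N,vt_N)$, $u,v\in[0,1]$. A graph with $m\ge1$ nodes and its signal are sampled from $(W_{\{N\}},X)$ as follows: $m$ points are drawn independently and uniformly from $[0,1]$ and sorted, $u_1\le\dots\le u_m$; given these, the entries $\mathbf S_m(i,j)$, $1\le i\le j\le m$, are independent with $\mathbf S_m(i,j)\sim\mathrm{Ber}(W_{\{N\}}(u_i,u_j))$ (loops $i=j$ included), $\mathbf S_m(j,i)=\mathbf S_m(i,j)$, and $x_m(i)=X(u_i)$. For $y\in\mathbb{R}^m$ let $I\cdot y=\sum_{i=1}^m y(i)\mathbf 1_{I_i}$ be the step function on $[0,1]$ with $I_i=[\frac{i-1}m,\frac im)$ for $i<m$ and $I_m=[\frac{m-1}m,1]$. Let $h$ be a real polynomial and let $\Delta h(\lambda)=\inf_{k\in\mathbb{R}}\sup_{\lambda}|h(\lambda)-k|$, the supremum being over the eigenvalues $\lambda$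 (zero included, if it is one) of the operator $(T\varphi)(v)=\int_0^1W_{\{N\}}(u,v)\varphi(u)\,du$ on $L^2([0,1])$. Let $L_1=\|W\|_{L^1([0,t_N]^2)}$ and $L_2=\|W\|_{L^2([0,t_N]^2)}$. **Theorem.** Assume 1. $|W(u_1,v_1)-W(u_2,v_2)|\le A_{\mathbb{R}_+}(|u_1-u_2|+|v_1-v_2|)$ for all $u_1,v_1,u_2,v_2\ge 0$; 2. $|X(u_1)-X(u_2)|\le A_s|u_1-u_2|$ for all $u_1,u_2\in[0,1]$; 3. $|h(\lambda)-h(\mu)|\le A_h|\lambda-\mu|$ and $|h(\lambda)|\le1$ for all $\lambda,\mu\in[-1,1]$. Let $N,n\ge1$, and let $(\mathbf S_N,x_N)$ (the large graph) and $(\mathbf S_n,x_n)$ (the downsampled graph) be defined on a common probability space, with an arbitrary joint distribution, each sampled as above from the same $(W_{\{N\}},X)$, with $N$ and $n$ nodes respectively. Put $y_N=h(\mathbf S_N/N)x_N$ and $y_n=h(\mathbf S_n/n)x_n$. Then $\|I\cdot y_N-I\cdot y_n\|_{L^2([0,1])}$ is integrable and $$\mathbb E\|I\cdot y_N-I\cdot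 y_n\|_2\le 2A_h\|X\|_2\left(\frac{\sqrt{L_1-L_2^2}}{t_N}+\frac{A_{\mathbb{R}_+}t_N}{\sqrt{6N}}+\frac{A_{\mathbb{R}_+}t_N}{\sqrt{6n}}\right)+\frac{A_s}{\sqrt6}\left(\frac1{\sqrt N}+\frac1{\sqrt n}\right)+4\,\Delta h(\lambda)\,\|X\|_2 .$$ -/

import Mathlib

open MeasureTheory ProbabilityTheory

noncomputable section

/-- A sparse random graph model: a symmetric kernel on `[0, ∞)²` with values in `[0, 1]`
(only the values at nonnegative arguments matter), an increasing positive scale function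
(only its values at positive integers matter), and a signal in `L²([0, 1])`. -/
structure SparseGraphModel where
  kernel : ℝ → ℝ → ℝ
  kernel_symm : ∀ u v, 0 ≤ u → 0 ≤ v → kernel u v = kernel v u
  kernel_mem : ∀ u v, 0 ≤ u → 0 ≤ v → kernel u v ∈ Set.Icc (0 : ℝ) 1
  scale : ℕ → ℝ
  scale_pos : ∀ n, 0 < n → 0 < scale n
  scale_mono : ∀ m n, 0 < m → m ≤ n → scale m ≤ scale n
  signal : unitInterval → ℝ
  signal_memLp : MemLp signal 2 volume

/-- The graphon on `[0, 1]²` obtained by rescaling the kernel restricted to `[0, t_N]²`. -/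
def SparseGraphModel.graphon (G : SparseGraphModel) (N : ℕ) (u v : unitInterval) : ℝ :=
  G.kernel ((u : ℝ) * G.scale N) ((v : ℝ) * G.scale N)

/-- The `L^p` norm of the kernel on the square `[0, t_N]²`. -/
def SparseGraphModel.kernelNorm (G : SparseGraphModel) (p : ENNReal) (N : ℕ) : ℝ :=
  (eLpNorm (fun z : ℝ × ℝ => G.kernel z.1 z.2) p
    (volume.restrict (Set.Icc 0 (G.scale N) ×ˢ Set.Icc 0 (G.scale N)))).toReal

/-- The `L²([0, 1])` norm of a function. -/
def l2Norm (f : unitInterval → ℝ) : ℝ := (eLpNorm f 2 volume).toReal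

/-- The unordered pairs of vertices, loops included, of a graph with vertices `0, …, m - 1`. -/
abbrev VertexPair (m : ℕ) : Type := {e : Fin m × Fin m // e.1 ≤ e.2}

/-- The outcome of sampling a graph with `m` vertices: the unsorted latent features, and for each
unordered pair of vertices whether it is an edge. Vertex `i` is the one whose latent feature is
the `i`-th smallest. -/
abbrev GraphSample (m : ℕ) : Type := (Fin m → unitInterval) × (VertexPair m → Bool)

/-- The latent features in increasing order. -/
def sortedLatent {m : ℕ} (v : Fin m → unitInterval) : Fin m → unitInterval := v ∘ Tuple.sort v

/-- The probability that a Bernoulli variable with parameter `p` takes the value `b`. -/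
def bernoulliWeight (p : ℝ) (b : Bool) : ENNReal :=
  if b then ENNReal.ofReal p else ENNReal.ofReal (1 - p)

/-- The law of a graph with `m` vertices sampled from the graphon `V`: the latent features are
i.i.d. uniform on `[0, 1]` and, given the features `u_0 ≤ … ≤ u_{m-1}` in increasing order, the
edge indicators of the pairs `i ≤ j` are independent Bernoulli variables with
parameters `V u_i u_j`. -/
def graphSampleLaw (V : unitInterval → unitInterval → ℝ) (m : ℕ) : Measure (GraphSample m) :=
  ((volume : Measure (Fin m → unitInterval)).prod
      (Measure.count : Measure (VertexPair m → Bool))).withDensity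
    fun ω => ∏ e : VertexPair m,
      bernoulliWeight (V (sortedLatent ω.1 e.1.1) (sortedLatent ω.1 e.1.2)) (ω.2 e)

/-- The symmetric adjacency matrix of a sampled graph. -/
def GraphSample.adjacency {m : ℕ} (ω : GraphSample m) : Matrix (Fin m) (Fin m) ℝ :=
  Matrix.of fun i j => if ω.2 ⟨(min i j, max i j), min_le_max⟩ then 1 else 0

/-- The graph signal read off the signal function `X` at the sorted latent features. -/
def GraphSample.graphSignal {m : ℕ} (ω : GraphSample m) (X : unitInterval → ℝ) : Fin m → ℝ :=
  fun i => X (sortedLatent ω.1 i)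

/-- The graph convolution `h(S / m) x`. -/
def GraphSample.convolution {m : ℕ} (ω : GraphSample m) (h : Polynomial ℝ)
    (X : unitInterval → ℝ) : Fin m → ℝ :=
  Matrix.mulVec (Polynomial.aeval ((m : ℝ)⁻¹ • ω.adjacency) h) (ω.graphSignal X)

/-- The `i`-th cell (counting from `0`) of the partition of `[0, 1]` into `m` intervals of equal
length, half-open except for the last one, which is closed. -/
def cell (m : ℕ) (i : Fin m) : Set unitInterval :=
  {u | (i : ℝ) / m ≤ u ∧ ((u : ℝ) < ((i : ℝ) + 1) / m ∨ (i : ℕ) + 1 = m)}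

/-- The step function on `[0, 1]` interpolating a vector. -/
def interpolate {m : ℕ} (x : Fin m → ℝ) (u : unitInterval) : ℝ :=
  ∑ i, (cell m i).indicator (fun _ => x i) u

/-- `lam` is an eigenvalue of the operator `φ ↦ ∫ V(u, ·) φ(u) du` on `L²([0, 1])`. -/
def IsGraphonEigenvalue (V : unitInterval → unitInterval → ℝ) (lam : ℝ) : Prop :=
  ∃ φ : unitInterval → ℝ, MemLp φ 2 volume ∧ ¬ (φ =ᵐ[volume] 0) ∧
    ∀ᵐ v, ∫ u, V u v * φ u = lam * φ v

/-- The half-oscillation of the frequency response over the eigenvalues of the graphon: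
the infimum over `k` of the supremum over the eigenvalues of `|h(lam) - k|`. -/
def responseVariation (V : unitInterval → unitInterval → ℝ) (h : Polynomial ℝ) : ℝ :=
  ⨅ k : ℝ, ⨆ lam : {lam : ℝ // IsGraphonEigenvalue V lam}, |h.eval (lam : ℝ) - k|

end

/-! Both graph convolutions are compared with the graphon convolution $h(T)X$, where $T$ is the
integral operator with kernel $V=W_{\{N\}}$; the triangle inequality then needs only the two
marginal laws, so the coupling is irrelevant. With $L=A_{\mathbb R_+}t_N$ and $\sigma^2=\iint
V(1-V)=(L_1-L_2^2)/t_N^2$, a graph with $m$ nodes is shown to satisfy a mean bound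
$A_h\|X\|_2(\sigma+2L/\sqrt{6m})+A_s/\sqrt{6m}$. Adding the cases $m=N$ and $m=n$ gives the claim
even without the nonnegative term in $\Delta h$.

The step function of $h(\mathbf S_m/m)x_m$ is $h(S)$ applied to the step function of $x_m$, where
$S$ is the integral operator of the step kernel of the graph. Since $\|h(S)\|\le1$, the signal error
is at most $A_s$ times the $L^2$ distance from the empirical quantile function to the identity,
whose mean square is exactly $1/(6m)$ (`integral_integral_quantile_sub_sq`).

For the operator error, a scalar Lipschitz bound passes to operators in Hilbert-Schmidt norm: on an
eigenvector $e$ of $B$ with eigenvalue $\beta$, $\|h(S)e-h(\beta)e\|\le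
A_h\|(S-\beta)e\|=A_h\|(S-B)e\|$, and Cauchy-Schwarz sums these over an eigenbasis
(`norm_aeval_sub_aeval_le_of_hilbertSchmidt`). Bias and variance of the edges bound the mean squared
Hilbert-Schmidt distance by $(1-1/m)\sigma^2+\delta/m+4L^2/(6m)$, where $\delta=\int
V(u,u)(1-V(u,u))\,du$ comes from loops and repeated indices. If $\delta$ is not much larger than
$\sigma^2$, this is at most $(\sigma+2L/\sqrt{6m})^2$ and Jensen finishes (`sq_bound_of_few_loops`).

Otherwise (`ManyLoops`) the second moment is too weak. But a Lipschitz function that is large on the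
diagonal or at a point has a large integral, so $\sigma^2$ then dominates enough to force
$m\sigma^2<1/24$ and $mV(1-V)\le 6/25$ everywhere. By connectedness $V$ is uniformly close to one
constant $c\in\{0,1\}$. The comparison goes through the constant kernel $c$: for $m\sigma\le 9/10$
by the mean, rather than the root mean square, of the Hilbert-Schmidt distance, which is small
because most samples differ from $c$ in few entries; for $m\sigma\ge 9/10$ by the second moment of
$(S-c)g$ on only two vectors, since the constant kernel has two eigenspaces. Explicit numerical
estimates close every range of $m$. -/

noncomputable section

/-! ### Polynomials of symmetric contractions -/

section Hilbert

variable {E : Type*} [NormedAddCommGroup E] [InnerProductSpace ℝ E]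

open Polynomial

/-- Polynomial functional calculus is monotone in finite dimension. -/
theorem norm_aeval_le_of_finiteDimensional [FiniteDimensional ℝ E] {T : E →ₗ[ℝ] E}
    (hT : T.IsSymmetric) (hc : ∀ x, ‖T x‖ ≤ ‖x‖) {p q : ℝ[X]}
    (hpq : ∀ x ∈ Set.Icc (-1 : ℝ) 1, |p.eval x| ≤ |q.eval x|) (y : E) :
    ‖aeval T p y‖ ≤ ‖aeval T q y‖ := by
  set b := hT.eigenvectorBasis rfl with hb
  set μ := hT.eigenvalues rfl with hμ
  have hbT : ∀ i, T (b i) = μ i • b i := fun i => hT.apply_eigenvectorBasis rfl i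
  have hμ1 : ∀ i, μ i ∈ Set.Icc (-1 : ℝ) 1 := by
    intro i
    have h1 := hc (b i)
    rw [hbT, norm_smul, b.norm_eq_one, mul_one, Real.norm_eq_abs] at h1
    exact abs_le.1 h1
  have key : ∀ (r : ℝ[X]) i, b.repr (aeval T r y) i = r.eval (μ i) * b.repr y i := by
    intro r i
    have hr : aeval T r y = ∑ j, (b.repr y j * r.eval (μ j)) • b j := by
      conv_lhs => rw [← b.sum_repr y]
      rw [map_sum]
      refine Finset.sum_congr rfl fun j _ => ?_
      rw [map_smul, Module.End.aeval_apply_of_hasEigenvector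
        (hT.hasEigenvector_eigenvectorBasis rfl j), smul_smul]
      rfl
    rw [hr, map_sum]
    simp only [map_smul, OrthonormalBasis.repr_self]
    rw [WithLp.ofLp_sum, Finset.sum_apply, Finset.sum_eq_single i]
    · simp [mul_comm]
    · intro j _ hj
      simp [hj.symm]
    · simp
  have hn : ∀ r : ℝ[X], ‖aeval T r y‖ ^ 2 = ∑ i, (r.eval (μ i) * b.repr y i) ^ 2 := by
    intro r
    rw [← b.repr.norm_map, EuclideanSpace.norm_sq_eq]
    exact Finset.sum_congr rfl fun i _ => by rw [key, Real.norm_eq_abs, sq_abs]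
  refine le_of_sq_le_sq ?_ (norm_nonneg _)
  rw [hn, hn]
  refine Finset.sum_le_sum fun i _ => ?_
  rw [mul_pow, mul_pow]
  exact mul_le_mul_of_nonneg_right (sq_le_sq.2 (hpq _ (hμ1 i))) (sq_nonneg _)

/-- Polynomial functional calculus of a symmetric contraction is monotone. -/
theorem norm_aeval_le {T : E →ₗ[ℝ] E} (hT : T.IsSymmetric) (hc : ∀ x, ‖T x‖ ≤ ‖x‖) {p q : ℝ[X]}
    (hpq : ∀ x ∈ Set.Icc (-1 : ℝ) 1, |p.eval x| ≤ |q.eval x|) (y : E) :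
    ‖aeval T p y‖ ≤ ‖aeval T q y‖ := by
  set d := max p.natDegree q.natDegree with hd
  -- The Krylov space of `y` up to the larger degree: the compression of `T` to it is again a
  -- symmetric contraction and has the same powers on `y` up to that degree.
  let K : Submodule ℝ E := Submodule.span ℝ (Set.range fun k : Fin (d + 1) => (T ^ (k : ℕ)) y)
  have : FiniteDimensional ℝ K := FiniteDimensional.span_of_finite ℝ (Set.finite_range _)
  have hK : ∀ k ≤ d, (T ^ k) y ∈ K := fun k hk =>
    Submodule.subset_span ⟨⟨k, by omega⟩, rfl⟩
  let TK : K →ₗ[ℝ] K := (K.orthogonalProjectionOnto : E →ₗ[ℝ] K) ∘ₗ T ∘ₗ K.subtype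
  have hTKs : TK.IsSymmetric := by
    intro x z
    simp only [TK, LinearMap.comp_apply, Submodule.subtype_apply, ContinuousLinearMap.coe_coe]
    rw [Submodule.inner_orthogonalProjectionOnto_eq_of_mem_right,
      Submodule.inner_orthogonalProjectionOnto_eq_of_mem_left]
    exact hT x z
  have hTKc : ∀ x, ‖TK x‖ ≤ ‖x‖ := fun x =>
    (K.norm_orthogonalProjectionOnto_apply_le (T x)).trans (hc x)
  let yK : K := ⟨y, by simpa using hK 0 (Nat.zero_le _)⟩
  have hpow : ∀ k ≤ d, (((TK ^ k) yK : K) : E) = (T ^ k) y := by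
    intro k
    induction k with
    | zero => intro _; rfl
    | succ k ih =>
      intro hk
      have h1 : (((TK ^ k) yK : K) : E) = (T ^ k) y := ih (by omega)
      have h2 : T ((T ^ k) y) ∈ K := by
        have := hK (k + 1) hk
        rwa [pow_succ', Module.End.mul_apply] at this
      rw [pow_succ', pow_succ', Module.End.mul_apply, Module.End.mul_apply]
      simp only [TK, LinearMap.comp_apply, Submodule.subtype_apply, ContinuousLinearMap.coe_coe]
      have h1' : ((((K.orthogonalProjectionOnto : E →ₗ[ℝ] K) ∘ₗ T ∘ₗ K.subtype) ^ k) yK : E)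
        = (T ^ k) y := h1
      rw [h1']
      exact congrArg Subtype.val (K.orthogonalProjectionOnto_mem_subspace_eq_self ⟨_, h2⟩)
  have haeval : ∀ r : ℝ[X], r.natDegree ≤ d → ((aeval TK r yK : K) : E) = aeval T r y := by
    intro r hr
    rw [aeval_eq_sum_range, aeval_eq_sum_range]
    simp only [LinearMap.sum_apply, LinearMap.smul_apply, Submodule.coe_sum, Submodule.coe_smul]
    refine Finset.sum_congr rfl fun k hk => ?_
    rw [hpow k (by have := Finset.mem_range.1 hk; omega)]
  have h := norm_aeval_le_of_finiteDimensional hTKs hTKc hpq yK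
  rw [← haeval p (le_max_left _ _), ← haeval q (le_max_right _ _)]
  exact h

theorem norm_aeval_apply_le {T : E →ₗ[ℝ] E} (hT : T.IsSymmetric) (hc : ∀ x, ‖T x‖ ≤ ‖x‖) {h : ℝ[X]}
    (hh : ∀ x ∈ Set.Icc (-1 : ℝ) 1, |h.eval x| ≤ 1) (y : E) : ‖aeval T h y‖ ≤ ‖y‖ := by
  have := norm_aeval_le hT hc (p := h) (q := 1) (by simpa using hh) y
  simpa using this

/-- On $[-1,1]$ the polynomial $h-h(c)$ is dominated by $A(x-c)$, so monotonicity of the functional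
calculus applies. -/
theorem norm_aeval_sub_smul_le {T : E →ₗ[ℝ] E} (hT : T.IsSymmetric) (hc : ∀ x, ‖T x‖ ≤ ‖x‖)
    {h : ℝ[X]} {A : ℝ} (hA : 0 ≤ A)
    (hh : ∀ x ∈ Set.Icc (-1 : ℝ) 1, ∀ y ∈ Set.Icc (-1 : ℝ) 1,
      |h.eval x - h.eval y| ≤ A * |x - y|) {c : ℝ} (hcm : c ∈ Set.Icc (-1 : ℝ) 1) (y : E) :
    ‖aeval T h y - h.eval c • y‖ ≤ A * ‖T y - c • y‖ := by
  have := norm_aeval_le hT hc (p := h - C (h.eval c)) (q := C A * (X - C c)) (by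
    intro x hx
    simp only [eval_sub, eval_C, eval_mul, eval_X, abs_mul, abs_of_nonneg hA]
    exact hh x hx c hcm) y
  have h1 : aeval T (h - C (h.eval c)) y = aeval T h y - h.eval c • y := by
    rw [map_sub, LinearMap.sub_apply, aeval_C, Module.algebraMap_end_apply]
  have h2 : aeval T (C A * (X - C c)) y = A • (T y - c • y) := by
    rw [map_mul, map_sub, Module.End.mul_apply, LinearMap.sub_apply, aeval_C, aeval_C, aeval_X,
      Module.algebraMap_end_apply, Module.algebraMap_end_apply]
  rwa [h1, h2, norm_smul, Real.norm_eq_abs, abs_of_nonneg hA] at this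

/-- If `y` is a sum of eigenvectors of `B`, the difference of a Lipschitz polynomial at `A`
and at `B` is controlled by `A - B` on these eigenvectors. -/
theorem norm_aeval_sub_aeval_le {ι : Type*} [Fintype ι] {S B : E →ₗ[ℝ] E} (hS : S.IsSymmetric)
    (hSc : ∀ x, ‖S x‖ ≤ ‖x‖) {h : ℝ[X]} {A : ℝ} (hA : 0 ≤ A)
    (hh : ∀ x ∈ Set.Icc (-1 : ℝ) 1, ∀ y ∈ Set.Icc (-1 : ℝ) 1,
      |h.eval x - h.eval y| ≤ A * |x - y|) {β : ι → ℝ} (hβ : ∀ i, β i ∈ Set.Icc (-1 : ℝ) 1)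
    {v : ι → E} (hv : ∀ i, B (v i) = β i • v i) :
    ‖aeval S h (∑ i, v i) - aeval B h (∑ i, v i)‖ ≤ A * ∑ i, ‖S (v i) - B (v i)‖ := by
  have hB : ∀ i, aeval B h (v i) = h.eval (β i) • v i := by
    intro i
    by_cases h0 : v i = 0
    · simp [h0]
    · exact Module.End.aeval_apply_of_hasEigenvector
        ⟨Module.End.mem_eigenspace_iff.2 (hv i), h0⟩
  rw [map_sum, map_sum, ← Finset.sum_sub_distrib, Finset.mul_sum]
  refine (norm_sum_le _ _).trans (Finset.sum_le_sum fun i _ => ?_)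
  rw [hB, hv]
  exact norm_aeval_sub_smul_le hS hSc hA hh (hβ i) (v i)

/-- A vector is a combination of finitely many orthonormal eigenvectors of a symmetric operator
of finite rank. -/
theorem exists_orthonormal_eigenvectors {B : E →ₗ[ℝ] E} (hB : B.IsSymmetric)
    [FiniteDimensional ℝ (LinearMap.range B)] (y : E) :
    ∃ (d : ℕ) (e : Fin d → E) (β : Fin d → ℝ), Orthonormal ℝ e ∧ (∀ i, B (e i) = β i • e i) ∧
      y = ∑ i, inner ℝ (e i) y • e i := by
  -- Any subspace containing the range of `B` is invariant, so adjoining `y` costs nothing and puts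
  -- `y` in the span of the eigenvectors, kernel part included.
  let K : Submodule ℝ E := LinearMap.range B ⊔ Submodule.span ℝ {y}
  have hinv : ∀ x ∈ K, B x ∈ K := fun x _ => Submodule.mem_sup_left ⟨x, rfl⟩
  have hy : y ∈ K := Submodule.mem_sup_right (Submodule.mem_span_singleton_self y)
  have hs := hB.restrict_invariant hinv
  let b := hs.eigenvectorBasis (rfl : Module.finrank ℝ K = _)
  refine ⟨_, fun i => (b i : E), hs.eigenvalues rfl, ?_, fun i => ?_, ?_⟩
  · exact b.orthonormal.comp_linearIsometry K.subtypeₗᵢ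
  · have := congrArg (Subtype.val : K → E) (hs.apply_eigenvectorBasis rfl i)
    exact this
  · have := congrArg (Subtype.val : K → E) (b.sum_repr' ⟨y, hy⟩)
    simpa using this.symm

/-- A Lipschitz polynomial is Lipschitz for the Hilbert-Schmidt norm. -/
theorem norm_aeval_sub_aeval_le_of_hilbertSchmidt {S B : E →ₗ[ℝ] E} (hS : S.IsSymmetric)
    (hSc : ∀ x, ‖S x‖ ≤ ‖x‖) (hB : B.IsSymmetric) (hBc : ∀ x, ‖B x‖ ≤ ‖x‖)
    [FiniteDimensional ℝ (LinearMap.range B)] {h : ℝ[X]} {A : ℝ} (hA : 0 ≤ A)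
    (hh : ∀ x ∈ Set.Icc (-1 : ℝ) 1, ∀ y ∈ Set.Icc (-1 : ℝ) 1,
      |h.eval x - h.eval y| ≤ A * |x - y|) {H : ℝ}
    (hHS : ∀ (d : ℕ) (e : Fin d → E), Orthonormal ℝ e → ∑ i, ‖S (e i) - B (e i)‖ ^ 2 ≤ H)
    (y : E) :
    ‖aeval S h y - aeval B h y‖ ≤ A * ‖y‖ * √H := by
  obtain ⟨d, e, β, he, hβ, hy⟩ := exists_orthonormal_eigenvectors hB y
  have hβ1 : ∀ i, β i ∈ Set.Icc (-1 : ℝ) 1 := by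
    intro i
    have h1 := hBc (e i)
    rw [hβ, norm_smul, he.1 i, mul_one, Real.norm_eq_abs] at h1
    exact abs_le.1 h1
  have h1 := norm_aeval_sub_aeval_le (v := fun i => inner ℝ (e i) y • e i) hS hSc hA hh hβ1
    (fun i => by rw [map_smul, hβ, smul_comm])
  rw [← hy] at h1
  refine h1.trans ?_
  rw [mul_assoc]
  refine mul_le_mul_of_nonneg_left ?_ hA
  have h2 : ∀ i, ‖S (inner ℝ (e i) y • e i) - B (inner ℝ (e i) y • e i)‖
      = |inner ℝ (e i) y| * ‖S (e i) - B (e i)‖ := by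
    intro i
    rw [map_smul, map_smul, ← smul_sub, norm_smul, Real.norm_eq_abs]
  simp only [h2]
  refine (Real.sum_mul_le_sqrt_mul_sqrt _ _ _).trans ?_
  refine mul_le_mul ?_ (Real.sqrt_le_sqrt (hHS d e he)) (Real.sqrt_nonneg _) (norm_nonneg _)
  rw [Real.sqrt_le_left (norm_nonneg _)]
  simpa using he.sum_inner_products_le (s := Finset.univ) y

end Hilbert

/-! ### Integral operators with bounded kernels -/

section Kernel

variable {α : Type*} [MeasurableSpace α] {μ : Measure α}

/-- A measurable kernel with values in `[-1, 1]`. -/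
structure IsBoundedKernel (K : α → α → ℝ) : Prop where
  measurable : Measurable (Function.uncurry K)
  abs_le : ∀ u v, |K u v| ≤ 1

theorem Lp.norm_sq_eq_integral (f : Lp ℝ 2 μ) : ‖f‖ ^ 2 = ∫ x, f x ^ 2 ∂μ := by
  rw [← real_inner_self_eq_norm_sq, L2.inner_def]
  refine integral_congr_ae (Filter.Eventually.of_forall fun x => ?_)
  simp [sq]

variable [IsProbabilityMeasure μ]

theorem IsBoundedKernel.memLp_section {K : α → α → ℝ} (hK : IsBoundedKernel K) (v : α) :
    MemLp (fun u => K u v) 2 μ :=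
  MemLp.of_bound (hK.measurable.comp (measurable_id.prodMk measurable_const)).aestronglyMeasurable 1
    (Filter.Eventually.of_forall fun u => by simpa using hK.abs_le u v)

theorem IsBoundedKernel.norm_section_le {K : α → α → ℝ} (hK : IsBoundedKernel K) (v : α) :
    ‖(hK.memLp_section (μ := μ) v).toLp‖ ≤ 1 := by
  have := Lp.norm_le_of_ae_bound (f := (hK.memLp_section (μ := μ) v).toLp) (C := 1) zero_le_one (by
    filter_upwards [(hK.memLp_section (μ := μ) v).coeFn_toLp] with u hu
    rw [hu]
    simpa using hK.abs_le u v)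
  simpa [measureUnivNNReal] using this

theorem IsBoundedKernel.norm_section_sq {K : α → α → ℝ} (hK : IsBoundedKernel K) (v : α) :
    ‖(hK.memLp_section (μ := μ) v).toLp‖ ^ 2 = ∫ u, K u v ^ 2 ∂μ := by
  rw [Lp.norm_sq_eq_integral]
  refine integral_congr_ae ?_
  filter_upwards [(hK.memLp_section (μ := μ) v).coeFn_toLp] with u hu
  rw [hu]

theorem IsBoundedKernel.integral_eq_inner {K : α → α → ℝ} (hK : IsBoundedKernel K)
    (f : Lp ℝ 2 μ) (v : α) :
    ∫ u, K u v * f u ∂μ = inner ℝ (hK.memLp_section (μ := μ) v).toLp f := by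
  rw [L2.inner_def]
  refine integral_congr_ae ?_
  filter_upwards [(hK.memLp_section (μ := μ) v).coeFn_toLp] with u hu
  simp [hu, mul_comm]

theorem IsBoundedKernel.abs_integral_le {K : α → α → ℝ} (hK : IsBoundedKernel K)
    (f : Lp ℝ 2 μ) (v : α) : |∫ u, K u v * f u ∂μ| ≤ ‖f‖ := by
  rw [hK.integral_eq_inner]
  refine (abs_real_inner_le_norm _ _).trans ?_
  exact mul_le_of_le_one_left (norm_nonneg _) (hK.norm_section_le v)

theorem IsBoundedKernel.aestronglyMeasurable_integral {K : α → α → ℝ} (hK : IsBoundedKernel K)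
    (f : Lp ℝ 2 μ) : AEStronglyMeasurable (fun v => ∫ u, K u v * f u ∂μ) μ := by
  have h : StronglyMeasurable fun z : α × α => K z.2 z.1 * f z.2 :=
    (hK.measurable.comp measurable_swap).stronglyMeasurable.mul
      ((Lp.stronglyMeasurable f).comp_measurable measurable_snd)
  exact (StronglyMeasurable.integral_prod_right (ν := μ) h).aestronglyMeasurable

theorem IsBoundedKernel.memLp_integral {K : α → α → ℝ} (hK : IsBoundedKernel K)
    (f : Lp ℝ 2 μ) : MemLp (fun v => ∫ u, K u v * f u ∂μ) 2 μ :=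
  MemLp.of_bound (hK.aestronglyMeasurable_integral f) ‖f‖
    (Filter.Eventually.of_forall fun v => by simpa using hK.abs_integral_le f v)

/-- The integral operator with kernel `K` on `L²`. -/
def IsBoundedKernel.op {K : α → α → ℝ} (hK : IsBoundedKernel K) (μ : Measure α)
    [IsProbabilityMeasure μ] : Lp ℝ 2 μ →ₗ[ℝ] Lp ℝ 2 μ where
  toFun f := (hK.memLp_integral f).toLp
  map_add' f g := by
    refine Lp.ext ?_
    filter_upwards [(hK.memLp_integral f).coeFn_toLp, (hK.memLp_integral g).coeFn_toLp,
      (hK.memLp_integral (f + g)).coeFn_toLp,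
      Lp.coeFn_add (hK.memLp_integral f).toLp (hK.memLp_integral g).toLp] with v h1 h2 h3 h4
    rw [h3, h4, Pi.add_apply, h1, h2, hK.integral_eq_inner, hK.integral_eq_inner,
      hK.integral_eq_inner, inner_add_right]
  map_smul' c f := by
    refine Lp.ext ?_
    filter_upwards [(hK.memLp_integral f).coeFn_toLp, (hK.memLp_integral (c • f)).coeFn_toLp,
      Lp.coeFn_smul c (hK.memLp_integral f).toLp] with v h1 h2 h3
    rw [h2, RingHom.id_apply, h3, Pi.smul_apply, h1, hK.integral_eq_inner,
      hK.integral_eq_inner, inner_smul_right, smul_eq_mul]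

theorem IsBoundedKernel.coeFn_op {K : α → α → ℝ} (hK : IsBoundedKernel K) (f : Lp ℝ 2 μ) :
    hK.op μ f =ᵐ[μ] fun v => ∫ u, K u v * f u ∂μ :=
  (hK.memLp_integral f).coeFn_toLp

theorem IsBoundedKernel.norm_op_le {K : α → α → ℝ} (hK : IsBoundedKernel K) (f : Lp ℝ 2 μ) :
    ‖hK.op μ f‖ ≤ ‖f‖ := by
  have := Lp.norm_le_of_ae_bound (f := hK.op μ f) (C := ‖f‖) (norm_nonneg _) (by
    filter_upwards [hK.coeFn_op f] with v hv
    rw [hv]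
    simpa using hK.abs_integral_le f v)
  simpa [measureUnivNNReal] using this

theorem IsBoundedKernel.op_isSymmetric {K : α → α → ℝ} (hK : IsBoundedKernel K)
    (hs : ∀ u v, K u v = K v u) : (hK.op μ).IsSymmetric := by
  intro f g
  have hint : Integrable (fun z : α × α => K z.1 z.2 * (f z.1 * g z.2)) (μ.prod μ) := by
    refine Integrable.bdd_mul (c := 1) ?_ hK.measurable.aestronglyMeasurable
      (Filter.Eventually.of_forall fun z => by simpa using hK.abs_le z.1 z.2)
    exact ((Lp.memLp f).integrable (by norm_num)).mul_prod ((Lp.memLp g).integrable (by norm_num))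
  have h1 : inner ℝ (hK.op μ f) g = ∫ v, ∫ u, K u v * (f u * g v) ∂μ ∂μ := by
    rw [L2.inner_def]
    refine integral_congr_ae ?_
    filter_upwards [hK.coeFn_op f] with v hv
    rw [hv]
    simp only [RCLike.inner_apply, conj_trivial]
    rw [← integral_const_mul]
    exact integral_congr_ae (Filter.Eventually.of_forall fun u => by ring)
  have h2 : inner ℝ f (hK.op μ g) = ∫ u, ∫ v, K u v * (f u * g v) ∂μ ∂μ := by
    rw [L2.inner_def]
    refine integral_congr_ae ?_
    filter_upwards [hK.coeFn_op g] with u hu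
    rw [hu]
    simp only [RCLike.inner_apply, conj_trivial]
    rw [← integral_mul_const]
    exact integral_congr_ae (Filter.Eventually.of_forall fun v => by
      simp only []
      rw [hs u v]; ring)
  rw [h1, h2]
  exact (integral_integral_swap hint).symm

theorem IsBoundedKernel.integrable_sq {K : α → α → ℝ} (hK : IsBoundedKernel K) :
    Integrable (fun z : α × α => K z.2 z.1 ^ 2) (μ.prod μ) := by
  refine Integrable.of_bound ((hK.measurable.comp measurable_swap).pow_const 2).aestronglyMeasurable
    1 (Filter.Eventually.of_forall fun z => ?_)
  rw [Real.norm_eq_abs, abs_pow]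
  exact pow_le_one₀ (abs_nonneg _) (hK.abs_le _ _)

/-- The Hilbert-Schmidt bound: Bessel's inequality for each section $K(\cdot,v)$, integrated over
$v$. Finite orthonormal families are all that is needed later. -/
theorem IsBoundedKernel.sum_norm_op_sq_le {K : α → α → ℝ} (hK : IsBoundedKernel K) {d : ℕ}
    {e : Fin d → Lp ℝ 2 μ} (he : Orthonormal ℝ e) :
    ∑ i, ‖hK.op μ (e i)‖ ^ 2 ≤ ∫ v, ∫ u, K u v ^ 2 ∂μ ∂μ := by
  have h1 : ∀ i, ‖hK.op μ (e i)‖ ^ 2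
      = ∫ v, (inner ℝ (hK.memLp_section (μ := μ) v).toLp (e i) : ℝ) ^ 2 ∂μ := by
    intro i
    rw [Lp.norm_sq_eq_integral]
    refine integral_congr_ae ?_
    filter_upwards [hK.coeFn_op (e i)] with v hv
    rw [hv, hK.integral_eq_inner]
  have hint : ∀ i, Integrable (fun v => (inner ℝ (hK.memLp_section (μ := μ) v).toLp (e i) : ℝ) ^ 2)
      μ := by
    intro i
    have := (hK.memLp_integral (e i)).integrable_sq
    simpa only [hK.integral_eq_inner] using this
  simp only [h1]
  rw [← integral_finsetSum _ fun i _ => hint i]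
  refine integral_mono (integrable_finsetSum _ fun i _ => hint i) hK.integrable_sq.integral_prod_left
    fun v => ?_
  simp only []
  rw [← hK.norm_section_sq]
  have := he.sum_inner_products_le (s := Finset.univ) (hK.memLp_section (μ := μ) v).toLp
  simpa [real_inner_comm] using this

theorem IsBoundedKernel.op_sub_op {K M : α → α → ℝ} (hK : IsBoundedKernel K)
    (hM : IsBoundedKernel M) (hKM : IsBoundedKernel fun u v => K u v - M u v) (f : Lp ℝ 2 μ) :
    hK.op μ f - hM.op μ f = hKM.op μ f := by
  refine Lp.ext ?_
  have hi : ∀ {R : α → α → ℝ} (hR : IsBoundedKernel R) (v : α),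
      Integrable (fun u => R u v * f u) μ := fun hR v =>
    (hR.memLp_section (μ := μ) v).integrable_mul (Lp.memLp f)
  filter_upwards [hK.coeFn_op f, hM.coeFn_op f, hKM.coeFn_op f,
    Lp.coeFn_sub (hK.op μ f) (hM.op μ f)] with v h1 h2 h3 h4
  rw [h4, Pi.sub_apply, h1, h2, h3, ← integral_sub (hi hK v) (hi hM v)]
  exact integral_congr_ae (Filter.Eventually.of_forall fun u => by ring)

end Kernel

/-! ### Step functions -/

section Step

theorem integral_unitInterval_eq (f : ℝ → ℝ) :
    ∫ u : unitInterval, f u = ∫ x in (0 : ℝ)..1, f x := by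
  rw [intervalIntegral.integral_of_le zero_le_one, ← integral_Icc_eq_integral_Ioc]
  exact integral_subtype measurableSet_Icc f

variable {m : ℕ} [NeZero m]

/-- The index of the cell that contains a point. -/
def cellIndex (m : ℕ) [NeZero m] (u : unitInterval) : Fin m :=
  -- The minimum only matters at $u=1$, which belongs to the closed last cell.
  ⟨min ⌊(u : ℝ) * m⌋₊ (m - 1), by have := NeZero.pos m; omega⟩

theorem mem_cell_iff (u : unitInterval) (i : Fin m) : u ∈ cell m i ↔ cellIndex m u = i := by
  have hm : (0 : ℝ) < m := by exact_mod_cast NeZero.pos m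
  have hu : (u : ℝ) * m ≤ m := mul_le_of_le_one_left hm.le u.2.2
  have hu0 : 0 ≤ (u : ℝ) * m := mul_nonneg u.2.1 hm.le
  have hi := i.2
  simp only [cell, Set.mem_ofPred_eq, Fin.ext_iff, cellIndex, div_le_iff₀ hm, lt_div_iff₀ hm]
  constructor
  · rintro ⟨h1, h2⟩
    have h3 : (i : ℕ) ≤ ⌊(u : ℝ) * m⌋₊ := Nat.le_floor h1
    rcases h2 with h2 | h2
    · have : ⌊(u : ℝ) * m⌋₊ < i + 1 := (Nat.floor_lt hu0).2 (by exact_mod_cast h2)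
      omega
    · omega
  · intro h
    have h1 : (i : ℕ) ≤ ⌊(u : ℝ) * m⌋₊ := by omega
    refine ⟨(Nat.le_floor_iff hu0).1 h1, ?_⟩
    by_cases h2 : (i : ℕ) + 1 = m
    · exact Or.inr h2
    · left
      have : ⌊(u : ℝ) * m⌋₊ < i + 1 := by omega
      exact_mod_cast (Nat.floor_lt hu0).1 this

theorem interpolate_eq (z : Fin m → ℝ) (u : unitInterval) :
    interpolate z u = z (cellIndex m u) := by
  rw [interpolate, Finset.sum_eq_single (cellIndex m u)]
  · rw [Set.indicator_of_mem ((mem_cell_iff u _).2 rfl)]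
  · intro i _ hi
    exact Set.indicator_of_notMem (fun h => hi ((mem_cell_iff u i).1 h).symm) _
  · simp

theorem measurable_cellIndex : Measurable (cellIndex m) := by
  have h : Measurable fun u : unitInterval => min ⌊(u : ℝ) * m⌋₊ (m - 1) :=
    (Nat.measurable_floor.comp (measurable_subtype_coe.mul_const _)).min measurable_const
  refine measurable_to_countable' fun i => ?_
  have : cellIndex m ⁻¹' {i} = (fun u : unitInterval => min ⌊(u : ℝ) * m⌋₊ (m - 1)) ⁻¹' {(i : ℕ)} := by
    ext u
    simp [cellIndex, Fin.ext_iff]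
  rw [this]
  exact h (measurableSet_singleton _)

theorem integral_mul_step {φ : ℝ → ℝ} (hφ : Continuous φ) (f : Fin m → ℝ) :
    ∫ u : unitInterval, φ u * f (cellIndex m u)
      = ∑ i : Fin m, (∫ x in ((i : ℕ) / m : ℝ)..(((i : ℕ) + 1 : ℕ) / m : ℝ), φ x) * f i := by
  have hm : (0 : ℝ) < m := by exact_mod_cast NeZero.pos m
  -- Extension to the real line, so that the integral can be cut into interval integrals over the
  -- cells; the endpoints of cells are negligible.
  let F : ℝ → ℝ := fun x => φ x * f (cellIndex m (Set.projIcc 0 1 zero_le_one x))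
  have hF : ∀ u : unitInterval, φ u * f (cellIndex m u) = F u := by
    intro u
    simp [F]
  have hEq : ∀ k (hk : k < m), Set.EqOn (fun x => φ x * f ⟨k, hk⟩) F
      (Set.uIoo ((k : ℝ) / m) ((k + 1 : ℕ) / m)) := by
    intro k hk x hx
    rw [Set.uIoo_of_le (by gcongr; simp)] at hx
    have hx0 : 0 ≤ x := le_trans (by positivity) hx.1.le
    have hx1 : x ≤ 1 := hx.2.le.trans (by
      rw [div_le_one hm]; exact_mod_cast hk)
    have hmem : (⟨x, hx0, hx1⟩ : unitInterval) ∈ cell m ⟨k, hk⟩ := by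
      refine ⟨hx.1.le, Or.inl ?_⟩
      have := hx.2
      push_cast at this
      exact this
    simp only [F]
    rw [Set.projIcc_of_mem zero_le_one ⟨hx0, hx1⟩, (mem_cell_iff _ _).1 hmem]
  simp only [hF]
  rw [integral_unitInterval_eq F]
  have hsum := intervalIntegral.sum_integral_adjacent_intervals (f := F) (μ := volume)
    (a := fun k : ℕ => (k : ℝ) / m) (n := m) (fun k hk =>
      ((hφ.mul continuous_const).intervalIntegrable _ _).congr_uIoo (hEq k hk))
  simp only [Nat.cast_zero, zero_div, div_self hm.ne'] at hsum
  rw [← hsum, Finset.sum_range]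
  refine Finset.sum_congr rfl fun i _ => ?_
  rw [← intervalIntegral.integral_congr_uIoo (hEq i i.2), intervalIntegral.integral_mul_const]

theorem integral_step (f : Fin m → ℝ) :
    ∫ u : unitInterval, f (cellIndex m u) = (m : ℝ)⁻¹ * ∑ i, f i := by
  have hm : (0 : ℝ) < m := by exact_mod_cast NeZero.pos m
  have := integral_mul_step (φ := fun _ => 1) continuous_const f
  simp only [one_mul] at this
  rw [this, Finset.mul_sum]
  refine Finset.sum_congr rfl fun i _ => ?_
  rw [intervalIntegral.integral_const]
  push_cast
  rw [smul_eq_mul, mul_one]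
  congr 1
  field_simp
  ring

theorem integral_coe_mul_step (f : Fin m → ℝ) :
    ∫ u : unitInterval, (u : ℝ) * f (cellIndex m u)
      = ((m : ℝ) ^ 2)⁻¹ / 2 * ∑ i : Fin m, (2 * (i : ℕ) + 1) * f i := by
  have hm : (0 : ℝ) < m := by exact_mod_cast NeZero.pos m
  rw [integral_mul_step (φ := fun x => x) continuous_id f, Finset.mul_sum]
  refine Finset.sum_congr rfl fun i _ => ?_
  rw [integral_id]
  push_cast
  field_simp
  ring

/-- The kernel that is constant on the products of cells. -/
def stepKernel (M : Matrix (Fin m) (Fin m) ℝ) (u v : unitInterval) : ℝ :=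
  M (cellIndex m u) (cellIndex m v)

theorem isBoundedKernel_stepKernel {M : Matrix (Fin m) (Fin m) ℝ} (hM : ∀ i j, |M i j| ≤ 1) :
    IsBoundedKernel (stepKernel M) where
  measurable := (measurable_of_countable (Function.uncurry M)).comp
    ((measurable_cellIndex.comp measurable_fst).prodMk (measurable_cellIndex.comp measurable_snd))
  abs_le _ _ := hM _ _

theorem memLp_step (z : Fin m → ℝ) :
    MemLp (fun u : unitInterval => z (cellIndex m u)) 2 volume :=
  MemLp.of_bound ((measurable_of_countable z).comp measurable_cellIndex).aestronglyMeasurable ‖z‖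
    (Filter.Eventually.of_forall fun _ => norm_le_pi_norm z _)

/-- The step function of a vector, as an element of `L²`. -/
def stepLp (m : ℕ) [NeZero m] : (Fin m → ℝ) →ₗ[ℝ] Lp ℝ 2 (volume : Measure unitInterval) where
  toFun z := (memLp_step z).toLp
  map_add' _ _ := rfl
  map_smul' _ _ := rfl

theorem coeFn_stepLp (z : Fin m → ℝ) : stepLp m z =ᵐ[volume] fun u => z (cellIndex m u) :=
  (memLp_step z).coeFn_toLp

theorem integral_stepKernel_mul {M : Matrix (Fin m) (Fin m) ℝ}
    (f : Lp ℝ 2 (volume : Measure unitInterval)) :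
    ∃ w : Fin m → ℝ, ∀ v, ∫ u, stepKernel M u v * f u = w (cellIndex m v) :=
  ⟨fun j => ∫ u, M (cellIndex m u) j * f u, fun _ => rfl⟩

/-- This gives the finite rank that makes an eigenvector expansion available without compactness
arguments. -/
theorem range_op_stepKernel_le {M : Matrix (Fin m) (Fin m) ℝ} (hM : ∀ i j, |M i j| ≤ 1) :
    LinearMap.range ((isBoundedKernel_stepKernel hM).op volume) ≤ LinearMap.range (stepLp m) := by
  rintro _ ⟨f, rfl⟩
  obtain ⟨w, hw⟩ := integral_stepKernel_mul (M := M) f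
  refine ⟨w, Lp.ext ?_⟩
  filter_upwards [coeFn_stepLp w, (isBoundedKernel_stepKernel hM).coeFn_op f] with v h1 h2
  rw [h1, h2, hw]

theorem finiteDimensional_range_op_stepKernel {M : Matrix (Fin m) (Fin m) ℝ}
    (hM : ∀ i j, |M i j| ≤ 1) :
    FiniteDimensional ℝ (LinearMap.range ((isBoundedKernel_stepKernel hM).op volume)) :=
  Submodule.finiteDimensional_of_le (range_op_stepKernel_le hM)

/-- `stepLp` intertwines $M/m$ with the integral operator, the factor $1/m$ being the length of a
cell. Symmetry is needed because the operator integrates over the first variable while `mulVec` sums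
over the second index. -/
theorem op_stepKernel_stepLp {M : Matrix (Fin m) (Fin m) ℝ} (hM : ∀ i j, |M i j| ≤ 1)
    (hs : ∀ i j, M i j = M j i) (z : Fin m → ℝ) :
    (isBoundedKernel_stepKernel hM).op volume (stepLp m z)
      = stepLp m (((m : ℝ)⁻¹ • M).mulVec z) := by
  refine Lp.ext ?_
  filter_upwards [coeFn_stepLp (((m : ℝ)⁻¹ • M).mulVec z),
    (isBoundedKernel_stepKernel hM).coeFn_op (stepLp m z)] with v h1 h2
  rw [h1, h2]
  have h3 : ∫ u, stepKernel M u v * stepLp m z u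
      = ∫ u, (fun i => M i (cellIndex m v) * z i) (cellIndex m u) := by
    refine integral_congr_ae ?_
    filter_upwards [coeFn_stepLp z] with u hu
    rw [hu]
    rfl
  rw [h3, integral_step (fun i => M i (cellIndex m v) * z i), Matrix.smul_mulVec, Pi.smul_apply, smul_eq_mul, Matrix.mulVec, dotProduct]
  simp only [hs _ (cellIndex m v)]

open Polynomial in
theorem aeval_op_stepKernel_stepLp {M : Matrix (Fin m) (Fin m) ℝ} (hM : ∀ i j, |M i j| ≤ 1)
    (hs : ∀ i j, M i j = M j i) (h : ℝ[X]) (z : Fin m → ℝ) :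
    aeval ((isBoundedKernel_stepKernel hM).op volume) h (stepLp m z)
      = stepLp m ((aeval ((m : ℝ)⁻¹ • M) h).mulVec z) := by
  have hpow : ∀ (k : ℕ) (z : Fin m → ℝ),
      (((isBoundedKernel_stepKernel hM).op volume) ^ k) (stepLp m z)
        = stepLp m ((((m : ℝ)⁻¹ • M) ^ k).mulVec z) := by
    intro k
    induction k with
    | zero => intro z; simp
    | succ k ih =>
      intro z
      rw [pow_succ, Module.End.mul_apply, op_stepKernel_stepLp hM hs, ih, Matrix.mulVec_mulVec,
        ← pow_succ]
  rw [aeval_eq_sum_range, aeval_eq_sum_range, LinearMap.sum_apply, Matrix.sum_mulVec, map_sum]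
  refine Finset.sum_congr rfl fun k _ => ?_
  rw [LinearMap.smul_apply, hpow, Matrix.smul_mulVec, map_smul]

end Step

/-! ### Products of Bernoulli laws -/

section Bernoulli

variable {ι : Type*} [Fintype ι] [DecidableEq ι]

/-- The expectation of `f` under the product of the Bernoulli laws with parameters `p i`. -/
def bernoulliMean (p : ι → ℝ) (f : (ι → Bool) → ℝ) : ℝ :=
  ∑ s, (∏ i, if s i then p i else 1 - p i) * f s

theorem bernoulliMean_mono {p : ι → ℝ} (hp : ∀ i, p i ∈ Set.Icc (0 : ℝ) 1)
    {f g : (ι → Bool) → ℝ} (hfg : ∀ s, f s ≤ g s) : bernoulliMean p f ≤ bernoulliMean p g := by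
  refine Finset.sum_le_sum fun s _ => mul_le_mul_of_nonneg_left (hfg s) ?_
  refine Finset.prod_nonneg fun i _ => ?_
  split_ifs
  · exact (hp i).1
  · linarith [(hp i).2]

theorem bernoulliMean_add (p : ι → ℝ) (f g : (ι → Bool) → ℝ) :
    bernoulliMean p (fun s => f s + g s) = bernoulliMean p f + bernoulliMean p g := by
  simp only [bernoulliMean, mul_add, Finset.sum_add_distrib]

theorem bernoulliMean_const_mul (p : ι → ℝ) (c : ℝ) (f : (ι → Bool) → ℝ) :
    bernoulliMean p (fun s => c * f s) = c * bernoulliMean p f := by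
  simp only [bernoulliMean, Finset.mul_sum]
  exact Finset.sum_congr rfl fun s _ => by ring

theorem bernoulliMean_sum {κ : Type*} (p : ι → ℝ) (t : Finset κ) (f : κ → (ι → Bool) → ℝ) :
    bernoulliMean p (fun s => ∑ k ∈ t, f k s) = ∑ k ∈ t, bernoulliMean p (f k) := by
  simp only [bernoulliMean, Finset.mul_sum]
  exact Finset.sum_comm

theorem bernoulliMean_integral {α : Type*} [MeasurableSpace α] {μ : Measure α} (p : ι → ℝ)
    {f : (ι → Bool) → α → ℝ} (hf : ∀ s, Integrable (f s) μ) :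
    bernoulliMean p (fun s => ∫ x, f s x ∂μ) = ∫ x, bernoulliMean p (fun s => f s x) ∂μ := by
  simp only [bernoulliMean]
  rw [integral_finsetSum _ fun s _ => (hf s).const_mul _]
  exact Finset.sum_congr rfl fun s _ => (integral_const_mul _ _).symm

/-- Independence in its finite form: a product of sums expands into a sum over all outcomes. The
one- and two-coordinate formulas follow by taking the other factors equal to $1$. -/
theorem bernoulliMean_prod (p : ι → ℝ) (φ : ι → Bool → ℝ) :
    bernoulliMean p (fun s => ∏ i, φ i (s i)) = ∏ i, (p i * φ i true + (1 - p i) * φ i false) := by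
  have := Fintype.prod_sum fun i (b : Bool) => (if b then p i else 1 - p i) * φ i b
  simp only [Fintype.sum_bool, if_true, Bool.false_eq_true, if_false] at this
  rw [this, bernoulliMean]
  exact Finset.sum_congr rfl fun s _ => Finset.prod_mul_distrib.symm

theorem bernoulliMean_const (p : ι → ℝ) (c : ℝ) : bernoulliMean p (fun _ => c) = c := by
  have h := bernoulliMean_const_mul p c fun _ => 1
  have h1 := bernoulliMean_prod p fun _ _ => 1
  simp only [Finset.prod_const_one, mul_one, add_sub_cancel] at h1
  rw [h1] at h
  simpa using h

theorem bernoulliMean_apply (p : ι → ℝ) (i : ι) (φ : Bool → ℝ) :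
    bernoulliMean p (fun s => φ (s i)) = p i * φ true + (1 - p i) * φ false := by
  have h := bernoulliMean_prod p fun j b => if j = i then φ b else 1
  simp only [Finset.prod_ite_eq', Finset.mem_univ, if_true] at h
  rw [h, Finset.prod_eq_single i]
  · simp
  · intro j _ hj
    simp [hj]
  · simp

theorem bernoulliMean_mul_apply (p : ι → ℝ) {i j : ι} (hij : i ≠ j) (φ ψ : Bool → ℝ) :
    bernoulliMean p (fun s => φ (s i) * ψ (s j))
      = (p i * φ true + (1 - p i) * φ false) * (p j * ψ true + (1 - p j) * ψ false) := by
  have h := bernoulliMean_prod p fun k b => (if k = i then φ b else 1) * (if k = j then ψ b else 1)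
  simp only [Finset.prod_mul_distrib, Finset.prod_ite_eq', Finset.mem_univ, if_true] at h
  rw [h, ← Finset.mul_prod_erase _ _ (Finset.mem_univ i),
    ← Finset.mul_prod_erase _ _ (Finset.mem_erase.2 ⟨hij.symm, Finset.mem_univ j⟩),
    Finset.prod_eq_one]
  · simp [hij, hij.symm]
  · intro k hk
    simp only [Finset.mem_erase, Finset.mem_univ, and_true] at hk
    simp [hk.1, hk.2]

end Bernoulli

/-! ### The law of a sampled graph -/

section Law

variable {m : ℕ}

theorem measurable_sortedLatent :
    Measurable (sortedLatent : (Fin m → unitInterval) → Fin m → unitInterval) := by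
  -- There are finitely many sorting permutations, each chosen on a measurable set cut out by
  -- comparisons of coordinates; sorting is measurable piece by piece.
  have hset : ∀ σ : Equiv.Perm (Fin m),
      MeasurableSet {v : Fin m → unitInterval | σ = Tuple.sort v} := by
    intro σ
    simp only [Tuple.eq_sort_iff, Monotone, Function.comp_apply]
    simp only [Set.ofPred_and, Set.ofPred_forall]
    refine MeasurableSet.inter ?_ ?_
    · refine MeasurableSet.iInter fun i => MeasurableSet.iInter fun j => MeasurableSet.iInter
        fun _ => measurableSet_le (measurable_pi_apply (σ i)) (measurable_pi_apply (σ j))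
    · refine MeasurableSet.iInter fun i => MeasurableSet.iInter fun j => MeasurableSet.iInter
        fun _ => ?_
      by_cases h : σ i < σ j
      · simp [h]
      · simp only [h, imp_false]
        exact (measurableSet_eq_fun (measurable_pi_apply (σ i))
          (measurable_pi_apply (σ j))).compl
  refine measurable_pi_iff.2 fun i => ?_
  intro s hs
  have : (fun v : Fin m → unitInterval => sortedLatent v i) ⁻¹' s
      = ⋃ σ : Equiv.Perm (Fin m), {v | σ = Tuple.sort v} ∩ {v | v (σ i) ∈ s} := by
    ext v
    simp [sortedLatent]
  rw [this]
  exact MeasurableSet.iUnion fun σ => (hset σ).inter (measurable_pi_apply (σ i) hs)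

/-- The edge probabilities given the latent features `w`. -/
def edgeProb (V : unitInterval → unitInterval → ℝ) (w : Fin m → unitInterval)
    (e : VertexPair m) : ℝ := V (w e.1.1) (w e.1.2)

/-- Fubini for the density: integrate first over the finitely many edge patterns given the latent
features. The density is at most $1$ on a finite measure, so boundedness of `F` gives integrability.
-/
theorem integral_graphSampleLaw {V : unitInterval → unitInterval → ℝ}
    (hV : Measurable (Function.uncurry V)) (hV01 : ∀ u v, V u v ∈ Set.Icc (0 : ℝ) 1)
    {F : GraphSample m → ℝ} (hF : Measurable F) {C : ℝ} (hC : ∀ ω, |F ω| ≤ C) :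
    ∫ ω, F ω ∂(graphSampleLaw V m)
      = ∫ v, bernoulliMean (edgeProb V (sortedLatent v)) fun s => F (v, s) := by
  have hprob : ∀ e : VertexPair m, Measurable fun ω : GraphSample m =>
      edgeProb V (sortedLatent ω.1) e := by
    intro e
    have h1 : Measurable fun ω : GraphSample m => sortedLatent ω.1 :=
      measurable_sortedLatent.comp measurable_fst
    exact hV.comp ((measurable_pi_iff.1 h1 e.1.1).prodMk (measurable_pi_iff.1 h1 e.1.2))
  have hwm : ∀ e : VertexPair m, Measurable fun ω : GraphSample m =>
      (if ω.2 e then edgeProb V (sortedLatent ω.1) e else 1 - edgeProb V (sortedLatent ω.1) e) := by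
    intro e
    refine Measurable.ite ?_ (hprob e) (measurable_const.sub (hprob e))
    have h1 : Measurable fun ω : GraphSample m => ω.2 e :=
      (measurable_pi_apply e).comp measurable_snd
    exact h1 (measurableSet_singleton true)
  have hw0 : ∀ (ω : GraphSample m) (e : VertexPair m),
      (if ω.2 e then edgeProb V (sortedLatent ω.1) e else 1 - edgeProb V (sortedLatent ω.1) e)
        ∈ Set.Icc (0 : ℝ) 1 := by
    intro ω e
    have := hV01 (sortedLatent ω.1 e.1.1) (sortedLatent ω.1 e.1.2)
    split_ifs
    · exact this
    · exact ⟨sub_nonneg.2 this.2, sub_le_self _ this.1⟩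
  have hdens : (fun ω : GraphSample m => ∏ e : VertexPair m,
      bernoulliWeight (V (sortedLatent ω.1 e.1.1) (sortedLatent ω.1 e.1.2)) (ω.2 e))
      = fun ω => ENNReal.ofReal (∏ e : VertexPair m,
        if ω.2 e then edgeProb V (sortedLatent ω.1) e else 1 - edgeProb V (sortedLatent ω.1) e) := by
    funext ω
    rw [ENNReal.ofReal_prod_of_nonneg fun e _ => (hw0 ω e).1]
    refine Finset.prod_congr rfl fun e _ => ?_
    simp only [bernoulliWeight, edgeProb]
    split_ifs <;> rfl
  have hprod : Measurable fun ω : GraphSample m => ∏ e : VertexPair m,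
      (if ω.2 e then edgeProb V (sortedLatent ω.1) e else 1 - edgeProb V (sortedLatent ω.1) e) :=
    Finset.measurable_prod _ fun e _ => hwm e
  have hprod0 : ∀ ω : GraphSample m, 0 ≤ ∏ e : VertexPair m,
      (if ω.2 e then edgeProb V (sortedLatent ω.1) e else 1 - edgeProb V (sortedLatent ω.1) e) :=
    fun ω => Finset.prod_nonneg fun e _ => (hw0 ω e).1
  have hprod1 : ∀ ω : GraphSample m, ∏ e : VertexPair m,
      (if ω.2 e then edgeProb V (sortedLatent ω.1) e else 1 - edgeProb V (sortedLatent ω.1) e) ≤ 1 :=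
    fun ω => Finset.prod_le_one (fun e _ => (hw0 ω e).1) fun e _ => (hw0 ω e).2
  rw [graphSampleLaw, hdens, integral_withDensity_eq_integral_toReal_smul hprod.ennreal_ofReal
    (Filter.Eventually.of_forall fun _ => ENNReal.ofReal_lt_top)]
  simp only [ENNReal.toReal_ofReal (hprod0 _), smul_eq_mul]
  rw [integral_prod]
  · refine integral_congr_ae (Filter.Eventually.of_forall fun v => ?_)
    simp only []
    rw [integral_count]
    rfl
  · refine Integrable.of_bound (hprod.mul hF).aestronglyMeasurable C
      (Filter.Eventually.of_forall fun ω => ?_)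
    rw [Real.norm_eq_abs, abs_mul, abs_of_nonneg (hprod0 ω)]
    exact (mul_le_of_le_one_left (abs_nonneg _) (hprod1 ω)).trans (hC ω)

theorem sum_sortedLatent (v : Fin m → unitInterval) (f : unitInterval → ℝ) :
    ∑ i, f (sortedLatent v i) = ∑ i, f (v i) :=
  Equiv.sum_comp (Tuple.sort v) fun i => f (v i)

/-- Sorting is a permutation, so every sum over all pairs can be computed with the independent
unsorted features. -/
theorem sum_sum_sortedLatent (v : Fin m → unitInterval) (f : unitInterval → unitInterval → ℝ) :
    ∑ i, ∑ j, f (sortedLatent v i) (sortedLatent v j) = ∑ i, ∑ j, f (v i) (v j) := by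
  rw [sum_sortedLatent v fun x => ∑ j, f x (sortedLatent v j)]
  exact Finset.sum_congr rfl fun i _ => sum_sortedLatent v (f (v i))

theorem monotone_sortedLatent (v : Fin m → unitInterval) : Monotone (sortedLatent v) :=
  Tuple.monotone_sort v

theorem integral_eval (i : Fin m) {f : unitInterval → ℝ} (hf : Measurable f) :
    ∫ v : Fin m → unitInterval, f (v i) = ∫ x, f x := by
  have := measurePreserving_eval (fun _ : Fin m => (volume : Measure unitInterval)) i
  rw [← this.map_eq, integral_map this.aemeasurable hf.aestronglyMeasurable]
  rfl

theorem integral_eval_eval {i j : Fin m} (hij : i ≠ j) {f : unitInterval → unitInterval → ℝ}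
    (hf : Measurable (Function.uncurry f)) {C : ℝ} (hC : ∀ x y, |f x y| ≤ C) :
    ∫ v : Fin m → unitInterval, f (v i) (v j) = ∫ x, ∫ y, f x y := by
  have hi := measurePreserving_eval (fun _ : Fin m => (volume : Measure unitInterval)) i
  have hj := measurePreserving_eval (fun _ : Fin m => (volume : Measure unitInterval)) j
  have hind := (iIndepFun_pi (μ := fun _ : Fin m => (volume : Measure unitInterval))
    (X := fun _ => id) fun _ => aemeasurable_id).indepFun hij
  have hmap := (indepFun_iff_map_prod_eq_prod_map_map (measurable_pi_apply i).aemeasurable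
    (measurable_pi_apply j).aemeasurable).1 hind
  have hi' : Measure.map (fun v : Fin m → unitInterval => v i)
    (Measure.pi fun _ => volume) = volume := hi.map_eq
  have hj' : Measure.map (fun v : Fin m → unitInterval => v j)
    (Measure.pi fun _ => volume) = volume := hj.map_eq
  have hmap' : Measure.map (fun v : Fin m → unitInterval => (v i, v j))
      (Measure.pi fun _ => volume) = volume.prod volume := by
    rw [← congrArg₂ Measure.prod hi' hj']
    exact hmap
  have h1 : ∫ v : Fin m → unitInterval, f (v i) (v j)
      = ∫ z, Function.uncurry f z ∂(Measure.map (fun v : Fin m → unitInterval => (v i, v j))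
        (Measure.pi fun _ => volume)) := by
    rw [integral_map ((measurable_pi_apply i).prodMk (measurable_pi_apply j)).aemeasurable
      hf.aestronglyMeasurable]
    rfl
  rw [h1, hmap', integral_prod]
  · rfl
  · exact Integrable.of_bound hf.aestronglyMeasurable C
      (Filter.Eventually.of_forall fun z => hC z.1 z.2)

/-- The $m(m-1)$ pairs of distinct indices are independent uniform pairs; the $m$ diagonal pairs
only see the diagonal of `f`. -/
theorem integral_sum_sum {f : unitInterval → unitInterval → ℝ}
    (hf : Measurable (Function.uncurry f)) {C : ℝ} (hC : ∀ x y, |f x y| ≤ C) :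
    ∫ v : Fin m → unitInterval, ∑ i, ∑ j, f (v i) (v j)
      = m * (m - 1) * (∫ x, ∫ y, f x y) + m * ∫ x, f x x := by
  have hint : ∀ i j, Integrable fun v : Fin m → unitInterval => f (v i) (v j) := fun i j =>
    Integrable.of_bound (Measurable.aestronglyMeasurable (hf.comp
      ((measurable_pi_apply i).prodMk (measurable_pi_apply j) :
        Measurable fun v : Fin m → unitInterval => (v i, v j)))) C
      (Filter.Eventually.of_forall fun z => hC _ _)
  rw [integral_finsetSum _ fun i _ => integrable_finsetSum _ fun j _ => hint i j]
  have hrow : ∀ i : Fin m, ∫ v : Fin m → unitInterval, ∑ j, f (v i) (v j)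
      = (m - 1) * (∫ x, ∫ y, f x y) + ∫ x, f x x := by
    intro i
    rw [integral_finsetSum _ fun j _ => hint i j, ← Finset.sum_erase_add _ _ (Finset.mem_univ i)]
    congr 1
    · rw [Finset.sum_congr rfl fun j hj =>
        integral_eval_eval (Finset.ne_of_mem_erase hj).symm hf hC, Finset.sum_const,
        Finset.card_erase_of_mem (Finset.mem_univ i), Finset.card_univ, Fintype.card_fin,
        nsmul_eq_mul, Nat.cast_sub i.pos, Nat.cast_one]
    · exact integral_eval i (f := fun x => f x x) (hf.comp (measurable_id.prodMk measurable_id))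
  rw [Finset.sum_congr rfl fun i _ => hrow i, Finset.sum_const, Finset.card_univ,
    Fintype.card_fin, nsmul_eq_mul]
  ring

end Law

/-! ### Integrals of Lipschitz kernels -/

section Lipschitz

theorem integral_abs_sub {a b c : ℝ} (hac : a ≤ c) (hcb : c ≤ b) :
    ∫ x in a..b, |x - c| = ((c - a) ^ 2 + (b - c) ^ 2) / 2 := by
  have hi : ∀ s t : ℝ, IntervalIntegrable (fun x => |x - c|) volume s t := fun s t =>
    (continuous_abs.comp (continuous_id.sub continuous_const)).intervalIntegrable _ _
  rw [← intervalIntegral.integral_add_adjacent_intervals (hi a c) (hi c b)]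
  have h1 : ∫ x in a..c, |x - c| = ∫ x in a..c, (c - x) := by
    refine intervalIntegral.integral_congr fun x hx => ?_
    rw [Set.uIcc_of_le hac] at hx
    rw [abs_sub_comm, abs_of_nonneg (sub_nonneg.2 hx.2)]
  have h2 : ∫ x in c..b, |x - c| = ∫ x in c..b, (x - c) := by
    refine intervalIntegral.integral_congr fun x hx => ?_
    rw [Set.uIcc_of_le hcb] at hx
    rw [abs_of_nonneg (sub_nonneg.2 hx.1)]
  rw [h1, h2, intervalIntegral.integral_sub (by simp) (by simp),
    intervalIntegral.integral_sub (by simp) (by simp), integral_id, integral_id]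
  simp only [intervalIntegral.integral_const, smul_eq_mul]
  ring

theorem integral_unitInterval_coe : ∫ u : unitInterval, (u : ℝ) = 1 / 2 := by
  rw [integral_unitInterval_eq fun x => x, integral_id]
  norm_num

theorem integral_unitInterval_sq : ∫ u : unitInterval, (u : ℝ) ^ 2 = 1 / 3 := by
  rw [integral_unitInterval_eq fun x => x ^ 2, integral_pow]
  norm_num

theorem integral_unitInterval_abs_sub (x : unitInterval) :
    ∫ y : unitInterval, |(y : ℝ) - x| = (x : ℝ) ^ 2 - x + 1 / 2 := by
  rw [integral_unitInterval_eq fun y => |y - x|, integral_abs_sub x.2.1 x.2.2]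
  ring

theorem integrable_of_continuous_unitInterval {f : unitInterval → ℝ} (hf : Continuous f) :
    Integrable f :=
  hf.integrable_of_hasCompactSupport (HasCompactSupport.of_compactSpace f)

theorem integral_integral_abs_sub :
    ∫ x : unitInterval, ∫ y : unitInterval, |(y : ℝ) - x| = 1 / 3 := by
  simp only [integral_unitInterval_abs_sub]
  have hi : ∀ f : unitInterval → ℝ, Continuous f → Integrable f := fun f =>
    integrable_of_continuous_unitInterval
  rw [integral_add (hi _ (by fun_prop)) (hi _ (by fun_prop)),
    integral_sub (hi _ (by fun_prop)) (hi _ (by fun_prop)), integral_unitInterval_sq,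
    integral_unitInterval_coe]
  simp

theorem integral_integral_max :
    ∫ x : unitInterval, ∫ y : unitInterval, max (x : ℝ) y = 2 / 3 := by
  have hi : ∀ f : unitInterval → ℝ, Continuous f → Integrable f := fun f =>
    integrable_of_continuous_unitInterval
  have h1 : ∀ x : unitInterval, ∫ y : unitInterval, max (x : ℝ) y = ((x : ℝ) ^ 2 + 1) / 2 := by
    intro x
    have h2 : ∀ y : unitInterval, max (x : ℝ) y = (x + y + |(y : ℝ) - x|) / 2 := by
      intro y
      rw [abs_sub_comm]
      linarith [max_add_min (x : ℝ) y, max_sub_min_eq_abs' (x : ℝ) y]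
    simp only [h2]
    rw [integral_div, integral_add (hi _ (by fun_prop)) (hi _ (by fun_prop)),
      integral_add (hi _ (by fun_prop)) (hi _ (by fun_prop)), integral_unitInterval_coe,
      integral_unitInterval_abs_sub]
    simp
    ring
  simp only [h1]
  rw [integral_div, integral_add (hi _ (by fun_prop)) (hi _ (by fun_prop)),
    integral_unitInterval_sq]
  simp
  norm_num

/-- A nonnegative function above a tent has a large integral. -/
theorem le_integral_of_tent_le {φ : unitInterval → ℝ} (hφ : Integrable φ) (h0 : ∀ y, 0 ≤ φ y)
    {k L t : ℝ} {a : unitInterval} (ht : t ∈ Set.Icc (0 : ℝ) 1)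
    (hk : ∀ y : unitInterval, k - L * |(y : ℝ) - a| ≤ φ y) :
    t * k - L * t ^ 2 * (((a : ℝ) ^ 2 + (1 - a) ^ 2) / 2) ≤ ∫ y, φ y := by
  let Φ : ℝ → ℝ := fun x => φ (Set.projIcc 0 1 zero_le_one x)
  have hΦ : ∀ u : unitInterval, φ u = Φ u := fun u => by simp [Φ]
  have ha := a.2
  -- The window of length $t$ starting at $a(1-t)$ stays in $[0,1]$ and is divided by $a$ in the
  -- ratio $a:1-a$, which gives the constant $(a^2+(1-a)^2)/2$.
  have hc0 : 0 ≤ (a : ℝ) * (1 - t) := mul_nonneg ha.1 (sub_nonneg.2 ht.2)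
  have hc1 : (a : ℝ) * (1 - t) + t ≤ 1 := by nlinarith [ha.2, ht.2]
  have hint : IntervalIntegrable Φ volume 0 1 := by
    rw [intervalIntegrable_iff_integrableOn_Icc_of_le zero_le_one]
    refine (unitInterval.measurePreserving_coe.integrable_comp_emb
      unitInterval.measurableEmbedding_coe).1 ?_
    exact hφ.congr (Filter.Eventually.of_forall hΦ)
  have hsub : IntervalIntegrable Φ volume ((a : ℝ) * (1 - t)) (a * (1 - t) + t) := by
    refine hint.mono_set ?_
    rw [Set.uIcc_of_le (by linarith [ht.1]), Set.uIcc_of_le zero_le_one]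
    exact Set.Icc_subset_Icc hc0 hc1
  calc t * k - L * t ^ 2 * (((a : ℝ) ^ 2 + (1 - a) ^ 2) / 2)
      = ∫ y in ((a : ℝ) * (1 - t))..(a * (1 - t) + t), (k - L * |y - a|) := by
        rw [intervalIntegral.integral_sub (by simp)
          (Continuous.intervalIntegrable (by fun_prop) _ _),
          intervalIntegral.integral_const_mul, integral_abs_sub (by nlinarith [ha.1, ht.1])
          (by nlinarith [ha.2, ht.1])]
        simp only [intervalIntegral.integral_const, smul_eq_mul]
        ring
    _ ≤ ∫ y in ((a : ℝ) * (1 - t))..(a * (1 - t) + t), Φ y := by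
        refine intervalIntegral.integral_mono_on (by linarith [ht.1])
          (Continuous.intervalIntegrable (by fun_prop) _ _) hsub fun y hy => ?_
        have hy' : y ∈ Set.Icc (0 : ℝ) 1 := ⟨hc0.trans hy.1, hy.2.trans hc1⟩
        have := hk ⟨y, hy'⟩
        simp only [Φ, Set.projIcc_of_mem zero_le_one hy']
        exact this
    _ ≤ ∫ y in (0 : ℝ)..1, Φ y :=
        intervalIntegral.integral_mono_interval hc0 (by linarith [ht.1]) hc1
          (Filter.Eventually.of_forall fun y => h0 _) hint
    _ = ∫ y, φ y := by
        rw [← integral_unitInterval_eq]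
        simp only [hΦ]

/-- A kernel on `[0, 1]²` that is `L`-Lipschitz for the `ℓ¹` distance. -/
def IsLipschitzKernel (L : ℝ) (g : unitInterval → unitInterval → ℝ) : Prop :=
  ∀ u v u' v' : unitInterval, |g u v - g u' v'| ≤ L * (|(u : ℝ) - u'| + |(v : ℝ) - v'|)

variable {L : ℝ} {g : unitInterval → unitInterval → ℝ}

theorem IsLipschitzKernel.continuous (hg : IsLipschitzKernel L g) :
    Continuous (Function.uncurry g) := by
  rw [continuous_iff_continuousAt]
  rintro ⟨u, v⟩
  rw [ContinuousAt, tendsto_iff_dist_tendsto_zero]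
  have h : Filter.Tendsto (fun z : unitInterval × unitInterval =>
      L * (|(z.1 : ℝ) - u| + |(z.2 : ℝ) - v|)) (nhds (u, v)) (nhds 0) := by
    have hc : Continuous fun z : unitInterval × unitInterval =>
      L * (|(z.1 : ℝ) - u| + |(z.2 : ℝ) - v|) := by fun_prop
    simpa using hc.tendsto (u, v)
  exact squeeze_zero (fun _ => dist_nonneg) (fun z => hg z.1 z.2 u v) h

theorem IsLipschitzKernel.continuous_integral (hg : IsLipschitzKernel L g) :
    Continuous fun u => ∫ v, g u v := by
  have hc := hg.continuous
  have := continuous_parametric_integral_of_continuous (μ := (volume : Measure unitInterval))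
    (f := g) hc (isCompact_univ (X := unitInterval))
  simpa using this

theorem IsLipschitzKernel.continuous_left (hg : IsLipschitzKernel L g) (u : unitInterval) :
    Continuous (g u) := hg.continuous.comp (Continuous.prodMk_right u)

theorem IsLipschitzKernel.continuous_diag (hg : IsLipschitzKernel L g) :
    Continuous fun u => g u u := hg.continuous.comp (continuous_id.prodMk continuous_id)

/-- Each section $g(u,\cdot)$ lies above a tent with peak $g(u,u)$ at $u$. Integrating the tent
bound over $u$ gives the constant $1/3$, the mean of $u^2-u+1/2$. -/
theorem IsLipschitzKernel.diag_le (hg : IsLipschitzKernel L g) (h0 : ∀ u v, 0 ≤ g u v)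
    {t : ℝ} (ht : t ∈ Set.Icc (0 : ℝ) 1) :
    t * (∫ u, g u u) - L * t ^ 2 / 3 ≤ ∫ u, ∫ v, g u v := by
  have hi : ∀ f : unitInterval → ℝ, Continuous f → Integrable f := fun f =>
    integrable_of_continuous_unitInterval
  have hd : Continuous fun u : unitInterval => t * g u u := hg.continuous_diag.const_mul t
  have h1 : ∫ u : unitInterval, (t * g u u - L * t ^ 2 * (((u : ℝ) ^ 2 + (1 - u) ^ 2) / 2))
      = t * (∫ u, g u u) - L * t ^ 2 / 3 := by
    have h2 : ∀ u : unitInterval, L * t ^ 2 * (((u : ℝ) ^ 2 + (1 - u) ^ 2) / 2)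
        = L * t ^ 2 * ((u : ℝ) ^ 2 - u + 1 / 2) := fun u => by ring
    simp only [h2, ← integral_unitInterval_abs_sub]
    rw [integral_sub (hi _ hd), integral_const_mul, integral_const_mul, integral_integral_abs_sub]
    · ring
    · simp only [integral_unitInterval_abs_sub]
      exact hi _ (by fun_prop)
  rw [← h1]
  refine integral_mono (hi _ (hd.sub (by fun_prop))) (hi _ hg.continuous_integral) fun u => ?_
  refine le_integral_of_tent_le (hi _ (hg.continuous_left u)) (h0 u) ht fun v => ?_
  have := (abs_le.1 (hg u u u v)).2
  simp only [sub_self, abs_zero, zero_add] at this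
  rw [abs_sub_comm]
  linarith

/-- The tent bound is used twice, in $v$ around $b$ and then in $u$ around $a$; each use costs at
most $Lt^3/2$ in total. -/
theorem IsLipschitzKernel.peak_le (hg : IsLipschitzKernel L g) (hL : 0 ≤ L)
    (h0 : ∀ u v, 0 ≤ g u v) {t : ℝ} (ht : t ∈ Set.Icc (0 : ℝ) 1) (a b : unitInterval) :
    t ^ 2 * (g a b - L * t) ≤ ∫ u, ∫ v, g u v := by
  have hi : ∀ f : unitInterval → ℝ, Continuous f → Integrable f := fun f =>
    integrable_of_continuous_unitInterval
  have hsq : ∀ c : unitInterval, ((c : ℝ) ^ 2 + (1 - c) ^ 2) / 2 ≤ 1 / 2 := fun c => by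
    nlinarith [c.2.1, c.2.2]
  have h1 : ∀ u : unitInterval, (t * g a b - L * t ^ 2 / 2) - t * L * |(u : ℝ) - a| ≤ ∫ v, g u v := by
    intro u
    have h2 := le_integral_of_tent_le (k := g u b) (L := L) (a := b) (hi _ (hg.continuous_left u))
      (h0 u) ht fun v => by
        have := (abs_le.1 (hg u b u v)).2
        simp only [sub_self, abs_zero, zero_add] at this
        rw [abs_sub_comm]
        linarith
    have h3 := (abs_le.1 (hg a b u b)).2
    simp only [sub_self, abs_zero, add_zero] at h3
    rw [abs_sub_comm] at h3
    have h4 := mul_le_mul_of_nonneg_left (hsq b) (mul_nonneg hL (sq_nonneg t))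
    nlinarith [ht.1]
  have h2 := le_integral_of_tent_le (hi _ hg.continuous_integral)
    (fun u => integral_nonneg fun v => h0 u v) ht h1
  have h4 := mul_le_mul_of_nonneg_left (hsq a) (mul_nonneg (mul_nonneg ht.1 hL) (sq_nonneg t))
  nlinarith [ht.1]

end Lipschitz

/-! ### The empirical quantile function -/

section Quantile

/-- In increasing order, with ties broken by index, the $i$-th entry (from $0$) is the maximum of
exactly $2i+1$ ordered pairs. -/
theorem sum_mul_eq_sum_max {m : ℕ} {w : Fin m → ℝ} (hw : Monotone w) :
    ∑ i : Fin m, (2 * (i : ℕ) + 1 : ℝ) * w i = ∑ i, ∑ j, max (w i) (w j) := by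
  induction m with
  | zero => simp
  | succ m ih =>
    have ih' := ih (w := fun i => w i.castSucc) (hw.comp Fin.strictMono_castSucc.monotone)
    rw [Fin.sum_univ_castSucc, Fin.sum_univ_castSucc (f := fun i => ∑ j, max (w i) (w j)),
      Fin.sum_univ_castSucc (f := fun j => max (w (Fin.last m)) (w j))]
    simp only [Fin.sum_univ_castSucc (n := m) (f := fun j => max (w (Fin.castSucc _)) (w j)),
      Finset.sum_add_distrib, Fin.val_castSucc, Fin.val_last]
    rw [ih']
    have h1 : ∀ i : Fin m, max (w i.castSucc) (w (Fin.last m)) = w (Fin.last m) := fun i =>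
      max_eq_right (hw (Fin.le_last _))
    have h2 : ∀ i : Fin m, max (w (Fin.last m)) (w i.castSucc) = w (Fin.last m) := fun i =>
      max_eq_left (hw (Fin.le_last _))
    simp only [h1, h2, max_self, Finset.sum_const, Finset.card_univ, Fintype.card_fin, nsmul_eq_mul]
    ring

variable {m : ℕ} [NeZero m]

/-- Expanding the square, the cross term weights the $i$-th order statistic by $(2i+1)/m^2$, which
turns into a sum of maxima. The right side is symmetric in the sample and continuous, so both its
mean and its measurability are immediate. -/
theorem integral_quantile_sub_sq (v : Fin m → unitInterval) :
    ∫ x : unitInterval, ((sortedLatent v (cellIndex m x) : ℝ) - x) ^ 2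
      = (m : ℝ)⁻¹ * (∑ i, (v i : ℝ) ^ 2) - ((m : ℝ) ^ 2)⁻¹ * (∑ i, ∑ j, max (v i : ℝ) (v j))
        + 1 / 3 := by
  have hi : ∀ f : Fin m → ℝ, Integrable fun x : unitInterval => f (cellIndex m x) := fun f =>
    (memLp_step f).integrable (by norm_num)
  have hi2 : ∀ f : Fin m → ℝ, Integrable fun x : unitInterval => (x : ℝ) * f (cellIndex m x) :=
    fun f => (hi f).bdd_mul (c := 1) (by fun_prop) (Filter.Eventually.of_forall fun x => by
      rw [Real.norm_eq_abs, abs_of_nonneg x.2.1]; exact x.2.2)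
  have h1 : ∀ x : unitInterval, ((sortedLatent v (cellIndex m x) : ℝ) - x) ^ 2
      = (fun i => (sortedLatent v i : ℝ) ^ 2) (cellIndex m x)
        - 2 * ((x : ℝ) * (fun i => (sortedLatent v i : ℝ)) (cellIndex m x)) + (x : ℝ) ^ 2 := by
    intro x
    simp only []
    ring
  simp only [h1]
  rw [integral_add, integral_sub, integral_const_mul,
    integral_step (fun i => (sortedLatent v i : ℝ) ^ 2),
    integral_coe_mul_step (fun i => (sortedLatent v i : ℝ)), integral_unitInterval_sq,
    sum_mul_eq_sum_max (w := fun i => (sortedLatent v i : ℝ))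
      (fun i j hij => monotone_sortedLatent v hij),
    sum_sum_sortedLatent v fun x y => max (x : ℝ) y,
    sum_sortedLatent v fun x => (x : ℝ) ^ 2]
  · ring
  · exact hi fun i => (sortedLatent v i : ℝ) ^ 2
  · exact (hi2 fun i => (sortedLatent v i : ℝ)).const_mul 2
  · exact (hi fun i => (sortedLatent v i : ℝ) ^ 2).sub
      ((hi2 fun i => (sortedLatent v i : ℝ)).const_mul 2)
  · exact integrable_of_continuous_unitInterval (by fun_prop)

/-- The mean squared `L²` distance between the empirical and the true quantile function. -/
theorem integral_integral_quantile_sub_sq :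
    ∫ v : Fin m → unitInterval, ∫ x : unitInterval,
      ((sortedLatent v (cellIndex m x) : ℝ) - x) ^ 2 = 1 / (6 * m) := by
  have hm : (0 : ℝ) < m := by exact_mod_cast NeZero.pos m
  simp only [integral_quantile_sub_sq]
  have hc : ∀ f : (Fin m → unitInterval) → ℝ, Continuous f → Integrable f := fun f hf =>
    hf.integrable_of_hasCompactSupport (HasCompactSupport.of_compactSpace f)
  rw [integral_add, integral_sub, integral_const_mul, integral_const_mul,
    -- The value is $\frac13-\frac1{m^2}\bigl(\frac23m(m-1)+\frac m2\bigr)+\frac13=\frac1{6m}$.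
    integral_finsetSum, integral_sum_sum (f := fun x y : unitInterval => max (x : ℝ) y) (C := 1),
    integral_integral_max]
  · have h2 : ∀ i : Fin m, ∫ v : Fin m → unitInterval, (v i : ℝ) ^ 2 = 1 / 3 := fun i => by
      rw [integral_eval i (f := fun x => (x : ℝ) ^ 2) (by fun_prop), integral_unitInterval_sq]
    simp only [h2, max_self, integral_unitInterval_coe]
    simp
    field_simp
    ring
  · have : Continuous (Function.uncurry fun x y : unitInterval => max (x : ℝ) y) :=
      (continuous_subtype_val.comp continuous_fst).max (continuous_subtype_val.comp continuous_snd)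
    exact this.measurable
  · intro x y
    rw [abs_of_nonneg (le_max_of_le_left x.2.1)]
    exact max_le x.2.2 y.2.2
  · exact fun i _ => hc _ (by fun_prop)
  · exact hc _ (by fun_prop)
  · exact hc _ (by fun_prop)
  · exact hc _ (by fun_prop)
  · exact hc _ (by fun_prop)

end Quantile

/-! ### Moments of the sampled adjacency matrix -/

section Sample

/-- A symmetric Lipschitz kernel with values in `[0, 1]`. -/
structure IsLipschitzGraphon (L : ℝ) (V : unitInterval → unitInterval → ℝ) : Prop where
  symm : ∀ u v, V u v = V v u
  mem : ∀ u v, V u v ∈ Set.Icc (0 : ℝ) 1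
  lip : IsLipschitzKernel L V
  nonneg : 0 ≤ L

variable {m : ℕ}

/-- The symmetric matrix of a family of edge indicators. -/
def edgeMatrix (s : VertexPair m → Bool) : Matrix (Fin m) (Fin m) ℝ :=
  Matrix.of fun i j => if s ⟨(min i j, max i j), min_le_max⟩ then 1 else 0

theorem edgeMatrix_eq_zero_or_one (s : VertexPair m → Bool) (i j : Fin m) :
    edgeMatrix s i j = 0 ∨ edgeMatrix s i j = 1 := by
  simp only [edgeMatrix, Matrix.of_apply]
  split_ifs
  · exact Or.inr rfl
  · exact Or.inl rfl

theorem edgeMatrix_abs_le (s : VertexPair m → Bool) (i j : Fin m) : |edgeMatrix s i j| ≤ 1 := by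
  rcases edgeMatrix_eq_zero_or_one s i j with h | h <;> simp [h]

theorem edgeMatrix_symm (s : VertexPair m → Bool) (i j : Fin m) :
    edgeMatrix s i j = edgeMatrix s j i := by
  simp only [edgeMatrix, Matrix.of_apply, min_comm i j, max_comm i j]

variable {L : ℝ} {V : unitInterval → unitInterval → ℝ}

theorem IsLipschitzGraphon.measurable (hV : IsLipschitzGraphon L V) :
    Measurable (Function.uncurry V) := hV.lip.continuous.measurable

theorem IsLipschitzGraphon.isBoundedKernel (hV : IsLipschitzGraphon L V) : IsBoundedKernel V where
  measurable := hV.measurable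
  abs_le u v := by
    rw [abs_of_nonneg (hV.mem u v).1]
    exact (hV.mem u v).2

theorem IsLipschitzGraphon.edgeProb_mem (hV : IsLipschitzGraphon L V) (w : Fin m → unitInterval)
    (e : VertexPair m) : edgeProb V w e ∈ Set.Icc (0 : ℝ) 1 := hV.mem _ _

theorem IsLipschitzGraphon.edgeProb_pair (hV : IsLipschitzGraphon L V) (w : Fin m → unitInterval)
    (i j : Fin m) : edgeProb V w ⟨(min i j, max i j), min_le_max⟩ = V (w i) (w j) := by
  rcases le_total i j with h | h
  · simp only [edgeProb, min_eq_left h, max_eq_right h]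
  · simp only [edgeProb, min_eq_right h, max_eq_left h]
    exact hV.symm _ _

theorem IsLipschitzGraphon.bernoulliMean_edgeMatrix (hV : IsLipschitzGraphon L V)
    (w : Fin m → unitInterval) (i j : Fin m) (φ : ℝ → ℝ) :
    bernoulliMean (edgeProb V w) (fun s => φ (edgeMatrix s i j))
      = V (w i) (w j) * φ 1 + (1 - V (w i) (w j)) * φ 0 := by
  have h := bernoulliMean_apply (edgeProb V w) ⟨(min i j, max i j), min_le_max⟩
    fun b => φ (if b then 1 else 0)
  rw [hV.edgeProb_pair] at h
  simpa [edgeMatrix] using h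

theorem IsLipschitzGraphon.bernoulliMean_edgeMatrix_mul (hV : IsLipschitzGraphon L V)
    (w : Fin m → unitInterval) {i k : Fin m} (hik : i ≠ k) (j : Fin m) (φ : ℝ → ℝ) :
    bernoulliMean (edgeProb V w) (fun s => φ (edgeMatrix s i j) * φ (edgeMatrix s k j))
      = (V (w i) (w j) * φ 1 + (1 - V (w i) (w j)) * φ 0)
        * (V (w k) (w j) * φ 1 + (1 - V (w k) (w j)) * φ 0) := by
  -- Entries of one column belong to different unordered pairs, so they are conditionally
  -- independent despite the symmetry of the matrix.
  have hne : (⟨(min i j, max i j), min_le_max⟩ : VertexPair m)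
      ≠ ⟨(min k j, max k j), min_le_max⟩ := by
    intro h
    simp only [Subtype.mk.injEq, Prod.mk.injEq, Fin.ext_iff, Fin.coe_min, Fin.coe_max] at h
    exact hik (Fin.ext (by omega))
  have h := bernoulliMean_mul_apply (edgeProb V w) hne (fun b => φ (if b then 1 else 0))
    fun b => φ (if b then 1 else 0)
  rw [hV.edgeProb_pair, hV.edgeProb_pair] at h
  simpa [edgeMatrix] using h

theorem measurable_snd_comp (f : (VertexPair m → Bool) → ℝ) :
    Measurable fun ω : GraphSample m => f ω.2 :=
  (measurable_of_countable f).comp measurable_snd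

theorem exists_abs_le_of_finite {κ : Type*} [Finite κ] (f : κ → ℝ) : ∃ C, ∀ s, |f s| ≤ C := by
  obtain ⟨C, hC⟩ := (Set.finite_range fun s => |f s|).bddAbove
  exact ⟨C, fun s => hC ⟨s, rfl⟩⟩

theorem IsLipschitzGraphon.integral_snd (hV : IsLipschitzGraphon L V)
    (f : (VertexPair m → Bool) → ℝ) :
    ∫ ω, f ω.2 ∂(graphSampleLaw V m) = ∫ v, bernoulliMean (edgeProb V (sortedLatent v)) f := by
  obtain ⟨C, hC⟩ := exists_abs_le_of_finite f
  exact integral_graphSampleLaw hV.measurable hV.mem (measurable_snd_comp f) fun ω => hC ω.2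

theorem integrable_snd [IsProbabilityMeasure (graphSampleLaw V m)]
    (f : (VertexPair m → Bool) → ℝ) : Integrable (fun ω => f ω.2) (graphSampleLaw V m) := by
  obtain ⟨C, hC⟩ := exists_abs_le_of_finite f
  exact Integrable.of_bound (measurable_snd_comp f).aestronglyMeasurable C
    (Filter.Eventually.of_forall fun ω => hC ω.2)

/-- The expectation of a function of the graph is bounded by the expectation of a bound on its
conditional expectations given the latent features. -/
theorem IsLipschitzGraphon.integral_snd_le (hV : IsLipschitzGraphon L V)
    {f : (VertexPair m → Bool) → ℝ} (hf : ∀ s, 0 ≤ f s) {c : (Fin m → unitInterval) → ℝ}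
    (hc : Integrable c)
    (hfc : ∀ v, bernoulliMean (edgeProb V (sortedLatent v)) f ≤ c v) :
    ∫ ω, f ω.2 ∂(graphSampleLaw V m) ≤ ∫ v, c v := by
  rw [hV.integral_snd]
  refine integral_mono_of_nonneg (Filter.Eventually.of_forall fun v => ?_) hc
    (Filter.Eventually.of_forall hfc)
  have := bernoulliMean_mono (hV.edgeProb_mem (sortedLatent v)) hf
  rwa [bernoulliMean_const] at this

/-- The variance of an edge indicator with given latent features. -/
def edgeVariance (V : unitInterval → unitInterval → ℝ) (u v : unitInterval) : ℝ :=
  V u v * (1 - V u v)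

theorem IsLipschitzGraphon.edgeVariance_nonneg (hV : IsLipschitzGraphon L V) (u v : unitInterval) :
    0 ≤ edgeVariance V u v :=
  mul_nonneg (hV.mem u v).1 (sub_nonneg.2 (hV.mem u v).2)

theorem IsLipschitzGraphon.edgeVariance_le_one (hV : IsLipschitzGraphon L V) (u v : unitInterval) :
    |edgeVariance V u v| ≤ 1 := by
  rw [abs_of_nonneg (hV.edgeVariance_nonneg u v), edgeVariance]
  nlinarith [(hV.mem u v).1, (hV.mem u v).2]

/-- The function $p(1-p)$ is $1$-Lipschitz on $[0,1]$, so the variance inherits the constant of `V`.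
-/
theorem IsLipschitzGraphon.edgeVariance_lip (hV : IsLipschitzGraphon L V) :
    IsLipschitzKernel L (edgeVariance V) := by
  intro u v u' v'
  have h : edgeVariance V u v - edgeVariance V u' v'
      = (V u v - V u' v') * (1 - V u v - V u' v') := by
    simp only [edgeVariance]; ring
  rw [h, abs_mul]
  refine (mul_le_of_le_one_right (abs_nonneg _) ?_).trans (hV.lip u v u' v')
  rw [abs_le]
  constructor <;> linarith [(hV.mem u v).1, (hV.mem u v).2, (hV.mem u' v').1, (hV.mem u' v').2]

variable [NeZero m]

theorem measurable_stepKernel (M : Matrix (Fin m) (Fin m) ℝ) :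
    Measurable (Function.uncurry (stepKernel M)) :=
  (measurable_of_countable (Function.uncurry M)).comp
    ((measurable_cellIndex.comp measurable_fst).prodMk (measurable_cellIndex.comp measurable_snd))

theorem IsLipschitzGraphon.isBoundedKernel_sub (hV : IsLipschitzGraphon L V)
    (s : VertexPair m → Bool) :
    IsBoundedKernel fun u v => stepKernel (edgeMatrix s) u v - V u v where
  measurable := (measurable_stepKernel _).sub hV.measurable
  abs_le u v := by
    have h1 := hV.mem u v
    simp only [stepKernel]
    rw [abs_le]
    rcases edgeMatrix_eq_zero_or_one s (cellIndex m u) (cellIndex m v) with h | h <;> rw [h] <;>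
      constructor <;> linarith [h1.1, h1.2]

/-- The squared `L²` distance between the step kernel of a graph and a kernel. -/
def kernelDistSq (V : unitInterval → unitInterval → ℝ) (s : VertexPair m → Bool) : ℝ :=
  ∫ v, ∫ u, (stepKernel (edgeMatrix s) u v - V u v) ^ 2

theorem integral_integral_step (f : Fin m → Fin m → ℝ) :
    ∫ v : unitInterval, ∫ u : unitInterval, f (cellIndex m u) (cellIndex m v)
      = ((m : ℝ) ^ 2)⁻¹ * ∑ i, ∑ j, f i j := by
  have h1 : ∀ v : unitInterval, ∫ u : unitInterval, f (cellIndex m u) (cellIndex m v)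
      = (fun j => (m : ℝ)⁻¹ * ∑ i, f i j) (cellIndex m v) := fun v =>
    integral_step fun i => f i (cellIndex m v)
  simp only [h1]
  rw [integral_step fun j => (m : ℝ)⁻¹ * ∑ i, f i j, ← Finset.mul_sum, ← mul_assoc,
    Finset.sum_comm, sq, mul_inv]

/-- Bias and variance: the conditional mean of (edge minus $V(x,y))^2$ is the edge variance at the
latent points plus a squared bias. The bias is Lipschitz in the quantile displacements, and
$(a+b)^2\le2a^2+2b^2$ gives $2L^2$ for each variable, hence $4L^2$. -/
theorem IsLipschitzGraphon.bernoulliMean_kernelDistSq_le (hV : IsLipschitzGraphon L V)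
    (v : Fin m → unitInterval) :
    bernoulliMean (edgeProb V (sortedLatent v)) (kernelDistSq V)
      ≤ ((m : ℝ) ^ 2)⁻¹ * (∑ i, ∑ j, edgeVariance V (v i) (v j))
        + 4 * L ^ 2 * ∫ x : unitInterval, ((sortedLatent v (cellIndex m x) : ℝ) - x) ^ 2 := by
  set w := sortedLatent v with hw
  have hk := hV.isBoundedKernel_sub (m := m)
  let q : unitInterval → ℝ := fun x => ((w (cellIndex m x) : ℝ) - x) ^ 2
  have hqm : Measurable q := by
    have : Measurable fun x : unitInterval => (w (cellIndex m x) : ℝ) :=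
      (measurable_of_countable fun i => (w i : ℝ)).comp measurable_cellIndex
    exact (this.sub measurable_subtype_coe).pow_const 2
  have hq1 : ∀ x, |q x| ≤ 1 := by
    intro x
    have h1 := (w (cellIndex m x)).2
    have h2 := x.2
    rw [abs_of_nonneg (sq_nonneg _)]
    simp only [q]
    have : |(w (cellIndex m x) : ℝ) - x| ≤ 1 := by
      rw [abs_le]; constructor <;> linarith [h1.1, h1.2, h2.1, h2.2]
    rw [← sq_abs]
    exact pow_le_one₀ (abs_nonneg _) this
  have hqi : Integrable q := Integrable.of_bound hqm.aestronglyMeasurable 1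
    (Filter.Eventually.of_forall hq1)
  let G : Fin m → Fin m → ℝ := fun i j => edgeVariance V (w i) (w j)
  have hGi : ∀ y, Integrable fun x : unitInterval => G (cellIndex m x) (cellIndex m y) := fun y =>
    (memLp_step fun i => G i (cellIndex m y)).integrable (by norm_num)
  have hpt : ∀ x y : unitInterval, bernoulliMean (edgeProb V w)
      (fun s => (stepKernel (edgeMatrix s) x y - V x y) ^ 2)
      ≤ G (cellIndex m x) (cellIndex m y) + 2 * L ^ 2 * q x + 2 * L ^ 2 * q y := by
    intro x y
    have h1 := hV.bernoulliMean_edgeMatrix w (cellIndex m x) (cellIndex m y)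
      fun a => (a - V x y) ^ 2
    have h2 := hV.lip (w (cellIndex m x)) (w (cellIndex m y)) x y
    simp only [stepKernel]
    rw [h1]
    simp only [G, edgeVariance, q]
    have h3 : (V (w (cellIndex m x)) (w (cellIndex m y)) - V x y) ^ 2
        ≤ (L * (|(w (cellIndex m x) : ℝ) - x| + |(w (cellIndex m y) : ℝ) - y|)) ^ 2 :=
      sq_le_sq' (by linarith [(abs_le.1 h2).1]) (abs_le.1 h2).2
    have h4 : (|(w (cellIndex m x) : ℝ) - x| + |(w (cellIndex m y) : ℝ) - y|) ^ 2
        ≤ 2 * ((w (cellIndex m x) : ℝ) - x) ^ 2 + 2 * ((w (cellIndex m y) : ℝ) - y) ^ 2 := by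
      rw [← sq_abs ((w (cellIndex m x) : ℝ) - x), ← sq_abs ((w (cellIndex m y) : ℝ) - y)]
      nlinarith [sq_nonneg (|(w (cellIndex m x) : ℝ) - x| - |(w (cellIndex m y) : ℝ) - y|)]
    rw [mul_pow] at h3
    nlinarith [mul_le_mul_of_nonneg_left h4 (sq_nonneg L)]
  have hsec : ∀ (s : VertexPair m → Bool) (y : unitInterval),
      Integrable fun x => (stepKernel (edgeMatrix s) x y - V x y) ^ 2 := fun s y =>
    ((hk s).memLp_section y).integrable_sq
  have hout : ∀ s : VertexPair m → Bool,
      Integrable fun y => ∫ x, (stepKernel (edgeMatrix s) x y - V x y) ^ 2 := fun s =>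
    (hk s).integrable_sq.integral_prod_left
  have hmean : bernoulliMean (edgeProb V w) (kernelDistSq V)
      = ∫ y, ∫ x, bernoulliMean (edgeProb V w)
        (fun s => (stepKernel (edgeMatrix s) x y - V x y) ^ 2) := by
    unfold kernelDistSq
    rw [bernoulliMean_integral _ hout]
    refine integral_congr_ae (Filter.Eventually.of_forall fun y => ?_)
    exact bernoulliMean_integral _ fun s => hsec s y
  have hmi : ∀ y, Integrable fun x => bernoulliMean (edgeProb V w)
        (fun s => (stepKernel (edgeMatrix s) x y - V x y) ^ 2) := fun y =>
    integrable_finsetSum _ fun s _ => (hsec s y).const_mul _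
  have hmo : Integrable fun y => ∫ x, bernoulliMean (edgeProb V w)
        (fun s => (stepKernel (edgeMatrix s) x y - V x y) ^ 2) := by
    have : ∀ y, ∫ x, bernoulliMean (edgeProb V w)
        (fun s => (stepKernel (edgeMatrix s) x y - V x y) ^ 2)
        = bernoulliMean (edgeProb V w)
        (fun s => ∫ x, (stepKernel (edgeMatrix s) x y - V x y) ^ 2) := fun y =>
      (bernoulliMean_integral _ fun s => hsec s y).symm
    simp only [this]
    exact integrable_finsetSum _ fun s _ => (hout s).const_mul _
  have hGo : Integrable fun y : unitInterval => ∫ x : unitInterval,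
      G (cellIndex m x) (cellIndex m y) :=
    (memLp_step fun j => ∫ x : unitInterval, G (cellIndex m x) j).integrable (by norm_num)
  have hinner : ∀ y : unitInterval, ∫ x : unitInterval, (G (cellIndex m x) (cellIndex m y)
      + 2 * L ^ 2 * q x + 2 * L ^ 2 * q y) = (∫ x : unitInterval, G (cellIndex m x) (cellIndex m y))
        + 2 * L ^ 2 * (∫ x, q x) + 2 * L ^ 2 * q y := by
    intro y
    have hsum : Integrable fun x : unitInterval =>
        G (cellIndex m x) (cellIndex m y) + 2 * L ^ 2 * q x := (hGi y).add (hqi.const_mul _)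
    rw [integral_add hsum (integrable_const _), integral_add (hGi y) (hqi.const_mul _), integral_const_mul]
    simp
  rw [hmean]
  calc ∫ y, ∫ x, bernoulliMean (edgeProb V w)
        (fun s => (stepKernel (edgeMatrix s) x y - V x y) ^ 2)
      ≤ ∫ y : unitInterval, ((∫ x : unitInterval, G (cellIndex m x) (cellIndex m y))
        + 2 * L ^ 2 * (∫ x, q x) + 2 * L ^ 2 * q y) := by
        refine integral_mono hmo ((hGo.add (integrable_const _)).add (hqi.const_mul _)) fun y => ?_
        simp only []
        rw [← hinner y]
        exact integral_mono (hmi y) (((hGi y).add (hqi.const_mul _)).add (integrable_const _))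
          fun x => hpt x y
    _ = _ := by
        have hsum : Integrable fun y : unitInterval =>
            (∫ x : unitInterval, G (cellIndex m x) (cellIndex m y)) + 2 * L ^ 2 * ∫ x, q x :=
          hGo.add (integrable_const _)
        rw [integral_add hsum (hqi.const_mul _), integral_add hGo (integrable_const _),
          integral_const, integral_const_mul (2 * L ^ 2) q, integral_integral_step G,
          sum_sum_sortedLatent v (edgeVariance V), probReal_univ, one_smul]
        change _ = _ + 4 * L ^ 2 * ∫ x, q x
        ring

theorem IsLipschitzGraphon.integral_kernelDistSq_le (hV : IsLipschitzGraphon L V) :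
    ∫ ω, kernelDistSq V ω.2 ∂(graphSampleLaw V m)
      ≤ (1 - 1 / m) * (∫ u, ∫ v, edgeVariance V u v) + (∫ u, edgeVariance V u u) / m
        + 4 * L ^ 2 / (6 * m) := by
  have hm : (0 : ℝ) < m := by exact_mod_cast NeZero.pos m
  have hc : ∀ f : (Fin m → unitInterval) → ℝ, Continuous f → Integrable f := fun f hf =>
    hf.integrable_of_hasCompactSupport (HasCompactSupport.of_compactSpace f)
  have hE : ∀ i j : Fin m, Continuous fun v : Fin m → unitInterval =>
      edgeVariance V (v i) (v j) := fun i j =>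
    hV.edgeVariance_lip.continuous.comp ((continuous_apply i).prodMk (continuous_apply j) :
      Continuous fun v : Fin m → unitInterval => (v i, v j))
  have h1 : Integrable fun v : Fin m → unitInterval => ∑ i, ∑ j, edgeVariance V (v i) (v j) :=
    hc _ (continuous_finsetSum _ fun i _ => continuous_finsetSum _ fun j _ => hE i j)
  have h2 : Integrable fun v : Fin m → unitInterval => ∫ x : unitInterval,
      ((sortedLatent v (cellIndex m x) : ℝ) - x) ^ 2 := by
    simp only [integral_quantile_sub_sq]
    exact hc _ (by fun_prop)
  refine (hV.integral_snd_le (f := kernelDistSq V) (fun s => integral_nonneg fun v =>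
    integral_nonneg fun u => sq_nonneg _) ((h1.const_mul _).add (h2.const_mul _))
    hV.bernoulliMean_kernelDistSq_le).trans_eq ?_
  rw [Pi.add_def, integral_add (h1.const_mul _) (h2.const_mul _), integral_const_mul,
    integral_const_mul,
    integral_sum_sum hV.edgeVariance_lip.continuous.measurable hV.edgeVariance_le_one,
    integral_integral_quantile_sub_sq]
  field_simp

end Sample

/-! ### Graphs that are almost empty or almost complete -/

section Sparse

theorem sum_sum_symm {m : ℕ} {b : Fin m → Fin m → ℝ} (hb : ∀ i j, b i j = b j i) :
    ∑ i, ∑ j, b i j = ∑ i, b i i + 2 * ∑ i, ∑ j, if i < j then b i j else 0 := by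
  have h1 : ∀ i j, b i j = (if i = j then b i i else 0) + (if i < j then b i j else 0)
      + (if j < i then b j i else 0) := by
    intro i j
    rcases lt_trichotomy i j with h | h | h
    · simp [h, h.ne, h.not_gt]
    · subst h; simp
    · simp [h, h.ne', h.not_gt, hb i j]
  have h2 : ∑ i, ∑ j, (if j < i then b j i else 0) = ∑ i, ∑ j, if i < j then b i j else 0 :=
    Finset.sum_comm
  calc ∑ i, ∑ j, b i j = ∑ i, ∑ j, ((if i = j then b i i else 0) + (if i < j then b i j else 0)
      + (if j < i then b j i else 0)) :=
        Finset.sum_congr rfl fun i _ => Finset.sum_congr rfl fun j _ => h1 i j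
    _ = _ := by
        simp only [Finset.sum_add_distrib, h2, Finset.sum_ite_eq, Finset.mem_univ, if_true]
        ring

/-- With $D$ ones on the diagonal and $K$ above it, the claim is $\sqrt{D+2K}\le D+\sqrt2K$, true
because the integers $D,K$ satisfy $D\le D^2$ and $K\le K^2$. The linear right side can be averaged
exactly, which improves on Jensen when few entries are nonzero. -/
theorem sqrt_sum_sum_le {m : ℕ} {b : Fin m → Fin m → ℝ} (hb : ∀ i j, b i j = b j i)
    (h01 : ∀ i j, b i j = 0 ∨ b i j = 1) :
    √(∑ i, ∑ j, b i j) ≤ (1 - √2 / 2) * ∑ i, b i i + √2 / 2 * ∑ i, ∑ j, b i j := by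
  have hself : ∀ {κ : Type} (t : Finset κ) (f : κ → ℝ), (∀ k, f k = 0 ∨ f k = 1) →
      0 ≤ ∑ k ∈ t, f k ∧ ∑ k ∈ t, f k ≤ (∑ k ∈ t, f k) ^ 2 := by
    intro κ t f hf
    have h0 : ∀ k, 0 ≤ f k := fun k => by rcases hf k with h | h <;> simp [h]
    refine ⟨Finset.sum_nonneg fun k _ => h0 k, ?_⟩
    refine le_trans (Finset.sum_le_sum fun k _ => ?_) (Finset.sum_sq_le_sq_sum_of_nonneg fun k _ => h0 k)
    rcases hf k with h | h <;> simp [h]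
  obtain ⟨hD0, hD⟩ := hself Finset.univ (fun i => b i i) fun i => h01 i i
  obtain ⟨hK0, hK⟩ := hself Finset.univ (fun z : Fin m × Fin m => if z.1 < z.2 then b z.1 z.2 else 0)
    fun z => by
      by_cases h : z.1 < z.2
      · simpa [h] using h01 z.1 z.2
      · simp [h]
  rw [← Finset.univ_product_univ, Finset.sum_product] at hK0 hK
  rw [sum_sum_symm hb]
  set D := ∑ i, b i i
  set K := ∑ i, ∑ j, if i < j then b i j else 0
  have h2 : √2 ^ 2 = 2 := Real.sq_sqrt (by norm_num)
  have h20 : 0 ≤ √2 := Real.sqrt_nonneg 2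
  rw [show (1 - √2 / 2) * D + √2 / 2 * (D + 2 * K) = D + √2 * K by ring]
  refine Real.sqrt_le_iff.2 ⟨by positivity, ?_⟩
  nlinarith [mul_nonneg (mul_nonneg h20 hD0) hK0]

variable {m : ℕ} {L : ℝ} {V : unitInterval → unitInterval → ℝ} {c : ℝ}

theorem IsLipschitzKernel.abs_sub_const {g : unitInterval → unitInterval → ℝ}
    (hg : IsLipschitzKernel L g) (c : ℝ) : IsLipschitzKernel L fun u v => |g u v - c| := by
  intro u v u' v'
  refine (abs_abs_sub_abs_le_abs_sub _ _).trans ?_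
  rw [sub_sub_sub_cancel_right]
  exact hg u v u' v'

theorem IsLipschitzGraphon.abs_sub_le_one (hV : IsLipschitzGraphon L V) (hc : c = 0 ∨ c = 1)
    (u v : unitInterval) : |V u v - c| ≤ 1 := by
  have := hV.mem u v
  rw [abs_le]
  rcases hc with rfl | rfl <;> constructor <;> linarith [this.1, this.2]

theorem IsLipschitzGraphon.bernoulliMean_sub_sq (hV : IsLipschitzGraphon L V) (hc : c = 0 ∨ c = 1)
    (w : Fin m → unitInterval) (i j : Fin m) :
    bernoulliMean (edgeProb V w) (fun s => (edgeMatrix s i j - c) ^ 2) = |V (w i) (w j) - c| := by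
  rw [hV.bernoulliMean_edgeMatrix w i j fun a => (a - c) ^ 2]
  have := hV.mem (w i) (w j)
  rcases hc with rfl | rfl
  · rw [sub_zero (V _ _), abs_of_nonneg this.1]; ring
  · rw [abs_of_nonpos (by linarith [this.2])]; ring

/-- Since $p(1-p)$ is invariant under $p\mapsto1-p$, both cases $c=0$ and $c=1$ can be handled
through the distance to `c`. -/
theorem IsLipschitzGraphon.edgeVariance_eq (hV : IsLipschitzGraphon L V) (hc : c = 0 ∨ c = 1)
    (u v : unitInterval) : edgeVariance V u v = |V u v - c| * (1 - |V u v - c|) := by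
  have := hV.mem u v
  rcases hc with rfl | rfl
  · rw [sub_zero, abs_of_nonneg this.1, edgeVariance]
  · rw [abs_of_nonpos (by linarith [this.2]), edgeVariance]; ring

/-- The conditional second moment of the sampled operator, compared with a constant kernel,
at a fixed function. -/
theorem IsLipschitzGraphon.bernoulliMean_sum_sq_le (hV : IsLipschitzGraphon L V)
    (hc : c = 0 ∨ c = 1) {b : ℝ} (hb : ∀ u v, |V u v - c| ≤ b)
    (w : Fin m → unitInterval) (y : Fin m → ℝ) (j : Fin m) :
    bernoulliMean (edgeProb V w) (fun s => (∑ i, (edgeMatrix s i j - c) * y i) ^ 2)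
      ≤ (b + b ^ 2 * m) * ∑ i, y i ^ 2 := by
  have hb0 : 0 ≤ b := (abs_nonneg _).trans (hb 0 0)
  have hterm : ∀ i k, bernoulliMean (edgeProb V w)
      (fun s => ((edgeMatrix s i j - c) * y i) * ((edgeMatrix s k j - c) * y k))
      ≤ (V (w i) (w j) - c) * y i * ((V (w k) (w j) - c) * y k)
        + if i = k then b * y i ^ 2 else 0 := by
    intro i k
    have h1 : ∀ s : VertexPair m → Bool,
        ((edgeMatrix s i j - c) * y i) * ((edgeMatrix s k j - c) * y k)
        = (y i * y k) * ((edgeMatrix s i j - c) * (edgeMatrix s k j - c)) := fun s => by ring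
    simp only [h1]
    rw [bernoulliMean_const_mul]
    by_cases hik : i = k
    · subst hik
      simp only [if_true, ← sq]
      rw [hV.bernoulliMean_sub_sq hc]
      nlinarith [mul_le_mul_of_nonneg_right (hb (w i) (w j)) (sq_nonneg (y i)),
        sq_nonneg ((V (w i) (w j) - c) * y i)]
    · rw [hV.bernoulliMean_edgeMatrix_mul w hik j fun a => a - c, if_neg hik, add_zero]
      exact le_of_eq (by ring)
  have hexp : ∀ s : VertexPair m → Bool, (∑ i, (edgeMatrix s i j - c) * y i) ^ 2
      = ∑ i, ∑ k, ((edgeMatrix s i j - c) * y i) * ((edgeMatrix s k j - c) * y k) := fun s => by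
    rw [sq, Finset.sum_mul_sum]
  simp only [hexp, bernoulliMean_sum]
  refine (Finset.sum_le_sum fun i _ => Finset.sum_le_sum fun k _ => hterm i k).trans ?_
  simp only [Finset.sum_add_distrib, Finset.sum_ite_eq, Finset.mem_univ, if_true]
  rw [← Finset.sum_mul_sum, ← sq, ← Finset.mul_sum]
  have hcs := Finset.sum_mul_sq_le_sq_mul_sq Finset.univ (fun i => V (w i) (w j) - c) y
  have hsum : ∑ i, (V (w i) (w j) - c) ^ 2 ≤ m * b ^ 2 := by
    refine (Finset.sum_le_card_nsmul _ _ (b ^ 2) fun i _ => ?_).trans_eq (by simp)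
    rw [← sq_abs]
    exact pow_le_pow_left₀ (abs_nonneg _) (hb _ _) 2
  have hy0 : 0 ≤ ∑ i, y i ^ 2 := Finset.sum_nonneg fun i _ => sq_nonneg _
  nlinarith [mul_le_mul_of_nonneg_right hsum hy0]

variable [NeZero m]

theorem kernelDistSq_const (c : ℝ) (s : VertexPair m → Bool) :
    kernelDistSq (fun _ _ => c) s = ((m : ℝ) ^ 2)⁻¹ * ∑ i, ∑ j, (edgeMatrix s i j - c) ^ 2 :=
  integral_integral_step fun i j => (edgeMatrix s i j - c) ^ 2

/-- For $c\in\{0,1\}$ the matrix of squared differences has entries $0$ and $1$, with conditional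
mean $|V-c|$, so `sqrt_sum_sum_le` applies before taking expectations. -/
theorem IsLipschitzGraphon.integral_sqrt_kernelDistSq_const_le (hV : IsLipschitzGraphon L V)
    (hc : c = 0 ∨ c = 1) :
    ∫ ω, √(kernelDistSq (fun _ _ => c) ω.2) ∂(graphSampleLaw V m)
      ≤ (∫ u, |V u u - c|) + √2 / 2 * (m - 1) * ∫ u, ∫ v, |V u v - c| := by
  have hm : (0 : ℝ) < m := by exact_mod_cast NeZero.pos m
  have hlip := hV.lip.abs_sub_const c
  have hci : ∀ f : (Fin m → unitInterval) → ℝ, Continuous f → Integrable f := fun f hf =>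
    hf.integrable_of_hasCompactSupport (HasCompactSupport.of_compactSpace f)
  have hE : ∀ i j : Fin m, Continuous fun v : Fin m → unitInterval => |V (v i) (v j) - c| :=
    fun i j => hlip.continuous.comp ((continuous_apply i).prodMk (continuous_apply j) :
      Continuous fun v : Fin m → unitInterval => (v i, v j))
  have h1 : Integrable fun v : Fin m → unitInterval => ∑ i, ∑ j, |V (v i) (v j) - c| :=
    hci _ (continuous_finsetSum _ fun i _ => continuous_finsetSum _ fun j _ => hE i j)
  have h2 : Integrable fun v : Fin m → unitInterval => ∑ i, |V (v i) (v i) - c| :=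
    hci _ (continuous_finsetSum _ fun i _ => hE i i)
  have hbound : ∀ s : VertexPair m → Bool, √(kernelDistSq (fun _ _ => c) s)
      ≤ (m : ℝ)⁻¹ * (1 - √2 / 2) * (∑ i, (edgeMatrix s i i - c) ^ 2)
        + (m : ℝ)⁻¹ * (√2 / 2) * ∑ i, ∑ j, (edgeMatrix s i j - c) ^ 2 := by
    intro s
    rw [kernelDistSq_const, Real.sqrt_mul (by positivity), Real.sqrt_inv, Real.sqrt_sq hm.le,
      mul_assoc, mul_assoc, ← mul_add]
    refine mul_le_mul_of_nonneg_left (sqrt_sum_sum_le (fun i j => by rw [edgeMatrix_symm])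
      fun i j => ?_) (by positivity)
    rcases hc with rfl | rfl <;> rcases edgeMatrix_eq_zero_or_one s i j with h | h <;> rw [h] <;>
      norm_num
  refine (hV.integral_snd_le (f := fun s => √(kernelDistSq (fun _ _ => c) s))
    (c := fun v => (m : ℝ)⁻¹ * (1 - √2 / 2) * (∑ i, |V (v i) (v i) - c|)
        + (m : ℝ)⁻¹ * (√2 / 2) * ∑ i, ∑ j, |V (v i) (v j) - c|)
    (fun s => Real.sqrt_nonneg _) ((h2.const_mul _).add (h1.const_mul _)) fun v => ?_).trans_eq ?_
  · refine (bernoulliMean_mono (hV.edgeProb_mem _) hbound).trans_eq ?_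
    rw [bernoulliMean_add, bernoulliMean_const_mul, bernoulliMean_const_mul, bernoulliMean_sum,
      bernoulliMean_sum]
    simp only [bernoulliMean_sum, hV.bernoulliMean_sub_sq hc]
    rw [sum_sum_sortedLatent v fun x y => |V x y - c|, sum_sortedLatent v fun x => |V x x - c|]
  · rw [integral_add (h2.const_mul _) (h1.const_mul _), integral_const_mul, integral_const_mul,
      integral_sum_sum (f := fun x y => |V x y - c|) (C := 1) hlip.continuous.measurable
      (fun x y => by rw [abs_abs]; exact hV.abs_sub_le_one hc x y),
      integral_finsetSum _ fun i _ => hci _ (hE i i)]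
    simp only [integral_eval _ (f := fun x => |V x x - c|) hlip.continuous_diag.measurable]
    simp
    field_simp
    ring

theorem isBoundedKernel_const (hc : c = 0 ∨ c = 1) :
    IsBoundedKernel fun _ _ : unitInterval => c where
  measurable := measurable_const
  abs_le _ _ := by rcases hc with rfl | rfl <;> simp

theorem isBoundedKernel_edgeMatrix_sub (hc : c = 0 ∨ c = 1) (s : VertexPair m → Bool) :
    IsBoundedKernel fun u v => stepKernel (edgeMatrix s) u v - c where
  measurable := (measurable_stepKernel _).sub measurable_const
  abs_le u v := by
    simp only [stepKernel]
    rcases hc with rfl | rfl <;>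
    rcases edgeMatrix_eq_zero_or_one s (cellIndex m u) (cellIndex m v) with h | h <;> rw [h] <;>
      norm_num

/-- Testing `f` against the step function of its own cell integrals: that step function has squared
norm $1/m$ times the sum, and Cauchy-Schwarz closes the loop. -/
theorem sum_sq_cellIntegral_le (f : Lp ℝ 2 (volume : Measure unitInterval)) :
    ∑ i : Fin m, (∫ u, (if cellIndex m u = i then 1 else 0) * f u) ^ 2 ≤ (m : ℝ)⁻¹ * ‖f‖ ^ 2 := by
  have hm : (0 : ℝ) < m := by exact_mod_cast NeZero.pos m
  set a : Fin m → ℝ := fun i => ∫ u, (if cellIndex m u = i then 1 else 0) * f u with ha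
  have hinner : inner ℝ (stepLp m a) f = ∑ i, a i ^ 2 := by
    rw [L2.inner_def]
    have h1 : ∫ u, inner ℝ (stepLp m a u) (f u)
        = ∫ u, ∑ i, a i * ((if cellIndex m u = i then 1 else 0) * f u) := by
      refine integral_congr_ae ?_
      filter_upwards [coeFn_stepLp a] with u hu
      rw [hu]
      simp [mul_comm]
    rw [h1, integral_finsetSum]
    · refine Finset.sum_congr rfl fun i _ => ?_
      rw [integral_const_mul, sq]
    · intro i _
      refine Integrable.const_mul ?_ _
      exact (memLp_step fun k => if k = i then (1 : ℝ) else 0).integrable_mul (Lp.memLp f)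
  have hnorm : ‖stepLp m a‖ ^ 2 = (m : ℝ)⁻¹ * ∑ i, a i ^ 2 := by
    rw [Lp.norm_sq_eq_integral, ← integral_step fun i => a i ^ 2]
    refine integral_congr_ae ?_
    filter_upwards [coeFn_stepLp a] with u hu
    rw [hu]
  have hcs := abs_real_inner_le_norm (stepLp m a) f
  have h0 : 0 ≤ ∑ i, a i ^ 2 := Finset.sum_nonneg fun i _ => sq_nonneg _
  rw [hinner, abs_of_nonneg h0] at hcs
  have h2 : (∑ i, a i ^ 2) ^ 2 ≤ (m : ℝ)⁻¹ * (∑ i, a i ^ 2) * ‖f‖ ^ 2 := by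
    rw [← hnorm, ← mul_pow]
    exact pow_le_pow_left₀ h0 hcs 2
  rcases h0.eq_or_lt with h | h
  · rw [← h]; positivity
  · rw [sq] at h2
    have : (∑ i, a i ^ 2) * (∑ i, a i ^ 2) ≤ (∑ i, a i ^ 2) * ((m : ℝ)⁻¹ * ‖f‖ ^ 2) := by
      linarith
    exact le_of_mul_le_mul_left this h

theorem norm_op_step_sub_const_sq (hc : c = 0 ∨ c = 1) (s : VertexPair m → Bool)
    (f : Lp ℝ 2 (volume : Measure unitInterval)) :
    ‖(isBoundedKernel_edgeMatrix_sub hc s).op volume f‖ ^ 2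
      = (m : ℝ)⁻¹ * ∑ j, (∑ i, (edgeMatrix s i j - c) *
        ∫ u, (if cellIndex m u = i then 1 else 0) * f u) ^ 2 := by
  rw [Lp.norm_sq_eq_integral, ← integral_step fun j => (∑ i, (edgeMatrix s i j - c) *
        ∫ u, (if cellIndex m u = i then 1 else 0) * f u) ^ 2]
  refine integral_congr_ae ?_
  filter_upwards [(isBoundedKernel_edgeMatrix_sub hc s).coeFn_op f] with v hv
  rw [hv]
  congr 1
  have h1 : ∀ u, (stepKernel (edgeMatrix s) u v - c) * f u
      = ∑ i, (edgeMatrix s i (cellIndex m v) - c) *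
        ((if cellIndex m u = i then 1 else 0) * f u) := by
    intro u
    simp [stepKernel]
  simp only [h1]
  rw [integral_finsetSum]
  · exact Finset.sum_congr rfl fun i _ => integral_const_mul _ _
  · intro i _
    refine Integrable.const_mul ?_ _
    exact (memLp_step fun k => if k = i then (1 : ℝ) else 0).integrable_mul (Lp.memLp f)

theorem IsLipschitzGraphon.integral_norm_op_sq_le (hV : IsLipschitzGraphon L V)
    (hc : c = 0 ∨ c = 1) {b : ℝ} (hb : ∀ u v, |V u v - c| ≤ b)
    (f : Lp ℝ 2 (volume : Measure unitInterval)) :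
    ∫ ω, ‖(isBoundedKernel_edgeMatrix_sub hc ω.2).op volume f‖ ^ 2 ∂(graphSampleLaw V m)
      ≤ (b / m + b ^ 2) * ‖f‖ ^ 2 := by
  have hm : (0 : ℝ) < m := by exact_mod_cast NeZero.pos m
  have hb0 : 0 ≤ b := (abs_nonneg _).trans (hb 0 0)
  refine (hV.integral_snd_le
    (f := fun s => ‖(isBoundedKernel_edgeMatrix_sub (m := m) hc s).op volume f‖ ^ 2)
    (c := fun _ => (b / m + b ^ 2) * ‖f‖ ^ 2) (fun s => sq_nonneg _) (integrable_const _)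
    fun v => ?_).trans_eq (by simp)
  simp only [norm_op_step_sub_const_sq hc]
  rw [bernoulliMean_const_mul, bernoulliMean_sum]
  have h1 := Finset.sum_le_sum fun j (_ : j ∈ (Finset.univ : Finset (Fin m))) =>
    hV.bernoulliMean_sum_sq_le hc hb (sortedLatent v)
      (fun i => ∫ u, (if cellIndex m u = i then 1 else 0) * f u) j
  rw [Finset.sum_const, Finset.card_univ, Fintype.card_fin, nsmul_eq_mul] at h1
  have h2 := sum_sq_cellIntegral_le (m := m) f
  calc _ ≤ (m : ℝ)⁻¹ * (m * ((b + b ^ 2 * m) *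
        ∑ i : Fin m, (∫ u, (if cellIndex m u = i then 1 else 0) * f u) ^ 2)) :=
        mul_le_mul_of_nonneg_left h1 (by positivity)
    _ ≤ (m : ℝ)⁻¹ * (m * ((b + b ^ 2 * m) * ((m : ℝ)⁻¹ * ‖f‖ ^ 2))) := by gcongr
    _ = (b / m + b ^ 2) * ‖f‖ ^ 2 := by field_simp

end Sparse

/-! ### Numerical estimates -/

section Numeric

/-- The numerical facts about a Lipschitz kernel with mean square `σ ^ 2` and diagonal mean `δ` for
which a sample of size `m` has comparatively many loops. -/
structure ManyLoops (m σ δ L : ℝ) : Prop where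
  one_le : 1 ≤ m
  pos : 0 < σ
  nonneg : 0 ≤ L
  diag_le : ∀ t ∈ Set.Icc (0 : ℝ) 1, t * δ - L * t ^ 2 / 3 ≤ σ ^ 2
  lt : σ ^ 2 < δ
  sq_lt : 8 / 3 * m * σ ^ 2 * L ^ 2 < (δ - σ ^ 2) ^ 2

variable {m σ δ L : ℝ}

theorem ManyLoops.L_pos (h : ManyLoops m σ δ L) : 0 < L := by
  have h1 := h.diag_le 1 ⟨zero_le_one, le_rfl⟩
  have := h.lt
  linarith

/-- At $t=1$ the diagonal bound gives $\delta-\sigma^2\le L/3$, so $\frac83m\sigma^2L^2<L^2/9$. -/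
theorem ManyLoops.mul_sq_lt (h : ManyLoops m σ δ L) : m * σ ^ 2 < 1 / 24 := by
  have h1 := h.diag_le 1 ⟨zero_le_one, le_rfl⟩
  have h2 := h.lt
  have hL := h.L_pos
  have h3 : (δ - σ ^ 2) ^ 2 ≤ (L / 3) ^ 2 :=
    pow_le_pow_left₀ (by linarith) (by linarith) 2
  have h4 : m * σ ^ 2 * L ^ 2 < 1 / 24 * L ^ 2 := by nlinarith [h.sq_lt]
  exact lt_of_mul_lt_mul_right h4 (sq_nonneg L)

/-- The best $t$ in the diagonal bound is $3\delta/(2L)$; the alternatives are whether it lies in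
$[0,1]$ or has to be replaced by $t=1$. -/
theorem ManyLoops.diag_cases (h : ManyLoops m σ δ L) :
    (3 * δ ^ 2 ≤ 4 * L * σ ^ 2 ∧ 2 * (m * L) < 1) ∨ (L < 3 * σ ^ 2 ∧ δ ≤ 2 * σ ^ 2) := by
  have hL := h.L_pos
  have hσ : 0 < σ ^ 2 := pow_pos h.pos 2
  have hδ : 0 < δ := hσ.trans h.lt
  rcases le_or_gt δ (2 * L / 3) with hc | hc
  · left
    have h1 := h.diag_le (3 * δ / (2 * L)) ⟨by positivity, by
      rw [div_le_one (by positivity)]; linarith⟩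
    have h2 : 3 * δ / (2 * L) * δ - L * (3 * δ / (2 * L)) ^ 2 / 3 = 3 * δ ^ 2 / (4 * L) := by
      field_simp
      ring
    rw [h2, div_le_iff₀ (by positivity)] at h1
    refine ⟨by linarith, ?_⟩
    have h3 : (δ - σ ^ 2) ^ 2 ≤ δ ^ 2 :=
      pow_le_pow_left₀ (by linarith [h.lt]) (by linarith) 2
    have h4 : (2 * (m * L)) * (σ ^ 2 * L) < 1 * (σ ^ 2 * L) := by nlinarith [h.sq_lt]
    exact lt_of_mul_lt_mul_right h4 (by positivity)
  · right
    have h1 := h.diag_le 1 ⟨zero_le_one, le_rfl⟩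
    constructor <;> linarith

theorem ManyLoops.mul_diag_sq_le (h : ManyLoops m σ δ L) : m * δ ^ 2 ≤ 2 / 3 * σ ^ 2 := by
  have hσ : 0 < σ ^ 2 := pow_pos h.pos 2
  have hδ : 0 < δ := hσ.trans h.lt
  have hm := h.one_le
  rcases h.diag_cases with ⟨h1, h2⟩ | ⟨-, h2⟩
  · nlinarith [mul_le_mul_of_nonneg_left h1 (by linarith : (0 : ℝ) ≤ m)]
  · have h3 : δ ^ 2 ≤ (2 * σ ^ 2) ^ 2 := pow_le_pow_left₀ hδ.le h2 2
    nlinarith [mul_le_mul_of_nonneg_left h3 (by linarith : (0 : ℝ) ≤ m), h.mul_sq_lt]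

/-- The maximum is attained at $x=3/4$. -/
theorem cube_mul_one_sub_le (x : ℝ) : x ^ 3 * (1 - x) ≤ 27 / 256 := by
  nlinarith [sq_nonneg (x - 3 / 4), sq_nonneg (x * (x - 3 / 4)), sq_nonneg (x ^ 2 - x / 4 - 3 / 8),
    sq_nonneg (x ^ 2 - 9 / 16), sq_nonneg (2 * x + 1), sq_nonneg ((x - 3 / 4) * (x + 1 / 4))]

/-- Optimizing the peak bound in $t$ gives $4(mg)^3\le27(mL)^2(m\sigma^2)$, and the defining
inequalities of `ManyLoops` bound the right side. The target $6/25$ is the value of $x(1-x)$ at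
$x=2/5$, which later separates `V` from $1/2$. -/
theorem ManyLoops.mul_le (h : ManyLoops m σ δ L) {g : ℝ} (hg0 : 0 ≤ g)
    (hg : ∀ t ∈ Set.Icc (0 : ℝ) 1, t ^ 2 * (g - L * t) ≤ σ ^ 2) : m * g ≤ 6 / 25 := by
  have hL := h.L_pos
  have hσ : 0 < σ ^ 2 := pow_pos h.pos 2
  have hδ : 0 < δ := hσ.trans h.lt
  have hm : 0 < m := by linarith [h.one_le]
  have hS := h.mul_sq_lt
  rcases le_or_gt (3 * L) (2 * g) with hc | hc
  · have h1 := hg 1 ⟨zero_le_one, le_rfl⟩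
    have h2 : g ≤ 3 * σ ^ 2 := by linarith
    nlinarith [mul_le_mul_of_nonneg_left h2 hm.le]
  -- The maximizer of $t^2(g-Lt)$.
  · have h1 := hg (2 * g / (3 * L)) ⟨by positivity, by rw [div_le_one (by positivity)]; linarith⟩
    have h2 : (2 * g / (3 * L)) ^ 2 * (g - L * (2 * g / (3 * L))) = 4 * g ^ 3 / (27 * L ^ 2) := by
      field_simp
      ring
    rw [h2, div_le_iff₀ (by positivity)] at h1
    have h3 : 4 * (m * g) ^ 3 ≤ 27 * ((m * L) ^ 2 * (m * σ ^ 2)) := by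
      have := mul_le_mul_of_nonneg_left h1 (pow_pos hm 3).le
      nlinarith
    have h4 : (m * L) ^ 2 * (m * σ ^ 2) ≤ 1 / 6 * (27 / 256) ^ 2 := by
      rcases h.diag_cases with ⟨ha, hb⟩ | ⟨ha, -⟩
      -- In these variables the diagonal bound reads $m\delta\le exs$ and the many-loops inequality
      -- reads $esx^2<m\delta-s^2$. Together $s\le e(x-x^2)$, and $mLs=x^2s/2\le\frac e2x^3(1-x)$.
      · set x := √(2 * (m * L)) with hx
        set s := √(m * σ ^ 2) with hs
        set e := √(2 / 3 : ℝ) with he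
        have hx2 : x ^ 2 = 2 * (m * L) := Real.sq_sqrt (by positivity)
        have hs2 : s ^ 2 = m * σ ^ 2 := Real.sq_sqrt (by positivity)
        have he2 : e ^ 2 = 2 / 3 := Real.sq_sqrt (by norm_num)
        have hx0 : 0 < x := Real.sqrt_pos.2 (by positivity)
        have hs0 : 0 < s := Real.sqrt_pos.2 (by positivity)
        have he0 : 0 < e := Real.sqrt_pos.2 (by norm_num)
        have h5 : m * δ ≤ e * x * s := by
          refine le_of_sq_le_sq ?_ (by positivity)
          have h6 : (e * x * s) ^ 2 = 2 / 3 * (2 * (m * L)) * (m * σ ^ 2) := by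
            rw [mul_pow, mul_pow, hx2, hs2, he2]
          rw [h6]
          nlinarith [mul_le_mul_of_nonneg_left ha (sq_nonneg m)]
        have h7 : e * s * x ^ 2 < m * δ - s ^ 2 := by
          refine lt_of_pow_lt_pow_left₀ 2 (by rw [hs2]; nlinarith [h.lt]) ?_
          have h8 : (e * s * x ^ 2) ^ 2 = m ^ 2 * (8 / 3 * m * σ ^ 2 * L ^ 2) := by
            rw [mul_pow, mul_pow, hx2, hs2, he2]; ring
          have h9 : (m * δ - s ^ 2) ^ 2 = m ^ 2 * (δ - σ ^ 2) ^ 2 := by rw [hs2]; ring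
          rw [h8, h9]
          exact mul_lt_mul_of_pos_left h.sq_lt (by positivity)
        have h10 : s ≤ e * (x - x ^ 2) := by
          have : s * s ≤ s * (e * (x - x ^ 2)) := by nlinarith
          exact le_of_mul_le_mul_left this hs0
        have h11 : m * L * s ≤ e / 2 * (27 / 256) := by
          have h12 := mul_le_mul_of_nonneg_left h10 (sq_nonneg x)
          have h13 := mul_le_mul_of_nonneg_left (cube_mul_one_sub_le x) he0.le
          nlinarith
        have h14 : (m * L * s) ^ 2 ≤ (e / 2 * (27 / 256)) ^ 2 :=
          pow_le_pow_left₀ (by positivity) h11 2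
        have h15 : (m * L * s) ^ 2 = (m * L) ^ 2 * (m * σ ^ 2) := by rw [mul_pow, hs2]
        have h16 : (e / 2 * (27 / 256)) ^ 2 = 1 / 6 * (27 / 256) ^ 2 := by
          rw [mul_pow, div_pow, he2]; norm_num
        rwa [h15, h16] at h14
      · have h5 : m * L ≤ 1 / 8 := by nlinarith
        have h6 : (m * L) ^ 2 ≤ (1 / 8) ^ 2 := pow_le_pow_left₀ (by positivity) h5 2
        calc (m * L) ^ 2 * (m * σ ^ 2) ≤ (1 / 8) ^ 2 * (1 / 24) :=
              mul_le_mul h6 hS.le (by positivity) (by norm_num)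
          _ ≤ _ := by norm_num
    -- It remains that $\frac{27}4\cdot\frac16\cdot(27/256)^2<(6/25)^3$.
    by_contra hcon
    push Not at hcon
    have h17 : (6 / 25 : ℝ) ^ 3 ≤ (m * g) ^ 3 := pow_le_pow_left₀ (by norm_num) hcon.le 3
    norm_num at h4 h17
    linarith

end Numeric

/-! ### Closing numerical inequalities for each range of the sample size -/

section Numeric

variable {m σ δ L : ℝ} {b p q ν : ℝ}

theorem sqrt_two_lt : √2 < 1.41422 := by
  rw [Real.sqrt_lt' (by norm_num)]; norm_num

theorem le_mul_of_sq_le_mul_sq {x y a r : ℝ} (h : x ^ 2 ≤ a * y ^ 2) (hy : 0 ≤ y) (hr : 0 ≤ r)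
    (har : a ≤ r ^ 2) : x ≤ r * y := by
  refine le_of_sq_le_sq ?_ (by positivity)
  rw [mul_pow]
  exact h.trans (mul_le_mul_of_nonneg_right har (sq_nonneg y))

theorem ManyLoops.sigma_lt (h : ManyLoops m σ δ L) : σ < 0.20413 := by
  have h1 := h.mul_sq_lt
  have h2 := h.one_le
  have h3 : σ ^ 2 < 0.20413 ^ 2 := by nlinarith [sq_nonneg σ]
  exact lt_of_pow_lt_pow_left₀ 2 (by norm_num) h3

/-- The bound for the mean distance to a constant kernel, for a single vertex. -/
theorem ManyLoops.bound_one (h : ManyLoops 1 σ δ L) (hq : q * (1 - b) ≤ σ ^ 2)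
    (hpq : p ≤ q + L / 3) (hν : ν ^ 2 ≤ b * q)
    (hb : (b = 2 / 5 ∧ 17 / 100 ≤ L) ∨ b = 31 / 100) :
    p + √2 / 2 * (1 - 1) * q + ν ≤ σ + 2 * L / √(6 * 1) := by
  have hσ := h.pos
  have hs := h.sigma_lt
  have hL := h.L_pos
  have h6 : √(6 * 1 : ℝ) ≤ 2.45 := by
    rw [Real.sqrt_le_left (by norm_num)]; norm_num
  have hτ : 0.816 * L ≤ 2 * L / √(6 * 1) := by
    rw [le_div_iff₀ (Real.sqrt_pos.2 (by norm_num))]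
    nlinarith [mul_le_mul_of_nonneg_left h6 hL.le]
  -- For $b=2/5$ the coefficients of $\sigma$ exceed $1$ and the excess is absorbed by
  -- $(0.816-\frac13)L$, using $L\ge0.17$ and $\sigma<0.20413$. For $b=0.31$ the coefficients
  -- already sum to less than $1$.
  rcases hb with ⟨rfl, hL2⟩ | rfl
  · have hq' : q ≤ 0.3403 * σ := by nlinarith
    have hν' : ν ≤ 0.8166 * σ :=
      le_mul_of_sq_le_mul_sq (a := 2 / 3) (by nlinarith) hσ.le (by norm_num) (by norm_num)
    linarith
  · have hq' : q ≤ 0.2959 * σ := by nlinarith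
    have hν' : ν ≤ 0.6704 * σ :=
      le_mul_of_sq_le_mul_sq (a := 31 / 69) (by nlinarith) hσ.le (by norm_num) (by norm_num)
    linarith

/-- For $m\le6$ one has $\sqrt{6m}\le6$, so the Lipschitz term pays for the $L/3$ lost in replacing
the diagonal mean `p` by the full mean `q`. -/
theorem ManyLoops.bound_small (h : ManyLoops m σ δ L) (h2 : 2 ≤ m) (h6 : m ≤ 6) (hq0 : 0 ≤ q)
    (hq : q * (1 - b) ≤ σ ^ 2) (hpq : p ≤ q + L / 3) (hν : ν ^ 2 ≤ b * q)
    (hb : b = 6 / (25 * m - 10)) :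
    p + √2 / 2 * (m - 1) * q + ν ≤ σ + 2 * L / √(6 * m) := by
  have hσ := h.pos
  have hL := h.L_pos
  have hb1 : b ≤ 3 / 20 := by
    rw [hb, div_le_iff₀ (by linarith)]; linarith
  have hτ : L / 3 ≤ 2 * L / √(6 * m) := by
    have h7 : √(6 * m) ≤ 6 := by
      rw [Real.sqrt_le_left (by norm_num)]; linarith
    rw [div_le_div_iff₀ (by norm_num) (Real.sqrt_pos.2 (by linarith))]
    nlinarith
  have hq1 : q ≤ 20 / 17 * σ ^ 2 := by nlinarith
  have hν' : ν ≤ 0.4202 * σ := by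
    refine le_mul_of_sq_le_mul_sq (a := 3 / 17) ?_ hσ.le (by norm_num) (by norm_num)
    nlinarith
  have hc : σ * (1 + 0.70711 * (m - 1)) ≤ 0.379 := by
    refine le_of_sq_le_sq ?_ (by norm_num)
    have h8 : (1 + 0.70711 * (m - 1)) ^ 2 ≤ 3.43 * m := by nlinarith
    rw [mul_pow]
    nlinarith [mul_le_mul_of_nonneg_left h8 (sq_nonneg σ), h.mul_sq_lt]
  have hs2 := sqrt_two_lt
  have h9 : √2 / 2 * (m - 1) * q ≤ 0.70711 * (m - 1) * q := by
    refine mul_le_mul_of_nonneg_right (mul_le_mul_of_nonneg_right (by linarith) (by linarith)) hq0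
  have h10 : (1 + 0.70711 * (m - 1)) * q ≤ 0.4459 * σ := by
    have h11 : (1 + 0.70711 * (m - 1)) * q ≤ (1 + 0.70711 * (m - 1)) * (20 / 17 * σ ^ 2) :=
      mul_le_mul_of_nonneg_left hq1 (by nlinarith)
    nlinarith [mul_le_mul_of_nonneg_right hc hσ.le]
  linarith

/-- Here the diagonal mean is controlled by $\delta$, and $m\delta^2\le\frac23\sigma^2$ makes $\sqrt
m\,p$ comparable to $\sigma$. The Lipschitz term is only used as nonnegative; everything is
multiplied by $\sqrt m$. -/
theorem ManyLoops.bound_large (h : ManyLoops m σ δ L) (h7 : 7 ≤ m) (hmσ : m * σ ≤ 9 / 10)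
    (hq0 : 0 ≤ q) (hq : q * (1 - b) ≤ σ ^ 2) (hp0 : 0 ≤ p) (hp : p * (1 - b) ≤ δ)
    (hν : ν ^ 2 ≤ b * q) (hb : b = 6 / (25 * m - 10)) :
    p + √2 / 2 * (m - 1) * q + ν ≤ σ + 2 * L / √(6 * m) := by
  have hσ := h.pos
  have hL := h.L_pos
  have hδ : 0 < δ := (pow_pos hσ 2).trans h.lt
  have hm0 : 0 < m := by linarith
  set W := √m with hW
  have hW2 : W ^ 2 = m := Real.sq_sqrt hm0.le
  have hW0 : 0 < W := Real.sqrt_pos.2 hm0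
  have hb1 : b ≤ 6 / 165 := by
    rw [hb, div_le_div_iff₀ (by linarith) (by norm_num)]; linarith
  have hb0 : 0 ≤ b := by
    rw [hb]; exact div_nonneg (by norm_num) (by linarith)
  have hbm : b * m ≤ 0.2546 := by
    rw [hb, div_mul_eq_mul_div, div_le_iff₀ (by linarith)]; linarith
  have hq1 : q ≤ 165 / 159 * σ ^ 2 := by nlinarith
  have hp1 : W * p ≤ 0.8475 * σ := by
    have h1 : p ≤ 165 / 159 * δ := by nlinarith
    have h2 : W * δ ≤ 0.8166 * σ := by
      refine le_mul_of_sq_le_mul_sq (a := 2 / 3) ?_ hσ.le (by norm_num) (by norm_num)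
      rw [mul_pow, hW2]
      exact h.mul_diag_sq_le
    nlinarith [mul_le_mul_of_nonneg_left h1 hW0.le]
  have hν1 : W * ν ≤ 0.5142 * σ := by
    refine le_mul_of_sq_le_mul_sq (a := 0.2546 * (165 / 159)) ?_ hσ.le (by norm_num) (by norm_num)
    rw [mul_pow, hW2]
    have h1 := mul_le_mul_of_nonneg_left hν hm0.le
    have h2 := mul_le_mul_of_nonneg_right hbm hq0
    nlinarith
  have hWσ : W * σ ≤ 0.20413 := by
    refine le_of_sq_le_sq ?_ (by norm_num)
    rw [mul_pow, hW2]
    nlinarith [h.mul_sq_lt]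
  have hs2 := sqrt_two_lt
  have h9 : √2 / 2 * (m - 1) * q ≤ 0.734 * (m * σ) * σ := by
    have h10 : √2 / 2 * (m - 1) * q ≤ 0.70711 * m * q := by
      refine mul_le_mul_of_nonneg_right ?_ hq0
      nlinarith [Real.sqrt_nonneg 2]
    have h11 : 0.70711 * m * q ≤ 0.70711 * m * (165 / 159 * σ ^ 2) :=
      mul_le_mul_of_nonneg_left hq1 (by positivity)
    nlinarith [mul_pos hm0 (pow_pos hσ 2)]
  have hW7 : 2.645 ≤ W := by
    rw [hW]; exact Real.le_sqrt_of_sq_le (by norm_num; linarith)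
  have hfin : W * (0.734 * (m * σ)) + 1.3617 ≤ W := by
    -- For large $W=\sqrt m$ the hypothesis $m\sigma\le9/10$ suffices; below $4.4$ the bound
    -- $m\sigma=W\cdot W\sigma\le0.20413\,W$ is better.
    rcases le_or_gt 4.4 W with hc | hc
    · nlinarith
    · have : m * σ ≤ 0.20413 * W := by
        rw [← hW2]; nlinarith
      nlinarith
  have hmain : W * (p + √2 / 2 * (m - 1) * q + ν) ≤ W * σ := by
    nlinarith [mul_le_mul_of_nonneg_left h9 hW0.le, mul_le_mul_of_nonneg_right hfin hσ.le]
  have := le_of_mul_le_mul_left hmain hW0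
  have hτ : 0 ≤ 2 * L / √(6 * m) := by positivity
  linarith

/-- The bound for the mean operator distance to a constant kernel, when there are many edges. -/
theorem ManyLoops.bound_operator (h : ManyLoops m σ δ L) (hmσ : 9 / 10 ≤ m * σ)
    (hq0 : 0 ≤ q) (hq : q * (1 - b) ≤ σ ^ 2) (hν : ν ^ 2 ≤ b * q) (hb : b = 6 / (25 * m - 10)) :
    √(b / m + b ^ 2) * √2 + ν ≤ σ + 2 * L / √(6 * m) := by
  have hσ := h.pos
  have hL := h.L_pos
  have hm1 := h.one_le
  have hm0 : 0 < m := by linarith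
  -- From $m\sigma\ge9/10$ and $m\sigma^2<1/24$: $m>24\cdot0.81$.
  have hm : 19.4 ≤ m := by
    have h1 : (9 / 10) ^ 2 ≤ (m * σ) ^ 2 := pow_le_pow_left₀ (by norm_num) hmσ 2
    nlinarith [h.mul_sq_lt]
  have hb0 : 0 ≤ b := by
    rw [hb]; exact div_nonneg (by norm_num) (by linarith)
  have hbm : b * m ≤ 0.24506 := by
    rw [hb, div_mul_eq_mul_div, div_le_iff₀ (by linarith)]; linarith
  have hb1 : b ≤ 0.01264 := by
    rw [hb, div_le_iff₀ (by linarith)]; linarith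
  have hq1 : q ≤ 1.013 * σ ^ 2 := by nlinarith
  have hν' : ν ≤ 0.1132 * σ := by
    refine le_mul_of_sq_le_mul_sq (a := 0.01264 * 1.013) ?_ hσ.le (by norm_num) (by norm_num)
    nlinarith
  have hα : √(b / m + b ^ 2) * √2 ≤ 0.8682 * σ := by
    rw [← Real.sqrt_mul (by positivity), Real.sqrt_le_left (by positivity), mul_pow]
    have h1 : (b / m + b ^ 2) * m ^ 2 ≤ 0.30512 := by
      have : (b / m + b ^ 2) * m ^ 2 = b * m + (b * m) ^ 2 := by field_simp
      rw [this]
      nlinarith [mul_nonneg hb0 hm0.le]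
    have h2 : (9 / 10) ^ 2 ≤ (m * σ) ^ 2 := pow_le_pow_left₀ (by norm_num) hmσ 2
    have h3 : (b / m + b ^ 2) * 2 * m ^ 2 ≤ 0.8682 ^ 2 * σ ^ 2 * m ^ 2 := by nlinarith
    exact le_of_mul_le_mul_right h3 (by positivity)
  have hτ : 0 ≤ 2 * L / √(6 * m) := by positivity
  linarith

/-- Without many loops, the second moment bound suffices. -/
theorem sq_bound_of_few_loops (hm : 1 ≤ m) (hσ : 0 ≤ σ) (hL : 0 ≤ L)
    (hδ : δ ≤ σ ^ 2 ∨ (δ - σ ^ 2) ^ 2 ≤ 8 / 3 * m * σ ^ 2 * L ^ 2) :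
    (1 - 1 / m) * σ ^ 2 + δ / m + 4 * L ^ 2 / (6 * m) ≤ (σ + 2 * L / √(6 * m)) ^ 2 := by
  have hm0 : 0 < m := by linarith
  set τ := 2 * L / √(6 * m) with hτ
  have hτ0 : 0 ≤ τ := by positivity
  have hτ2 : τ ^ 2 = 4 * L ^ 2 / (6 * m) := by
    rw [hτ, div_pow, Real.sq_sqrt (by positivity)]; ring
  have hkey : δ - σ ^ 2 ≤ 2 * m * σ * τ := by
    rcases hδ with h | h
    · have : 0 ≤ 2 * m * σ * τ := by positivity
      linarith
    · refine le_of_sq_le_sq (h.trans_eq ?_) (by positivity)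
      rw [mul_pow, mul_pow, mul_pow, hτ2]
      field_simp
      ring
  have h1 : (1 - 1 / m) * σ ^ 2 + δ / m = σ ^ 2 + (δ - σ ^ 2) / m := by field_simp; ring
  rw [← hτ2, h1]
  have h2 : (δ - σ ^ 2) / m ≤ 2 * σ * τ := by
    rw [div_le_iff₀ hm0]; linarith
  nlinarith

end Numeric

/-! ### Convergence of the sampled operator -/

section Operator

open Polynomial

theorem integral_sqrt_le_sqrt_integral {Ω : Type*} [MeasurableSpace Ω] {P : Measure Ω}
    [IsProbabilityMeasure P] {f : Ω → ℝ} (h0 : ∀ ω, 0 ≤ f ω) (hf : Integrable f P)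
    (hs : Integrable (fun ω => √(f ω)) P) : ∫ ω, √(f ω) ∂P ≤ √(∫ ω, f ω ∂P) :=
  Real.strictConcaveOn_sqrt.concaveOn.le_map_integral Real.continuous_sqrt.continuousOn
    isClosed_Ici (Filter.Eventually.of_forall h0) hf hs

variable {m : ℕ} [NeZero m] {L A : ℝ} {V : unitInterval → unitInterval → ℝ} {h : ℝ[X]}

theorem norm_aeval_op_sub_aeval_stepKernel_le {K : unitInterval → unitInterval → ℝ}
    (hK : IsBoundedKernel K) (hKs : ∀ u v, K u v = K v u) {M : Matrix (Fin m) (Fin m) ℝ}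
    (hM : ∀ i j, |M i j| ≤ 1) (hMs : ∀ i j, M i j = M j i)
    (hD : IsBoundedKernel fun u v => stepKernel M u v - K u v) (hA : 0 ≤ A)
    (hh : ∀ x ∈ Set.Icc (-1 : ℝ) 1, ∀ y ∈ Set.Icc (-1 : ℝ) 1,
      |h.eval x - h.eval y| ≤ A * |x - y|) (f : Lp ℝ 2 (volume : Measure unitInterval)) :
    ‖aeval (hK.op volume) h f - aeval ((isBoundedKernel_stepKernel hM).op volume) h f‖
      ≤ A * ‖f‖ * √(∫ v, ∫ u, (stepKernel M u v - K u v) ^ 2) := by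
  have := finiteDimensional_range_op_stepKernel hM
  refine norm_aeval_sub_aeval_le_of_hilbertSchmidt (hK.op_isSymmetric hKs) hK.norm_op_le
    ((isBoundedKernel_stepKernel hM).op_isSymmetric fun u v => hMs _ _)
    (isBoundedKernel_stepKernel hM).norm_op_le hA hh (fun d e he => ?_) f
  refine le_trans (le_of_eq ?_) (hD.sum_norm_op_sq_le he)
  refine Finset.sum_congr rfl fun i _ => ?_
  rw [← (isBoundedKernel_stepKernel hM).op_sub_op hK hD, norm_sub_rev]

/-- The integral operator of the step kernel of a graph. -/
def graphOp (s : VertexPair m → Bool) :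
    Lp ℝ 2 (volume : Measure unitInterval) →ₗ[ℝ] Lp ℝ 2 (volume : Measure unitInterval) :=
  (isBoundedKernel_stepKernel (edgeMatrix_abs_le s)).op volume

theorem graphOp_isSymmetric (s : VertexPair m → Bool) : (graphOp s).IsSymmetric :=
  (isBoundedKernel_stepKernel (edgeMatrix_abs_le s)).op_isSymmetric fun _ _ => edgeMatrix_symm s _ _

theorem norm_graphOp_le (s : VertexPair m → Bool) (f : Lp ℝ 2 (volume : Measure unitInterval)) :
    ‖graphOp s f‖ ≤ ‖f‖ :=
  (isBoundedKernel_stepKernel (edgeMatrix_abs_le s)).norm_op_le f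

theorem IsLipschitzGraphon.norm_aeval_graphOp_sub_le (hV : IsLipschitzGraphon L V) (hA : 0 ≤ A)
    (hh : ∀ x ∈ Set.Icc (-1 : ℝ) 1, ∀ y ∈ Set.Icc (-1 : ℝ) 1,
      |h.eval x - h.eval y| ≤ A * |x - y|) (s : VertexPair m → Bool)
    (f : Lp ℝ 2 (volume : Measure unitInterval)) :
    ‖aeval (graphOp s) h f - aeval (hV.isBoundedKernel.op volume) h f‖
      ≤ A * ‖f‖ * √(kernelDistSq V s) := by
  rw [norm_sub_rev]
  exact norm_aeval_op_sub_aeval_stepKernel_le hV.isBoundedKernel hV.symm (edgeMatrix_abs_le s)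
    (edgeMatrix_symm s) (hV.isBoundedKernel_sub s) hA hh f

theorem kernelDistSq_nonneg (V : unitInterval → unitInterval → ℝ) (s : VertexPair m → Bool) :
    0 ≤ kernelDistSq V s :=
  integral_nonneg fun _ => integral_nonneg fun _ => sq_nonneg _

theorem integral_sqrt_kernelDistSq_le_sqrt [IsProbabilityMeasure (graphSampleLaw V m)] :
    ∫ ω, √(kernelDistSq V ω.2) ∂(graphSampleLaw V m)
      ≤ √(∫ ω, kernelDistSq V ω.2 ∂(graphSampleLaw V m)) := by
  have h1 : Integrable (fun ω : GraphSample m => kernelDistSq V ω.2) (graphSampleLaw V m) :=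
    integrable_snd (kernelDistSq V)
  have h2 : Integrable (fun ω : GraphSample m => √(kernelDistSq V ω.2)) (graphSampleLaw V m) :=
    integrable_snd fun s => √(kernelDistSq V s)
  exact integral_sqrt_le_sqrt_integral (fun ω => kernelDistSq_nonneg V ω.2) h1 h2

theorem IsLipschitzGraphon.integral_sqrt_kernelDistSq_le (hV : IsLipschitzGraphon L V)
    [IsProbabilityMeasure (graphSampleLaw V m)] :
    ∫ ω, √(kernelDistSq V ω.2) ∂(graphSampleLaw V m)
      ≤ √((1 - 1 / m) * (∫ u, ∫ v, edgeVariance V u v) + (∫ u, edgeVariance V u u) / m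
        + 4 * L ^ 2 / (6 * m)) :=
  integral_sqrt_kernelDistSq_le_sqrt.trans
    (Real.sqrt_le_sqrt (hV.integral_kernelDistSq_le (m := m)))

/-- If the edge variances are small, the kernel is close to `0` or close to `1`. -/
theorem IsLipschitzGraphon.exists_abs_sub_le (hV : IsLipschitzGraphon L V)
    (hg : ∀ u v, edgeVariance V u v ≤ 6 / 25) :
    ∃ c : ℝ, (c = 0 ∨ c = 1) ∧ ∀ u v, |V u v - c| ≤ 2 / 5 := by
  have hpt : ∀ u v, V u v ≤ 2 / 5 ∨ 3 / 5 ≤ V u v := by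
    intro u v
    by_contra hcon
    push Not at hcon
    have := hg u v
    rw [edgeVariance] at this
    nlinarith [mul_pos (sub_pos.2 hcon.1) (sub_pos.2 hcon.2)]
  by_cases hall : ∀ u v, V u v ≤ 2 / 5
  · exact ⟨0, Or.inl rfl, fun u v => by
      rw [sub_zero, abs_of_nonneg (hV.mem u v).1]; exact hall u v⟩
  · push Not at hall
    obtain ⟨u₀, v₀, h₀⟩ := hall
    refine ⟨1, Or.inr rfl, fun u v => ?_⟩
    rw [abs_of_nonpos (by linarith [(hV.mem u v).2])]
    by_contra hcon
    have h1 : V u v ≤ 1 / 2 := by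
      rcases hpt u v with h | h
      · linarith
      · exact absurd (by linarith) hcon
    have h2 : 1 / 2 ≤ V u₀ v₀ := by
      rcases hpt u₀ v₀ with h | h
      · linarith
      · linarith
    obtain ⟨z, hz⟩ := mem_range_of_exists_le_of_exists_ge hV.lip.continuous
      ⟨(u, v), h1⟩ ⟨(u₀, v₀), h2⟩
    have hz' : V z.1 z.2 = 1 / 2 := hz
    rcases hpt z.1 z.2 with h | h <;> rw [hz'] at h <;> norm_num at h

/-! ### Comparison with a constant kernel -/

section Constant

variable {c b : ℝ}

theorem IsLipschitzGraphon.isBoundedKernel_const_sub (hV : IsLipschitzGraphon L V)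
    (hc : c = 0 ∨ c = 1) : IsBoundedKernel fun u v => c - V u v where
  measurable := measurable_const.sub hV.measurable
  abs_le u v := by
    rw [abs_sub_comm]
    exact hV.abs_sub_le_one hc u v

theorem IsLipschitzGraphon.norm_aeval_const_sub_le (hV : IsLipschitzGraphon L V)
    (hc : c = 0 ∨ c = 1) (hA : 0 ≤ A)
    (hh : ∀ x ∈ Set.Icc (-1 : ℝ) 1, ∀ y ∈ Set.Icc (-1 : ℝ) 1,
      |h.eval x - h.eval y| ≤ A * |x - y|) (f : Lp ℝ 2 (volume : Measure unitInterval)) :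
    ‖aeval ((isBoundedKernel_const hc).op volume) h f - aeval (hV.isBoundedKernel.op volume) h f‖
      ≤ A * ‖f‖ * √(∫ u, ∫ v, |V u v - c| ^ 2) := by
  -- A constant kernel is the step kernel of a $1\times1$ matrix, so the general comparison applies.
  have hM : ∀ i j : Fin 1, |Matrix.of (fun _ _ : Fin 1 => c) i j| ≤ 1 := fun i j => by
    rcases hc with rfl | rfl <;> simp
  have := norm_aeval_op_sub_aeval_stepKernel_le (h := h) hV.isBoundedKernel hV.symm hM
    (fun i j => rfl) (hV.isBoundedKernel_const_sub hc) hA hh f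
  rw [norm_sub_rev]
  refine this.trans_eq ?_
  congr 2
  refine integral_congr_ae (Filter.Eventually.of_forall fun v => ?_)
  refine integral_congr_ae (Filter.Eventually.of_forall fun u => ?_)
  simp only [stepKernel, Matrix.of_apply]
  rw [sq_abs, hV.symm v u]
  ring

theorem norm_aeval_graphOp_sub_const_le (hc : c = 0 ∨ c = 1) (hA : 0 ≤ A)
    (hh : ∀ x ∈ Set.Icc (-1 : ℝ) 1, ∀ y ∈ Set.Icc (-1 : ℝ) 1,
      |h.eval x - h.eval y| ≤ A * |x - y|) (s : VertexPair m → Bool)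
    (f : Lp ℝ 2 (volume : Measure unitInterval)) :
    ‖aeval (graphOp s) h f - aeval ((isBoundedKernel_const hc).op volume) h f‖
      ≤ A * ‖f‖ * √(kernelDistSq (fun _ _ => c) s) := by
  rw [norm_sub_rev]
  exact norm_aeval_op_sub_aeval_stepKernel_le (isBoundedKernel_const hc) (fun _ _ => rfl)
    (edgeMatrix_abs_le s) (edgeMatrix_symm s) (isBoundedKernel_edgeMatrix_sub hc s) hA hh f

/-- Splitting off the mean of a function diagonalizes a constant kernel. -/
theorem exists_add_eq_of_const (hc : c = 0 ∨ c = 1)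
    (f : Lp ℝ 2 (volume : Measure unitInterval)) :
    ∃ f₁ f₂ : Lp ℝ 2 (volume : Measure unitInterval), f = f₁ + f₂ ∧ ‖f₁‖ + ‖f₂‖ ≤ √2 * ‖f‖ ∧
      (isBoundedKernel_const hc).op volume f₁ = c • f₁ ∧
      (isBoundedKernel_const hc).op volume f₂ = (0 : ℝ) • f₂ := by
  set e : Lp ℝ 2 (volume : Measure unitInterval) := stepLp 1 (fun _ => 1) with he
  have hee : ∀ᵐ u, e u = 1 := coeFn_stepLp (m := 1) fun _ => 1
  have hnorm : ‖e‖ ^ 2 = 1 := by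
    rw [Lp.norm_sq_eq_integral]
    rw [integral_congr_ae (g := fun _ => (1 : ℝ)) (by filter_upwards [hee] with u hu; simp [hu])]
    simp
  have hop : ∀ g : Lp ℝ 2 (volume : Measure unitInterval),
      (isBoundedKernel_const hc).op volume g = (c * inner ℝ e g) • e := by
    intro g
    refine Lp.ext ?_
    filter_upwards [(isBoundedKernel_const hc).coeFn_op g, hee,
      Lp.coeFn_smul (c * inner ℝ e g) e] with u h1 h2 h3
    rw [h1, h3, Pi.smul_apply, h2, smul_eq_mul, mul_one, integral_const_mul, L2.inner_def]
    congr 1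
    refine integral_congr_ae ?_
    filter_upwards [hee] with v hv
    simp [hv]
  have hin : inner ℝ e e = (1 : ℝ) := by rw [real_inner_self_eq_norm_sq, hnorm]
  set a : ℝ := inner ℝ e f with ha
  have hne : ‖e‖ = 1 := by
    have := norm_nonneg e
    nlinarith
  have hf2 : ‖f - a • e‖ ^ 2 = ‖f‖ ^ 2 - a ^ 2 := by
    rw [norm_sub_sq_real, inner_smul_right, real_inner_comm, ← ha, norm_smul, hne, mul_one,
      Real.norm_eq_abs, sq_abs]
    ring
  refine ⟨a • e, f - a • e, by abel, ?_, ?_, ?_⟩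
  · have h1 : ‖a • e‖ ^ 2 = a ^ 2 := by rw [norm_smul, hne, mul_one, Real.norm_eq_abs, sq_abs]
    have h2 : √2 ^ 2 = 2 := Real.sq_sqrt (by norm_num)
    refine le_of_sq_le_sq ?_ (by positivity)
    rw [mul_pow, h2]
    nlinarith [sq_nonneg (‖a • e‖ - ‖f - a • e‖)]
  · rw [hop, inner_smul_right, hin, mul_one, smul_smul]
  · rw [hop, inner_sub_right, inner_smul_right, hin, ← ha]
    simp

/-- Only two eigenvectors of the constant kernel are involved, the mean of `f` and the rest, so the
second moment at a fixed function replaces the full Hilbert-Schmidt norm; the price is the factor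
$\sqrt2$ from $\|f_1\|+\|f_2\|\le\sqrt2\|f\|$. -/
theorem IsLipschitzGraphon.integral_norm_aeval_graphOp_sub_const_le (hV : IsLipschitzGraphon L V)
    [IsProbabilityMeasure (graphSampleLaw V m)]
    (hc : c = 0 ∨ c = 1) (hb : ∀ u v, |V u v - c| ≤ b) (hA : 0 ≤ A)
    (hh : ∀ x ∈ Set.Icc (-1 : ℝ) 1, ∀ y ∈ Set.Icc (-1 : ℝ) 1,
      |h.eval x - h.eval y| ≤ A * |x - y|) (f : Lp ℝ 2 (volume : Measure unitInterval)) :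
    ∫ ω, ‖aeval (graphOp ω.2) h f - aeval ((isBoundedKernel_const hc).op volume) h f‖
        ∂(graphSampleLaw V m)
      ≤ A * ‖f‖ * (√(b / m + b ^ 2) * √2) := by
  obtain ⟨f₁, f₂, hf, hnorm, h₁, h₂⟩ := exists_add_eq_of_const hc f
  have hcm : c ∈ Set.Icc (-1 : ℝ) 1 := by rcases hc with rfl | rfl <;> norm_num
  have hpt : ∀ s : VertexPair m → Bool,
      ‖aeval (graphOp s) h f - aeval ((isBoundedKernel_const hc).op volume) h f‖
        ≤ A * (‖(isBoundedKernel_edgeMatrix_sub hc s).op volume f₁‖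
          + ‖(isBoundedKernel_edgeMatrix_sub hc s).op volume f₂‖) := by
    intro s
    have key := norm_aeval_sub_aeval_le (ι := Fin 2) (S := graphOp s)
      (B := (isBoundedKernel_const hc).op volume) (β := ![c, 0]) (v := ![f₁, f₂])
      (graphOp_isSymmetric s) (norm_graphOp_le s) hA hh
      (fun i => by fin_cases i <;> simp [hcm.1, hcm.2])
      (fun i => by fin_cases i; exacts [h₁, h₂])
    have hd : ∀ g, graphOp s g - (isBoundedKernel_const hc).op volume g
        = (isBoundedKernel_edgeMatrix_sub hc s).op volume g := fun g =>
      (isBoundedKernel_stepKernel (edgeMatrix_abs_le s)).op_sub_op (isBoundedKernel_const hc)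
        (isBoundedKernel_edgeMatrix_sub hc s) g
    simpa [Fin.sum_univ_two, hd, ← hf] using key
  have hE : ∀ g : Lp ℝ 2 (volume : Measure unitInterval),
      ∫ ω, ‖(isBoundedKernel_edgeMatrix_sub hc ω.2).op volume g‖ ∂(graphSampleLaw V m)
        ≤ √(b / m + b ^ 2) * ‖g‖ := by
    intro g
    have h3 := integral_sqrt_le_sqrt_integral (P := graphSampleLaw V m)
      (f := fun ω => ‖(isBoundedKernel_edgeMatrix_sub hc ω.2).op volume g‖ ^ 2)
      (fun ω => sq_nonneg _)
      (integrable_snd fun s => ‖(isBoundedKernel_edgeMatrix_sub hc s).op volume g‖ ^ 2)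
      (integrable_snd fun s => √(‖(isBoundedKernel_edgeMatrix_sub hc s).op volume g‖ ^ 2))
    simp only [Real.sqrt_sq (norm_nonneg _)] at h3
    refine h3.trans ((Real.sqrt_le_sqrt (hV.integral_norm_op_sq_le hc hb g)).trans_eq ?_)
    rw [Real.sqrt_mul' _ (sq_nonneg _), Real.sqrt_sq (norm_nonneg _)]
  have hi : ∀ g : Lp ℝ 2 (volume : Measure unitInterval), Integrable
      (fun ω => ‖(isBoundedKernel_edgeMatrix_sub hc ω.2).op volume g‖) (graphSampleLaw V m) :=
    fun g => integrable_snd fun s => ‖(isBoundedKernel_edgeMatrix_sub hc s).op volume g‖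
  calc _ ≤ ∫ ω, A * (‖(isBoundedKernel_edgeMatrix_sub hc ω.2).op volume f₁‖
          + ‖(isBoundedKernel_edgeMatrix_sub hc ω.2).op volume f₂‖) ∂(graphSampleLaw V m) :=
        integral_mono (integrable_snd fun s =>
          ‖aeval (graphOp s) h f - aeval ((isBoundedKernel_const hc).op volume) h f‖)
          (((hi f₁).add (hi f₂)).const_mul A) fun ω => hpt ω.2
    _ ≤ A * (√(b / m + b ^ 2) * ‖f₁‖ + √(b / m + b ^ 2) * ‖f₂‖) := by
        rw [integral_const_mul, integral_add (hi f₁) (hi f₂)]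
        exact mul_le_mul_of_nonneg_left (add_le_add (hE f₁) (hE f₂)) hA
    _ ≤ A * (√(b / m + b ^ 2) * (√2 * ‖f‖)) := by
        rw [← mul_add]
        gcongr
    _ = _ := by ring

end Constant

end Operator

/-! ### The mean operator error at a fixed function -/

section Operator

open Polynomial

variable {m : ℕ} {L A : ℝ} {V : unitInterval → unitInterval → ℝ} {h : ℝ[X]} {b c : ℝ}

theorem IsLipschitzKernel.integral_mono {g k : unitInterval → unitInterval → ℝ}
    (hg : Continuous (Function.uncurry g)) (hk : Continuous (Function.uncurry k))
    (hle : ∀ u v, g u v ≤ k u v) : ∫ u, ∫ v, g u v ≤ ∫ u, ∫ v, k u v := by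
  have hi : ∀ f : unitInterval → unitInterval → ℝ, Continuous (Function.uncurry f) →
      Integrable fun u => ∫ v, f u v := by
    intro f hf
    refine integrable_of_continuous_unitInterval ?_
    simpa using continuous_parametric_integral_of_continuous
      (μ := (volume : Measure unitInterval)) (f := f) hf (isCompact_univ (X := unitInterval))
  refine MeasureTheory.integral_mono (hi g hg) (hi k hk) fun u => ?_
  refine MeasureTheory.integral_mono
    (integrable_of_continuous_unitInterval (hg.comp (Continuous.prodMk_right u)))
    (integrable_of_continuous_unitInterval (hk.comp (Continuous.prodMk_right u))) fun v => hle u v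

theorem IsLipschitzGraphon.integral_abs_sub_mul_le (hV : IsLipschitzGraphon L V)
    (hc : c = 0 ∨ c = 1) (hb : ∀ u v, |V u v - c| ≤ b) :
    (∫ u, ∫ v, |V u v - c|) * (1 - b) ≤ ∫ u, ∫ v, edgeVariance V u v := by
  rw [← integral_mul_const]
  simp only [← integral_mul_const]
  refine IsLipschitzKernel.integral_mono ((hV.lip.abs_sub_const c).continuous.mul_const _)
    hV.edgeVariance_lip.continuous fun u v => ?_
  rw [hV.edgeVariance_eq hc]
  exact mul_le_mul_of_nonneg_left (by linarith [hb u v]) (abs_nonneg _)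

theorem IsLipschitzGraphon.integral_diag_abs_sub_mul_le (hV : IsLipschitzGraphon L V)
    (hc : c = 0 ∨ c = 1) (hb : ∀ u v, |V u v - c| ≤ b) :
    (∫ u, |V u u - c|) * (1 - b) ≤ ∫ u, edgeVariance V u u := by
  rw [← integral_mul_const]
  refine MeasureTheory.integral_mono (integrable_of_continuous_unitInterval
    ((hV.lip.abs_sub_const c).continuous_diag.mul_const _))
    (integrable_of_continuous_unitInterval hV.edgeVariance_lip.continuous_diag) fun u => ?_
  simp only []
  rw [hV.edgeVariance_eq hc]
  exact mul_le_mul_of_nonneg_left (by linarith [hb u u]) (abs_nonneg _)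

theorem IsLipschitzGraphon.integral_abs_sub_sq_le (hV : IsLipschitzGraphon L V)
    (hb : ∀ u v, |V u v - c| ≤ b) :
    ∫ u, ∫ v, |V u v - c| ^ 2 ≤ b * ∫ u, ∫ v, |V u v - c| := by
  rw [← integral_const_mul]
  simp only [← integral_const_mul]
  have hcont := (hV.lip.abs_sub_const c).continuous
  refine IsLipschitzKernel.integral_mono (hcont.pow 2) (hcont.const_mul b) fun u v => ?_
  rw [sq]
  exact mul_le_mul_of_nonneg_right (hb u v) (abs_nonneg _)

theorem IsLipschitzGraphon.integral_diag_abs_sub_le (hV : IsLipschitzGraphon L V) :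
    ∫ u, |V u u - c| ≤ (∫ u, ∫ v, |V u v - c|) + L / 3 := by
  have := (hV.lip.abs_sub_const c).diag_le (fun _ _ => abs_nonneg _) (t := 1)
    ⟨zero_le_one, le_rfl⟩
  simp only [one_mul, one_pow, mul_one] at this
  linarith

variable [NeZero m]

theorem IsLipschitzGraphon.integral_norm_aeval_graphOp_sub_le_of_const
    (hV : IsLipschitzGraphon L V) [IsProbabilityMeasure (graphSampleLaw V m)]
    (hc : c = 0 ∨ c = 1) (hA : 0 ≤ A)
    (hh : ∀ x ∈ Set.Icc (-1 : ℝ) 1, ∀ y ∈ Set.Icc (-1 : ℝ) 1,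
      |h.eval x - h.eval y| ≤ A * |x - y|) (f : Lp ℝ 2 (volume : Measure unitInterval)) {B : ℝ}
    (hB : ∫ ω, ‖aeval (graphOp ω.2) h f - aeval ((isBoundedKernel_const hc).op volume) h f‖
        ∂(graphSampleLaw V m) ≤ A * ‖f‖ * B) :
    ∫ ω, ‖aeval (graphOp ω.2) h f - aeval (hV.isBoundedKernel.op volume) h f‖
        ∂(graphSampleLaw V m) ≤ A * ‖f‖ * (B + √(∫ u, ∫ v, |V u v - c| ^ 2)) := by
  have hi : Integrable (fun ω : GraphSample m => ‖aeval (graphOp ω.2) h f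
      - aeval ((isBoundedKernel_const hc).op volume) h f‖) (graphSampleLaw V m) :=
    integrable_snd fun s =>
      ‖aeval (graphOp s) h f - aeval ((isBoundedKernel_const hc).op volume) h f‖
  have hi2 : Integrable (fun ω : GraphSample m => ‖aeval (graphOp ω.2) h f
      - aeval (hV.isBoundedKernel.op volume) h f‖) (graphSampleLaw V m) :=
    integrable_snd fun s =>
      ‖aeval (graphOp s) h f - aeval (hV.isBoundedKernel.op volume) h f‖
  calc _ ≤ ∫ ω : GraphSample m, (‖aeval (graphOp ω.2) h f
        - aeval ((isBoundedKernel_const hc).op volume) h f‖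
        + A * ‖f‖ * √(∫ u, ∫ v, |V u v - c| ^ 2)) ∂(graphSampleLaw V m) := by
        refine MeasureTheory.integral_mono hi2 (hi.add (integrable_const _)) fun ω => ?_
        exact (norm_sub_le_norm_sub_add_norm_sub _ _ _).trans
          (by gcongr; exact hV.norm_aeval_const_sub_le hc hA hh f)
    _ ≤ _ := by
        rw [integral_add hi (integrable_const _), integral_const, probReal_univ, one_smul, mul_add]
        gcongr

theorem IsLipschitzGraphon.integral_norm_aeval_graphOp_sub_const_le_sqrt
    (hV : IsLipschitzGraphon L V) [IsProbabilityMeasure (graphSampleLaw V m)]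
    (hc : c = 0 ∨ c = 1) (hA : 0 ≤ A)
    (hh : ∀ x ∈ Set.Icc (-1 : ℝ) 1, ∀ y ∈ Set.Icc (-1 : ℝ) 1,
      |h.eval x - h.eval y| ≤ A * |x - y|) (f : Lp ℝ 2 (volume : Measure unitInterval)) :
    ∫ ω, ‖aeval (graphOp ω.2) h f - aeval ((isBoundedKernel_const hc).op volume) h f‖
        ∂(graphSampleLaw V m)
      ≤ A * ‖f‖ * ((∫ u, |V u u - c|) + √2 / 2 * (m - 1) * ∫ u, ∫ v, |V u v - c|) := by
  have hi : Integrable (fun ω : GraphSample m => ‖aeval (graphOp ω.2) h f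
      - aeval ((isBoundedKernel_const hc).op volume) h f‖) (graphSampleLaw V m) :=
    integrable_snd fun s =>
      ‖aeval (graphOp s) h f - aeval ((isBoundedKernel_const hc).op volume) h f‖
  have hi2 : Integrable (fun ω : GraphSample m => √(kernelDistSq (fun _ _ => c) ω.2))
      (graphSampleLaw V m) := integrable_snd fun s => √(kernelDistSq (fun _ _ => c) s)
  refine (MeasureTheory.integral_mono hi (hi2.const_mul (A * ‖f‖)) fun ω =>
    norm_aeval_graphOp_sub_const_le hc hA hh ω.2 f).trans ?_
  rw [integral_const_mul]
  exact mul_le_mul_of_nonneg_left (hV.integral_sqrt_kernelDistSq_const_le hc) (by positivity)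

/-- The mean distance between a polynomial of the sampled operator and of the operator of the
kernel, when the loops contribute little to the variance. -/
theorem IsLipschitzGraphon.integral_norm_aeval_graphOp_sub_le_of_few_loops
    (hV : IsLipschitzGraphon L V) [IsProbabilityMeasure (graphSampleLaw V m)] (hA : 0 ≤ A)
    (hh : ∀ x ∈ Set.Icc (-1 : ℝ) 1, ∀ y ∈ Set.Icc (-1 : ℝ) 1,
      |h.eval x - h.eval y| ≤ A * |x - y|) (f : Lp ℝ 2 (volume : Measure unitInterval)) {σ : ℝ}
    (hσ : 0 ≤ σ) (hσ2 : σ ^ 2 = ∫ u, ∫ v, edgeVariance V u v)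
    (hfew : ∫ u, edgeVariance V u u ≤ σ ^ 2 ∨
      ((∫ u, edgeVariance V u u) - σ ^ 2) ^ 2 ≤ 8 / 3 * m * σ ^ 2 * L ^ 2) :
    ∫ ω, ‖aeval (graphOp ω.2) h f - aeval (hV.isBoundedKernel.op volume) h f‖
        ∂(graphSampleLaw V m) ≤ A * ‖f‖ * (σ + 2 * L / √(6 * m)) := by
  have hm : (1 : ℝ) ≤ m := by exact_mod_cast NeZero.pos m
  have hi : Integrable (fun ω : GraphSample m => ‖aeval (graphOp ω.2) h f
      - aeval (hV.isBoundedKernel.op volume) h f‖) (graphSampleLaw V m) :=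
    integrable_snd fun s =>
      ‖aeval (graphOp s) h f - aeval (hV.isBoundedKernel.op volume) h f‖
  have hi2 : Integrable (fun ω : GraphSample m => √(kernelDistSq V ω.2))
      (graphSampleLaw V m) := integrable_snd fun s => √(kernelDistSq V s)
  refine (MeasureTheory.integral_mono hi (hi2.const_mul (A * ‖f‖)) fun ω =>
    hV.norm_aeval_graphOp_sub_le hA hh ω.2 f).trans ?_
  rw [integral_const_mul]
  refine mul_le_mul_of_nonneg_left ((hV.integral_sqrt_kernelDistSq_le (m := m)).trans ?_)
    (by positivity)
  have hL := hV.nonneg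
  rw [← hσ2, Real.sqrt_le_left (by positivity)]
  exact sq_bound_of_few_loops hm hσ hL hfew

/-- The kernel is uniformly close to a constant `c`, so the error splits into sampled operator
against `c` and `c` against `V`. Which bound serves for the first part depends on $m\sigma$, roughly
on whether many entries differ from `c`. -/
theorem IsLipschitzGraphon.integral_norm_aeval_graphOp_sub_le_of_many_loops
    (hV : IsLipschitzGraphon L V) [IsProbabilityMeasure (graphSampleLaw V m)] (hA : 0 ≤ A)
    (hh : ∀ x ∈ Set.Icc (-1 : ℝ) 1, ∀ y ∈ Set.Icc (-1 : ℝ) 1,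
      |h.eval x - h.eval y| ≤ A * |x - y|) (f : Lp ℝ 2 (volume : Measure unitInterval)) {σ : ℝ}
    (hσ2 : σ ^ 2 = ∫ u, ∫ v, edgeVariance V u v)
    (hmany : ManyLoops m σ (∫ u, edgeVariance V u u) L) :
    ∫ ω, ‖aeval (graphOp ω.2) h f - aeval (hV.isBoundedKernel.op volume) h f‖
        ∂(graphSampleLaw V m) ≤ A * ‖f‖ * (σ + 2 * L / √(6 * m)) := by
  have hm := hmany.one_le
  have hpeak : ∀ a d : unitInterval, ∀ t ∈ Set.Icc (0 : ℝ) 1,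
      t ^ 2 * (edgeVariance V a d - L * t) ≤ σ ^ 2 := fun a d t ht => by
    rw [hσ2]
    exact hV.edgeVariance_lip.peak_le hV.nonneg hV.edgeVariance_nonneg ht a d
  have hg : ∀ u v, m * edgeVariance V u v ≤ 6 / 25 := fun u v =>
    hmany.mul_le (hV.edgeVariance_nonneg u v) (hpeak u v)
  have hg' : ∀ u v, edgeVariance V u v ≤ 6 / 25 := fun u v => by
    nlinarith [hg u v, hV.edgeVariance_nonneg u v]
  obtain ⟨c, hc, hc25⟩ := hV.exists_abs_sub_le hg'
  -- Bootstrapping with $x=|V-c|$: from $mx(1-x)\le6/25$ and $x\le2/5$ first $mx\le2/5$, hence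
  -- $mx^2\le\frac25x$, and then $(m-\frac25)x\le6/25$.
  have hb : ∀ u v, |V u v - c| ≤ 6 / (25 * m - 10) := by
    intro u v
    have h1 := hg u v
    rw [hV.edgeVariance_eq hc] at h1
    have h2 := hc25 u v
    have h3 := abs_nonneg (V u v - c)
    set x := |V u v - c|
    have h4 : m * x ≤ 2 / 5 := by
      have : m * x * (3 / 5) ≤ m * (x * (1 - x)) := by
        have := mul_le_mul_of_nonneg_left (by linarith : (3 / 5 : ℝ) ≤ 1 - x)
          (mul_nonneg (by linarith : (0 : ℝ) ≤ m) h3)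
        linarith
      linarith
    rw [le_div_iff₀ (by linarith)]
    nlinarith [mul_le_mul_of_nonneg_left h4 h3]
  have hq0 : 0 ≤ ∫ u, ∫ v, |V u v - c| :=
    integral_nonneg fun _ => integral_nonneg fun _ => abs_nonneg _
  have hp0 : 0 ≤ ∫ u, |V u u - c| := integral_nonneg fun _ => abs_nonneg _
  have hν2 : √(∫ u, ∫ v, |V u v - c| ^ 2) ^ 2 = ∫ u, ∫ v, |V u v - c| ^ 2 :=
    Real.sq_sqrt (integral_nonneg fun _ => integral_nonneg fun _ => sq_nonneg _)
  have hq : ∀ {b : ℝ}, (∀ u v, |V u v - c| ≤ b) →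
      (∫ u, ∫ v, |V u v - c|) * (1 - b) ≤ σ ^ 2 := fun hb => by
    rw [hσ2]; exact hV.integral_abs_sub_mul_le hc hb
  have hν : ∀ {b : ℝ}, (∀ u v, |V u v - c| ≤ b) →
      √(∫ u, ∫ v, |V u v - c| ^ 2) ^ 2 ≤ b * ∫ u, ∫ v, |V u v - c| := fun hb => by
    rw [hν2]; exact hV.integral_abs_sub_sq_le hb
  have hpq := hV.integral_diag_abs_sub_le (c := c)
  have hAf : 0 ≤ A * ‖f‖ := by positivity
  rcases le_or_gt (9 / 10) (m * σ) with hmσ | hmσ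
  · refine (hV.integral_norm_aeval_graphOp_sub_le_of_const hc hA hh f
      (hV.integral_norm_aeval_graphOp_sub_const_le hc hb hA hh f)).trans ?_
    exact mul_le_mul_of_nonneg_left (hmany.bound_operator hmσ hq0 (hq hb) (hν hb) rfl) hAf
  · refine (hV.integral_norm_aeval_graphOp_sub_le_of_const hc hA hh f
      (hV.integral_norm_aeval_graphOp_sub_const_le_sqrt hc hA hh f)).trans ?_
    refine mul_le_mul_of_nonneg_left ?_ hAf
    rcases Nat.lt_or_ge m 2 with hm2 | hm2
    · have hm1 : (m : ℝ) = 1 := by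
        have := NeZero.pos m
        exact_mod_cast (by omega : m = 1)
      rw [hm1] at hmany ⊢
      rcases le_or_gt (17 / 100) L with hL | hL
      · exact hmany.bound_one (hq hc25) hpq (hν hc25) (Or.inl ⟨rfl, hL⟩)
      -- The peak bound at $t=1$ gives $x(1-x)<0.17+\frac1{24}<0.31\cdot0.69$, and $x\le2/5$ selects
      -- the lower root.
      · have hb' : ∀ u v, |V u v - c| ≤ 31 / 100 := by
          intro u v
          have h1 := hpeak u v 1 ⟨zero_le_one, le_rfl⟩
          have h2 := hmany.mul_sq_lt
          have h3 := hc25 u v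
          rw [hV.edgeVariance_eq hc] at h1
          by_contra hcon
          push Not at hcon
          nlinarith
        exact hmany.bound_one (hq hb') hpq (hν hb') (Or.inr rfl)
    · rcases Nat.lt_or_ge m 7 with hm7 | hm7
      · exact hmany.bound_small (by exact_mod_cast hm2)
          (by exact_mod_cast (by omega : m ≤ 6)) hq0 (hq hb) hpq (hν hb) rfl
      · exact hmany.bound_large (by exact_mod_cast hm7) hmσ.le hq0 (hq hb) hp0
          (hV.integral_diag_abs_sub_mul_le hc hb) (hν hb) rfl

/-- The mean distance between a polynomial of the sampled operator and of the operator of the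
kernel, at a fixed function. -/
theorem IsLipschitzGraphon.integral_norm_aeval_graphOp_sub_le (hV : IsLipschitzGraphon L V)
    [IsProbabilityMeasure (graphSampleLaw V m)] (hA : 0 ≤ A)
    (hh : ∀ x ∈ Set.Icc (-1 : ℝ) 1, ∀ y ∈ Set.Icc (-1 : ℝ) 1,
      |h.eval x - h.eval y| ≤ A * |x - y|) (f : Lp ℝ 2 (volume : Measure unitInterval)) :
    ∫ ω, ‖aeval (graphOp ω.2) h f - aeval (hV.isBoundedKernel.op volume) h f‖
        ∂(graphSampleLaw V m)
      ≤ A * ‖f‖ * (√(∫ u, ∫ v, edgeVariance V u v) + 2 * L / √(6 * m)) := by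
  set σ := √(∫ u, ∫ v, edgeVariance V u v) with hσ
  have hm : (1 : ℝ) ≤ m := by exact_mod_cast NeZero.pos m
  have hσ2 : σ ^ 2 = ∫ u, ∫ v, edgeVariance V u v :=
    Real.sq_sqrt (integral_nonneg fun u => integral_nonneg fun v => hV.edgeVariance_nonneg u v)
  have hdiag : ∀ t ∈ Set.Icc (0 : ℝ) 1,
      t * (∫ u, edgeVariance V u u) - L * t ^ 2 / 3 ≤ σ ^ 2 := fun t ht => by
    rw [hσ2]
    exact hV.edgeVariance_lip.diag_le hV.edgeVariance_nonneg ht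
  by_cases hfew : ∫ u, edgeVariance V u u ≤ σ ^ 2 ∨
      ((∫ u, edgeVariance V u u) - σ ^ 2) ^ 2 ≤ 8 / 3 * m * σ ^ 2 * L ^ 2
  · exact hV.integral_norm_aeval_graphOp_sub_le_of_few_loops hA hh f (Real.sqrt_nonneg _) hσ2 hfew
  · push Not at hfew
    refine hV.integral_norm_aeval_graphOp_sub_le_of_many_loops hA hh f hσ2
      ⟨hm, ?_, hV.nonneg, hdiag, hfew.1, hfew.2⟩
    -- If $\sigma=0$, the diagonal bound at $t=\delta/L$ would read $2\delta^2/(3L)\le0$,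
    -- contradicting $\delta>0$.
    refine lt_of_le_of_ne (Real.sqrt_nonneg _) fun h0 => ?_
    have hσ0 : σ ^ 2 = 0 := by
      have : σ = 0 := h0.symm
      rw [this]; norm_num
    set δ := ∫ u, edgeVariance V u u
    have hδ := hfew.1
    rw [hσ0] at hdiag hδ
    have h1 := hdiag 1 ⟨zero_le_one, le_rfl⟩
    have hδ0 : 0 < δ := by linarith
    have hL : 0 < L := by linarith
    have h2 := hdiag (δ / L) ⟨by positivity, by rw [div_le_one hL]; linarith⟩
    have h3 : δ / L * δ - L * (δ / L) ^ 2 / 3 = 2 * δ ^ 2 / (3 * L) := by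
      field_simp
      ring
    rw [h3] at h2
    have : 0 < 2 * δ ^ 2 / (3 * L) := by positivity
    linarith

end Operator

/-! ### Convergence of the graph convolutions -/

section Convolution

open Polynomial

variable {m : ℕ} [NeZero m] {L A B : ℝ} {V : unitInterval → unitInterval → ℝ} {h : ℝ[X]}
  {X : unitInterval → ℝ}

/-- The squared `L²` distance of the empirical quantile function to the identity. -/
def quantileDistSq (v : Fin m → unitInterval) : ℝ :=
  ∫ x : unitInterval, ((sortedLatent v (cellIndex m x) : ℝ) - x) ^ 2

theorem quantileDistSq_nonneg (v : Fin m → unitInterval) : 0 ≤ quantileDistSq v :=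
  integral_nonneg fun _ => sq_nonneg _

theorem sq_coe_sub_coe_le_one (u v : unitInterval) : ((u : ℝ) - v) ^ 2 ≤ 1 := by
  rw [sq_le_one_iff_abs_le_one, abs_le]
  have := u.2.1
  have := u.2.2
  have := v.2.1
  have := v.2.2
  constructor <;> linarith

theorem measurable_sq_quantile_sub (v : Fin m → unitInterval) :
    Measurable fun x : unitInterval => ((sortedLatent v (cellIndex m x) : ℝ) - x) ^ 2 :=
  (((measurable_of_countable fun i => (sortedLatent v i : ℝ)).comp measurable_cellIndex).sub
    measurable_subtype_coe).pow_const 2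

theorem integrable_sq_quantile_sub (v : Fin m → unitInterval) :
    Integrable fun x : unitInterval => ((sortedLatent v (cellIndex m x) : ℝ) - x) ^ 2 :=
  Integrable.of_bound (measurable_sq_quantile_sub v).aestronglyMeasurable 1
    (Filter.Eventually.of_forall fun x => by
      rw [Real.norm_of_nonneg (sq_nonneg _)]
      exact sq_coe_sub_coe_le_one _ _)

theorem quantileDistSq_le_one (v : Fin m → unitInterval) : quantileDistSq v ≤ 1 := by
  refine (integral_mono (integrable_sq_quantile_sub v) (integrable_const 1)
    fun x => sq_coe_sub_coe_le_one _ _).trans_eq ?_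
  simp

theorem measurable_quantileDistSq :
    Measurable (quantileDistSq : (Fin m → unitInterval) → ℝ) := by
  have : Continuous (quantileDistSq : (Fin m → unitInterval) → ℝ) := by
    unfold quantileDistSq
    simp only [integral_quantile_sub_sq]
    fun_prop
  exact this.measurable

theorem integrable_quantileDistSq [IsProbabilityMeasure (graphSampleLaw V m)] :
    Integrable (fun ω : GraphSample m => quantileDistSq ω.1) (graphSampleLaw V m) :=
  Integrable.of_bound (measurable_quantileDistSq.comp measurable_fst).aestronglyMeasurable 1
    (Filter.Eventually.of_forall fun ω => by
      rw [Real.norm_of_nonneg (quantileDistSq_nonneg _)]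
      exact quantileDistSq_le_one _)

theorem integrable_sqrt_quantileDistSq [IsProbabilityMeasure (graphSampleLaw V m)] :
    Integrable (fun ω : GraphSample m => √(quantileDistSq ω.1)) (graphSampleLaw V m) :=
  Integrable.of_bound
    (measurable_quantileDistSq.comp measurable_fst).sqrt.aestronglyMeasurable 1
    (Filter.Eventually.of_forall fun ω => by
      rw [Real.norm_of_nonneg (Real.sqrt_nonneg _), Real.sqrt_le_one]
      exact quantileDistSq_le_one _)

theorem IsLipschitzGraphon.integral_quantileDistSq (hV : IsLipschitzGraphon L V) :
    ∫ ω : GraphSample m, quantileDistSq ω.1 ∂(graphSampleLaw V m) = 1 / (6 * m) := by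
  have hq : Measurable fun ω : GraphSample m => quantileDistSq ω.1 :=
    measurable_quantileDistSq.comp measurable_fst
  have hle : ∀ ω : GraphSample m, |quantileDistSq ω.1| ≤ 1 := fun ω => by
    rw [abs_of_nonneg (quantileDistSq_nonneg _)]
    exact quantileDistSq_le_one _
  rw [integral_graphSampleLaw hV.measurable hV.mem hq hle]
  simp only [bernoulliMean_const]
  exact integral_integral_quantile_sub_sq

theorem IsLipschitzGraphon.integral_sqrt_quantileDistSq_le (hV : IsLipschitzGraphon L V)
    [IsProbabilityMeasure (graphSampleLaw V m)] :
    ∫ ω : GraphSample m, √(quantileDistSq ω.1) ∂(graphSampleLaw V m) ≤ √(1 / (6 * m)) := by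
  have h1 : Integrable (fun ω : GraphSample m => quantileDistSq ω.1) (graphSampleLaw V m) :=
    integrable_quantileDistSq
  have h2 : Integrable (fun ω : GraphSample m => √(quantileDistSq ω.1)) (graphSampleLaw V m) :=
    integrable_sqrt_quantileDistSq
  rw [← hV.integral_quantileDistSq]
  exact integral_sqrt_le_sqrt_integral (fun ω => quantileDistSq_nonneg ω.1) h1 h2

/-- The step function of the sampled signal is close to the signal. -/
theorem norm_stepLp_graphSignal_sub_le (hX : MemLp X 2 volume) (hB : 0 ≤ B)
    (hs : ∀ u₁ u₂ : unitInterval, |X u₁ - X u₂| ≤ B * |(u₁ : ℝ) - (u₂ : ℝ)|)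
    (ω : GraphSample m) :
    ‖stepLp m (ω.graphSignal X) - hX.toLp‖ ≤ B * √(quantileDistSq ω.1) := by
  have h1 : ‖stepLp m (ω.graphSignal X) - hX.toLp‖ ^ 2 ≤ B ^ 2 * quantileDistSq ω.1 := by
    rw [Lp.norm_sq_eq_integral, quantileDistSq, ← integral_const_mul]
    refine integral_mono_of_nonneg (Filter.Eventually.of_forall fun _ => sq_nonneg _)
      ((integrable_sq_quantile_sub _).const_mul _) ?_
    filter_upwards [coeFn_stepLp (ω.graphSignal X), hX.coeFn_toLp,
      Lp.coeFn_sub (stepLp m (ω.graphSignal X)) hX.toLp] with x h1 h2 h3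
    rw [h3, Pi.sub_apply, h1, h2, ← mul_pow]
    refine sq_le_sq.2 ((hs _ _).trans_eq ?_)
    rw [abs_mul, abs_of_nonneg hB]
  calc ‖stepLp m (ω.graphSignal X) - hX.toLp‖
      = √(‖stepLp m (ω.graphSignal X) - hX.toLp‖ ^ 2) := (Real.sqrt_sq (norm_nonneg _)).symm
    _ ≤ √(B ^ 2 * quantileDistSq ω.1) := Real.sqrt_le_sqrt h1
    _ = _ := by rw [Real.sqrt_mul (sq_nonneg B), Real.sqrt_sq hB]

theorem stepLp_convolution (ω : GraphSample m) (h : ℝ[X]) (X : unitInterval → ℝ) :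
    stepLp m (ω.convolution h X) = aeval (graphOp ω.2) h (stepLp m (ω.graphSignal X)) :=
  (aeval_op_stepKernel_stepLp (edgeMatrix_abs_le ω.2) (edgeMatrix_symm ω.2) h _).symm

theorem continuous_of_abs_sub_le
    (hs : ∀ u₁ u₂ : unitInterval, |X u₁ - X u₂| ≤ B * |(u₁ : ℝ) - (u₂ : ℝ)|) : Continuous X :=
  (LipschitzWith.of_dist_le' fun u v => by
    rw [Real.dist_eq, Subtype.dist_eq, Real.dist_eq]
    exact hs u v).continuous

theorem measurable_convolution {m : ℕ} (hX : Measurable X) (h : ℝ[X]) :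
    Measurable fun ω : GraphSample m => ω.convolution h X := by
  refine measurable_from_prod_countable_left fun s => ?_
  refine measurable_pi_lambda _ fun i => ?_
  have hj : ∀ j, Measurable fun v : Fin m → unitInterval => X (sortedLatent v j) := fun j =>
    hX.comp ((measurable_pi_apply j).comp measurable_sortedLatent)
  change Measurable fun v : Fin m → unitInterval =>
    ∑ j, aeval ((m : ℝ)⁻¹ • edgeMatrix s) h i j * X (sortedLatent v j)
  exact Finset.measurable_sum _ fun j _ => (hj j).const_mul _

theorem stronglyMeasurable_stepLp_convolution (hX : Measurable X) (h : ℝ[X]) :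
    StronglyMeasurable fun ω : GraphSample m => stepLp m (ω.convolution h X) :=
  (LinearMap.continuous_of_finiteDimensional (stepLp m)).comp_stronglyMeasurable
    (measurable_convolution hX h).stronglyMeasurable

/-- Insert $h(S)X$ for the sampled operator $S$: since $|h|\le1$ on $[-1,1]$, the calculus is a
contraction and the signal error passes through unamplified. -/
theorem IsLipschitzGraphon.norm_stepLp_convolution_sub_le (hV : IsLipschitzGraphon L V)
    (hX : MemLp X 2 volume) (hB : 0 ≤ B)
    (hs : ∀ u₁ u₂ : unitInterval, |X u₁ - X u₂| ≤ B * |(u₁ : ℝ) - (u₂ : ℝ)|)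
    (hh_le : ∀ x ∈ Set.Icc (-1 : ℝ) 1, |h.eval x| ≤ 1) (ω : GraphSample m) :
    ‖stepLp m (ω.convolution h X) - aeval (hV.isBoundedKernel.op volume) h hX.toLp‖
      ≤ ‖aeval (graphOp ω.2) h hX.toLp - aeval (hV.isBoundedKernel.op volume) h hX.toLp‖
        + B * √(quantileDistSq ω.1) := by
  rw [stepLp_convolution, add_comm]
  refine (norm_sub_le_norm_sub_add_norm_sub _ (aeval (graphOp ω.2) h hX.toLp) _).trans
    (add_le_add_left ?_ _)
  rw [← map_sub]
  exact (norm_aeval_apply_le (graphOp_isSymmetric _) (norm_graphOp_le _) hh_le _).trans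
    (norm_stepLp_graphSignal_sub_le hX hB hs ω)

theorem IsLipschitzGraphon.integrable_norm_stepLp_convolution_sub (hV : IsLipschitzGraphon L V)
    [IsProbabilityMeasure (graphSampleLaw V m)] (hX : MemLp X 2 volume) (hB : 0 ≤ B)
    (hs : ∀ u₁ u₂ : unitInterval, |X u₁ - X u₂| ≤ B * |(u₁ : ℝ) - (u₂ : ℝ)|)
    (hh_le : ∀ x ∈ Set.Icc (-1 : ℝ) 1, |h.eval x| ≤ 1) :
    Integrable (fun ω : GraphSample m => ‖stepLp m (ω.convolution h X)
      - aeval (hV.isBoundedKernel.op volume) h hX.toLp‖) (graphSampleLaw V m) := by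
  refine ((integrable_snd fun s => ‖aeval (graphOp s) h hX.toLp
    - aeval (hV.isBoundedKernel.op volume) h hX.toLp‖).add
    (integrable_sqrt_quantileDistSq.const_mul B)).mono' ?_ (Filter.Eventually.of_forall fun ω => ?_)
  · exact ((stronglyMeasurable_stepLp_convolution (continuous_of_abs_sub_le hs).measurable h).sub
      stronglyMeasurable_const).norm.aestronglyMeasurable
  · rw [norm_norm]
    exact hV.norm_stepLp_convolution_sub_le hX hB hs hh_le ω

/-- The mean distance between the graph convolution and the graphon convolution. -/
theorem IsLipschitzGraphon.integral_norm_stepLp_convolution_sub_le (hV : IsLipschitzGraphon L V)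
    [IsProbabilityMeasure (graphSampleLaw V m)] (hX : MemLp X 2 volume) (hB : 0 ≤ B)
    (hs : ∀ u₁ u₂ : unitInterval, |X u₁ - X u₂| ≤ B * |(u₁ : ℝ) - (u₂ : ℝ)|) (hA : 0 ≤ A)
    (hh : ∀ x ∈ Set.Icc (-1 : ℝ) 1, ∀ y ∈ Set.Icc (-1 : ℝ) 1,
      |h.eval x - h.eval y| ≤ A * |x - y|)
    (hh_le : ∀ x ∈ Set.Icc (-1 : ℝ) 1, |h.eval x| ≤ 1) :
    ∫ ω : GraphSample m, ‖stepLp m (ω.convolution h X)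
        - aeval (hV.isBoundedKernel.op volume) h hX.toLp‖ ∂(graphSampleLaw V m)
      ≤ A * ‖hX.toLp‖ * (√(∫ u, ∫ v, edgeVariance V u v) + 2 * L / √(6 * m))
        + B * √(1 / (6 * m)) := by
  have hi : Integrable (fun ω : GraphSample m => ‖aeval (graphOp ω.2) h hX.toLp
      - aeval (hV.isBoundedKernel.op volume) h hX.toLp‖) (graphSampleLaw V m) :=
    integrable_snd fun s => ‖aeval (graphOp s) h hX.toLp
      - aeval (hV.isBoundedKernel.op volume) h hX.toLp‖
  have hq : Integrable (fun ω : GraphSample m => B * √(quantileDistSq ω.1))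
      (graphSampleLaw V m) := integrable_sqrt_quantileDistSq.const_mul B
  refine (integral_mono (hV.integrable_norm_stepLp_convolution_sub hX hB hs hh_le) (hi.add hq)
    fun ω => hV.norm_stepLp_convolution_sub_le hX hB hs hh_le ω).trans ?_
  rw [Pi.add_def, integral_add hi hq, integral_const_mul]
  exact add_le_add (hV.integral_norm_aeval_graphOp_sub_le hA hh _)
    (mul_le_mul_of_nonneg_left hV.integral_sqrt_quantileDistSq_le hB)

end Convolution

/-! ### The rescaled kernel -/

section Rescaling

theorem integral_unitInterval_comp_mul {t : ℝ} (ht : 0 < t) (f : ℝ → ℝ) :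
    ∫ u : unitInterval, f (u * t) = t⁻¹ * ∫ x in Set.Icc 0 t, f x := by
  rw [integral_unitInterval_eq fun x => f (x * t),
    intervalIntegral.integral_comp_mul_right f ht.ne', zero_mul, one_mul, smul_eq_mul,
    integral_Icc_eq_integral_Ioc, intervalIntegral.integral_of_le ht.le]

theorem setIntegral_square_eq {t : ℝ} (ht : 0 < t) {F : ℝ × ℝ → ℝ}
    (hF : ContinuousOn F (Set.Icc 0 t ×ˢ Set.Icc 0 t)) :
    ∫ z in Set.Icc 0 t ×ˢ Set.Icc 0 t, F z
      = t ^ 2 * ∫ u : unitInterval, ∫ v : unitInterval, F (u * t, v * t) := by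
  have hi : IntegrableOn F (Set.Icc 0 t ×ˢ Set.Icc 0 t) (volume.prod volume) :=
    hF.integrableOn_compact (isCompact_Icc.prod isCompact_Icc)
  rw [Measure.volume_eq_prod, setIntegral_prod F hi]
  have hin : ∀ x : ℝ, ∫ v : unitInterval, F (x, v * t) = t⁻¹ * ∫ y in Set.Icc 0 t, F (x, y) :=
    fun x => integral_unitInterval_comp_mul ht fun y => F (x, y)
  simp only [hin]
  rw [integral_const_mul, integral_unitInterval_comp_mul ht fun x => ∫ y in Set.Icc 0 t, F (x, y)]
  field_simp

end Rescaling

/-! ### From the sparse model to a Lipschitz graphon -/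

section Model

variable {G : SparseGraphModel} {A : ℝ} {N : ℕ}

theorem nonneg_of_abs_sub_le (hR : ∀ u₁ v₁ u₂ v₂ : ℝ, 0 ≤ u₁ → 0 ≤ v₁ → 0 ≤ u₂ → 0 ≤ v₂ →
      |G.kernel u₁ v₁ - G.kernel u₂ v₂| ≤ A * (|u₁ - u₂| + |v₁ - v₂|)) : 0 ≤ A := by
  have := (abs_nonneg _).trans (hR 1 0 0 0 zero_le_one le_rfl le_rfl le_rfl)
  simpa using this

theorem isLipschitzGraphon_graphon (hN : 0 < N)
    (hR : ∀ u₁ v₁ u₂ v₂ : ℝ, 0 ≤ u₁ → 0 ≤ v₁ → 0 ≤ u₂ → 0 ≤ v₂ →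
      |G.kernel u₁ v₁ - G.kernel u₂ v₂| ≤ A * (|u₁ - u₂| + |v₁ - v₂|)) :
    IsLipschitzGraphon (A * G.scale N) (G.graphon N) := by
  have ht := G.scale_pos N hN
  have h0 : ∀ u : unitInterval, 0 ≤ (u : ℝ) * G.scale N := fun u => mul_nonneg u.2.1 ht.le
  refine ⟨fun u v => G.kernel_symm _ _ (h0 u) (h0 v), fun u v => G.kernel_mem _ _ (h0 u) (h0 v),
    fun u v u' v' => ?_, mul_nonneg (nonneg_of_abs_sub_le hR) ht.le⟩
  refine (hR _ _ _ _ (h0 u) (h0 v) (h0 u') (h0 v')).trans_eq ?_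
  rw [← sub_mul, ← sub_mul, abs_mul, abs_mul, abs_of_pos ht]
  ring

theorem continuousOn_kernel (hR : ∀ u₁ v₁ u₂ v₂ : ℝ, 0 ≤ u₁ → 0 ≤ v₁ → 0 ≤ u₂ → 0 ≤ v₂ →
      |G.kernel u₁ v₁ - G.kernel u₂ v₂| ≤ A * (|u₁ - u₂| + |v₁ - v₂|)) (t : ℝ) :
    ContinuousOn (fun z : ℝ × ℝ => G.kernel z.1 z.2) (Set.Icc 0 t ×ˢ Set.Icc 0 t) := by
  have hA := nonneg_of_abs_sub_le hR
  refine (LipschitzOnWith.of_dist_le_mul (K := (2 * A).toNNReal) fun z hz w hw => ?_).continuousOn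
  rw [Real.coe_toNNReal _ (by positivity), Real.dist_eq]
  refine (hR _ _ _ _ hz.1.1 hz.2.1 hw.1.1 hw.2.1).trans ?_
  have h1 : |z.1 - w.1| ≤ dist z w := le_max_left _ _
  have h2 : |z.2 - w.2| ≤ dist z w := le_max_right _ _
  nlinarith

theorem aestronglyMeasurable_kernel (hR : ∀ u₁ v₁ u₂ v₂ : ℝ, 0 ≤ u₁ → 0 ≤ v₁ → 0 ≤ u₂ → 0 ≤ v₂ →
      |G.kernel u₁ v₁ - G.kernel u₂ v₂| ≤ A * (|u₁ - u₂| + |v₁ - v₂|)) (t : ℝ) :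
    AEStronglyMeasurable (fun z : ℝ × ℝ => G.kernel z.1 z.2)
      (volume.restrict (Set.Icc 0 t ×ˢ Set.Icc 0 t)) :=
  (continuousOn_kernel hR t).aestronglyMeasurable (measurableSet_Icc.prod measurableSet_Icc)

theorem kernelNorm_one_eq (hN : 0 < N)
    (hR : ∀ u₁ v₁ u₂ v₂ : ℝ, 0 ≤ u₁ → 0 ≤ v₁ → 0 ≤ u₂ → 0 ≤ v₂ →
      |G.kernel u₁ v₁ - G.kernel u₂ v₂| ≤ A * (|u₁ - u₂| + |v₁ - v₂|)) :
    G.kernelNorm 1 N = G.scale N ^ 2 * ∫ u, ∫ v, G.graphon N u v := by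
  unfold SparseGraphModel.kernelNorm
  rw [toReal_eLpNorm (aestronglyMeasurable_kernel hR _),
    lpNorm_one_eq_integral_norm (aestronglyMeasurable_kernel hR _)]
  refine Eq.trans ?_ (setIntegral_square_eq (G.scale_pos N hN) (continuousOn_kernel hR _))
  refine setIntegral_congr_fun (measurableSet_Icc.prod measurableSet_Icc) fun z hz => ?_
  exact Real.norm_of_nonneg (G.kernel_mem _ _ hz.1.1 hz.2.1).1

theorem kernelNorm_two_sq_eq (hN : 0 < N)
    (hR : ∀ u₁ v₁ u₂ v₂ : ℝ, 0 ≤ u₁ → 0 ≤ v₁ → 0 ≤ u₂ → 0 ≤ v₂ →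
      |G.kernel u₁ v₁ - G.kernel u₂ v₂| ≤ A * (|u₁ - u₂| + |v₁ - v₂|)) :
    G.kernelNorm 2 N ^ 2 = G.scale N ^ 2 * ∫ u, ∫ v, G.graphon N u v ^ 2 := by
  unfold SparseGraphModel.kernelNorm
  rw [toReal_eLpNorm (aestronglyMeasurable_kernel hR _),
    lpNorm_eq_integral_norm_rpow_toReal two_ne_zero ENNReal.ofNat_ne_top
      (aestronglyMeasurable_kernel hR _), ← Real.rpow_natCast, ← Real.rpow_mul
      (integral_nonneg fun _ => by positivity)]
  simp only [ENNReal.toReal_ofNat, Nat.cast_ofNat, Real.rpow_ofNat, Real.norm_eq_abs, sq_abs]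
  rw [inv_mul_cancel₀ two_ne_zero, Real.rpow_one]
  exact setIntegral_square_eq (G.scale_pos N hN) (F := fun z => G.kernel z.1 z.2 ^ 2)
    ((continuousOn_kernel hR _).pow 2)

/-- The norms of the kernel give the mean edge variance of the graphon. -/
theorem sqrt_kernelNorm_div_scale (hN : 0 < N)
    (hR : ∀ u₁ v₁ u₂ v₂ : ℝ, 0 ≤ u₁ → 0 ≤ v₁ → 0 ≤ u₂ → 0 ≤ v₂ →
      |G.kernel u₁ v₁ - G.kernel u₂ v₂| ≤ A * (|u₁ - u₂| + |v₁ - v₂|)) :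
    √(G.kernelNorm 1 N - G.kernelNorm 2 N ^ 2) / G.scale N
      = √(∫ u, ∫ v, edgeVariance (G.graphon N) u v) := by
  have ht := G.scale_pos N hN
  have hV := isLipschitzGraphon_graphon hN hR
  have hc : Continuous (Function.uncurry (G.graphon N)) := hV.lip.continuous
  have hc2 : Continuous (Function.uncurry fun u v => G.graphon N u v ^ 2) := hc.pow 2
  have hi : ∀ f : unitInterval → unitInterval → ℝ, Continuous (Function.uncurry f) →
      Integrable fun u => ∫ v, f u v := by
    intro f hf
    refine integrable_of_continuous_unitInterval ?_
    simpa using continuous_parametric_integral_of_continuous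
      (μ := (volume : Measure unitInterval)) (f := f) hf (isCompact_univ (X := unitInterval))
  have hj : ∀ f : unitInterval → unitInterval → ℝ, Continuous (Function.uncurry f) →
      ∀ u, Integrable fun v => f u v := fun f hf u =>
    integrable_of_continuous_unitInterval (hf.comp (Continuous.prodMk_right u))
  have h1 : ∫ u, ∫ v, edgeVariance (G.graphon N) u v
      = (∫ u, ∫ v, G.graphon N u v) - ∫ u, ∫ v, G.graphon N u v ^ 2 := by
    rw [← integral_sub (hi _ hc) (hi _ hc2)]
    refine integral_congr_ae (Filter.Eventually.of_forall fun u => ?_)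
    simp only []
    rw [← integral_sub (hj _ hc u) (hj _ hc2 u)]
    refine integral_congr_ae (Filter.Eventually.of_forall fun v => ?_)
    simp only [edgeVariance]
    ring
  rw [kernelNorm_one_eq hN hR, kernelNorm_two_sq_eq hN hR, h1, ← mul_sub,
    Real.sqrt_mul (sq_nonneg _), Real.sqrt_sq ht.le, mul_div_cancel_left₀ _ ht.ne']

theorem l2Norm_signal (G : SparseGraphModel) : l2Norm G.signal = ‖G.signal_memLp.toLp‖ :=
  (Lp.norm_toLp _ _).symm

theorem l2Norm_interpolate_sub {m n : ℕ} [NeZero m] [NeZero n] (y : Fin m → ℝ) (z : Fin n → ℝ) :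
    l2Norm (fun u => interpolate y u - interpolate z u) = ‖stepLp m y - stepLp n z‖ := by
  simp only [interpolate_eq]
  exact (Lp.norm_toLp _ ((memLp_step y).sub (memLp_step z))).symm

theorem responseVariation_nonneg (V : unitInterval → unitInterval → ℝ) (h : Polynomial ℝ) :
    0 ≤ responseVariation V h :=
  Real.iInf_nonneg fun _ => Real.iSup_nonneg fun _ => abs_nonneg _

end Model

end

/-! ### The bound for two coupled samples -/

theorem theorem2
    {Ω : Type*} [MeasurableSpace Ω] (P : Measure Ω) [IsProbabilityMeasure P]
    (G : SparseGraphModel) (N n : ℕ) (hN : 0 < N) (hn : 0 < n)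
    (A_R A_s A_h : ℝ)
    (hR : ∀ u₁ v₁ u₂ v₂ : ℝ, 0 ≤ u₁ → 0 ≤ v₁ → 0 ≤ u₂ → 0 ≤ v₂ →
      |G.kernel u₁ v₁ - G.kernel u₂ v₂| ≤ A_R * (|u₁ - u₂| + |v₁ - v₂|))
    (hs : ∀ u₁ u₂ : unitInterval,
      |G.signal u₁ - G.signal u₂| ≤ A_s * |(u₁ : ℝ) - (u₂ : ℝ)|)
    (h : Polynomial ℝ)
    (hh : ∀ x ∈ Set.Icc (-1 : ℝ) 1, ∀ y ∈ Set.Icc (-1 : ℝ) 1,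
      |h.eval x - h.eval y| ≤ A_h * |x - y|)
    (hh_le : ∀ x ∈ Set.Icc (-1 : ℝ) 1, |h.eval x| ≤ 1)
    -- the large graph and the downsampled graph, on a common probability space
    (Γ : Ω → GraphSample N) (γ : Ω → GraphSample n)
    (hΓ : HasLaw Γ (graphSampleLaw (G.graphon N) N) P)
    (hγ : HasLaw γ (graphSampleLaw (G.graphon N) n) P) :
    Integrable (fun ω => l2Norm (fun u =>
        interpolate ((Γ ω).convolution h G.signal) u
          - interpolate ((γ ω).convolution h G.signal) u)) P ∧
    ∫ ω, l2Norm (fun u =>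
        interpolate ((Γ ω).convolution h G.signal) u
          - interpolate ((γ ω).convolution h G.signal) u) ∂P
      ≤ 2 * A_h * l2Norm G.signal *
          (√(G.kernelNorm 1 N - G.kernelNorm 2 N ^ 2) / G.scale N
            + A_R * G.scale N / √(6 * N) + A_R * G.scale N / √(6 * n))
        + A_s / √6 * (1 / √N + 1 / √n)
        + 4 * responseVariation (G.graphon N) h * l2Norm G.signal := by
  have : NeZero N := ⟨hN.ne'⟩
  have : NeZero n := ⟨hn.ne'⟩
  have := hΓ.isProbabilityMeasure_iff.1 ‹_›
  have := hγ.isProbabilityMeasure_iff.1 ‹_›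
  have hAs : 0 ≤ A_s := by
    have := (abs_nonneg _).trans (hs 1 0)
    simpa using this
  have hAh : 0 ≤ A_h := by
    have := (abs_nonneg _).trans (hh 1 (by norm_num) 0 (by norm_num))
    simpa using this
  have hV := isLipschitzGraphon_graphon hN hR
  have hX : Measurable G.signal := (continuous_of_abs_sub_le hs).measurable
  set f := G.signal_memLp.toLp
  set y := Polynomial.aeval (hV.isBoundedKernel.op volume) h f
  have hsample : ∀ {m : ℕ} [NeZero m] {g : Ω → GraphSample m},
      HasLaw g (graphSampleLaw (G.graphon N) m) P →
      AEStronglyMeasurable (fun ω => stepLp m ((g ω).convolution h G.signal)) P ∧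
      Integrable (fun ω => ‖stepLp m ((g ω).convolution h G.signal) - y‖) P ∧
      ∫ ω, ‖stepLp m ((g ω).convolution h G.signal) - y‖ ∂P
        ≤ A_h * ‖f‖ * (√(∫ u, ∫ v, edgeVariance (G.graphon N) u v)
          + 2 * (A_R * G.scale N) / √(6 * m)) + A_s / √6 * (1 / √m) := by
    intro m _ g hg
    have := hg.isProbabilityMeasure_iff.1 ‹_›
    have hi := hV.integrable_norm_stepLp_convolution_sub (m := m) G.signal_memLp hAs hs hh_le
    refine ⟨(stronglyMeasurable_stepLp_convolution hX h).aestronglyMeasurable.comp_aemeasurable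
      hg.aemeasurable, ?_, ?_⟩
    · rw [← hg.map_eq] at hi
      exact hi.comp_aemeasurable hg.aemeasurable
    · refine (hg.integral_comp hi.aestronglyMeasurable).trans_le
        ((hV.integral_norm_stepLp_convolution_sub_le G.signal_memLp hAs hs hAh hh hh_le).trans_eq ?_)
      rw [Real.sqrt_div zero_le_one, Real.sqrt_one, Real.sqrt_mul (by norm_num : (0 : ℝ) ≤ 6)]
      congr 1
      field_simp
  obtain ⟨hm1, hi1, hb1⟩ := hsample hΓ
  obtain ⟨hm2, hi2, hb2⟩ := hsample hγ
  simp only [l2Norm_interpolate_sub]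
  have hle : ∀ ω, ‖stepLp N ((Γ ω).convolution h G.signal)
      - stepLp n ((γ ω).convolution h G.signal)‖
      ≤ ‖stepLp N ((Γ ω).convolution h G.signal) - y‖
        + ‖stepLp n ((γ ω).convolution h G.signal) - y‖ := fun ω => by
    rw [norm_sub_rev (stepLp n _) y]
    exact norm_sub_le_norm_sub_add_norm_sub _ _ _
  have hi : Integrable (fun ω => ‖stepLp N ((Γ ω).convolution h G.signal)
      - stepLp n ((γ ω).convolution h G.signal)‖) P :=
    (hi1.add hi2).mono' (hm1.sub hm2).norm (Filter.Eventually.of_forall fun ω => by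
      rw [norm_norm]; exact hle ω)
  refine ⟨hi, (integral_mono hi (hi1.add hi2) hle).trans ?_⟩
  rw [Pi.add_def, integral_add hi1 hi2, sqrt_kernelNorm_div_scale hN hR, l2Norm_signal]
  -- The two one-graph bounds already add up to the other terms; this one enters only through its
  -- sign.
  have hv : 0 ≤ 4 * responseVariation (G.graphon N) h * ‖f‖ :=
    mul_nonneg (mul_nonneg (by norm_num) (responseVariation_nonneg _ _)) (norm_nonneg _)
  refine (add_le_add hb1 hb2).trans (le_trans (le_of_eq ?_) (le_add_of_nonneg_right hv))
  ring
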